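/- **Setting.** Let $G=(V,A)$ be a finite directed graph with $n=|V|$, let $B>0$, and let $g:A\to[-B,B]$ be a gain function. A car at $x$ with charge $b$ can traverse $xy\in A$ iff $b+g(xy)\ge 0$, and then reaches $y$ with charge $\min\{b+g(xy),B\}$. For a path $P$ (not necessarily simple; the one-vertex path is allowed) let $\alpha_b(P)$ be the charge at its end when it is started with charge $b$, with $\alpha_b(P)=-\infty$ if $P$ cannot be traversed, and let $\alpha_b(s,t)$ be the maximum of $\alpha_b(P)$ over all paths $P$ from $s$ to $t$ ($-\infty$ if there is none). **Theorem.** For every $c>0$ the positive constants $c_1,\dots,c_5$ below can be chosen, depending only on $c$, such that for all $G,g,B$ as above the following holds. Let $M$ be the random table returned by Compute-Shortcuts$(G)$. Then with probability at least $1-n^{-c}$ the table returned by MFC$(M)$ equals $\alpha_B(s,t)$ for all $s,t\in V$ simultaneously. **Algorithm.** All logarithms are to base 2, numbers of iterations are rounded up, probabilities are clipped to $[0,1]$, a maximum over the empty set is $-\infty$, and all random choices are independent. $\mathrm{Sample}(p)$ returns a random subset of $V$ that contains each vertex independently with probability $p$. A table $M$ has entries $M[x][y]$; a data structure $D$ has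 entries $D[x][y]$, $D[xy][z]$ and $D[x][yz]$. "$e\leftarrow_{\max}r$" means $e\leftarrow\max\{e,r\}$. $\mathrm{InitDS}(M)$ has $D[x][y]=D[x][xy]=D[xy][y]=M[x][y]$ and all other entries $-\infty$. *Compute-Shortcuts(G).* Start with $M[i][i]=0$, $M[i][j]=g(ij)$ for $ij\in A$, and $M[i][j]=-\infty$ otherwise (for a loop $ii\in A$, $M[i][i]=\max\{0,g(ii)\}$). Apply $M\leftarrow$ Update-Shortcuts$(M)$ $c_1\log^2 n$ times and return $M$. *Update-Shortcuts(M).* Let $r=\lceil c_2\sqrt n\rceil$ and $M'=M$. Repeat $r$ times: with probability $\log n/r$ set $M'\leftarrow\max\{M',\text{Long-Shortcuts}(M)\}$; then set $M\leftarrow$ Short-Shortcuts$(M)$. Return $\max\{M,M'\}$. *Short-Shortcuts(M).* For tables $M,N$ let $(M\circ N)[x][z]$ be the maximum over $y$ of: $M[x][y]+N[y][z]$ if both summands are $\ge0$; otherwise $\min\{M[x][y],0\}+\min\{N[y][z],0\}$ if this is $\ge -B$. Put $M_2=M\circ M$, $M_3=M\circ M_2$. The returned entry at $(x,z)$ is the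 maximum of $M[x][z]$, $M_2[x][z]$, $M_3[x][z]$ and of the following values for all $y\in V$, where $m=M[x][y]$. (a) If $m\ge0$: let $k=\max\{M[y][a]+M[a][z] : -m\le M[y][a]\le 0\}$; the value is $m+k$ if $m+k\ge m$. (b) If $m\le 0$: let $k=\max\{M[y][a]+M[a][z] : 0\le M[y][a]\le |m|\}$; the value is $m+k$ if $-B\le m+k\le m$, and the value is $m$ if $m+k\ge m$. (c) If $m\le 0$: the value is $\min\{m,\ \max\{M[a][z] : M[y][a]\ge |m|\}\}$. *Breadth-Search(M,D).* Say that $m'$ opposes $m$ if $m\ge0$ and $-m\le m'\le0$, or $m<0$ and $0\le m'\le|m|$. For all $x,y,z$, with the old entries on the right-hand sides, $D[xy][z]\leftarrow_{\max} M[x][y]+\max\{D[ya][z] : M[y][a]\text{ opposes }M[x][y]\}$ and $D[z][yx]\leftarrow_{\max} \max\{D[z][ay] : M[a][y]\text{ opposes }M[y][x]\}+M[y][x]$. *Concatenate(M,D,U,W,X).* Let $D_0$ be a copy of $D$. For all $(u,v,w,x)\in U\times V\times W\times X$, one after the other: if $M[u][v]<0$, $D[uv][x]\leftarrow_{\max}D[uv][w]+\max\{D_0[wa][x]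 : -(D[uv][w]-M[u][v])\le M[w][a]\le 0\}$; then, if $M[v][u]<0$, $D[x][vu]\leftarrow_{\max}\max\{D_0[x][aw] : -(D[w][vu]-M[v][u])\le M[a][w]\le0\}+D[w][vu]$. *Concatenate-Opposite(M,D,U,W,X).* Let $D_0$ be a copy of $D$. For all $(u,v,w,x)\in U\times V\times W\times X$, one after the other: if $M[u][v]<0$, first $D[uv][x]\leftarrow_{\max}D[uv][w]+\max\{D_0[w][ax] : M[a][x]\ge0,\ M[a][x]-D_0[w][ax]\le D[uv][w]-M[u][v],\ D_0[w][ax]\le|D[uv][w]|\}$, and then, if some $a$ has $M[a][x]\ge 0$, $D_0[w][ax]\ge|D[uv][w]|$ and $M[a][x]\le|M[u][v]|$, set $D[uv][x]\leftarrow0$; after that, if $M[v][u]<0$, first $D[x][vu]\leftarrow_{\max}\max\{D_0[xa][w] : M[x][a]\ge0,\ M[x][a]-D_0[xa][w]\le D[w][vu]-M[v][u],\ D_0[xa][w]\le|D[w][vu]|\}+D[w][vu]$, and then, if some $a$ has $M[x][a]\ge0$, $D_0[xa][w]\ge|D[w][vu]|$ and $M[x][a]\le|M[v][u]|$, set $D[x][vu]\leftarrow0$.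 *Compute-Funnels(M).* Let $s=c_4n^{2/3}$ and $D=\mathrm{InitDS}(M)$. Run Breadth-Search$(M,D)$ $n/s$ times; let $S\leftarrow\mathrm{Sample}(c_5\log n\cdot s/n)$; run Concatenate$(M,D,S,S,S)$ $\log n$ times; run Concatenate$(M,D,S,S,V)$ once; run Breadth-Search$(M,D)$ $n/s$ times; return $D$. *Arc-Bounded-To-Monotone(M,D,T).* For all $(u,v,x,y)\in T\times V^3$: if $M[u][v]\le0$, with $\sigma=D[uv][x]+M[x][y]$: if $-B\le\sigma\le M[u][v]$ then $D[u][y]\leftarrow_{\max}\sigma$; if $\sigma\ge M[u][v]$ then $D[u][y]\leftarrow_{\max}M[u][v]$; if $\sigma\ge0$ then $D[v][y]\leftarrow_{\max}-M[u][v]+\sigma$; if $M[v][u]\le0$, with $\sigma=M[y][x]+D[x][vu]$: if $-B\le\sigma\le M[v][u]$ then $D[y][u]\leftarrow_{\max}\sigma$; if $\sigma\ge M[v][u]$ then $D[y][u]\leftarrow_{\max}M[v][u]$; if $\sigma\ge0$ then $D[y][v]\leftarrow_{\max}\sigma-M[v][u]$. *Long-Shortcuts(M).* Let $D\leftarrow$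 Compute-Funnels$(M)$ and $T=\emptyset$. For $i=1,\dots,\lceil\log(\sqrt n\log^2 n)\rceil$: let $T_i\leftarrow\mathrm{Sample}(c_3\log^2n/(2^i\sqrt n))$; repeat $2^i$ times Concatenate-Opposite$(M,D,T_i,V,V)$ followed by Concatenate$(M,D,T_i,V,V)$; set $T\leftarrow T\cup T_i$. Then run Arc-Bounded-To-Monotone$(M,D,T)$ and return the table of the entries $D[x][y]$. *MFC(M).* Let $H$ be the directed graph with vertices $v^0,v^B$ for $v\in V$ and the arcs: $x^0z^0$ if some $y$ has $M[x][y]\ge0$ and $M[x][y]+M[y][z]\ge0$; $x^0y^B$ if $M[x][y]\ge B$, or $M[x][y]>0$ and $M[x][y]+M[y][x]>0$; $x^By^0$ if $M[x][y]\ne-\infty$; $x^Bz^B$ if some $y$ has $M[y][z]\ge0$ and $M[x][y]+M[y][z]\ge0$. Let $H^*$ be its transitive closure. Let $D\leftarrow$ Compute-Funnels$(M)$ (with fresh randomness) and $A_B[y][t]=\max\{B+D[yx][t] : x\in V,\ M[y][x]\le0\}$. The returned entry at $(s,t)$ is the maximum of $A_B[y][t]$ over all $y$ with $s^By^B\in H^*$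 and, if $s^Bt^B\in H^*$, of $B$. -/

import Mathlib

open scoped ENNReal

noncomputable section

open Classical

namespace ElectricCar

universe u

/-! ### Charge dynamics and maximum final charges

Charges and table entries are extended reals; `⊥` is the value `-∞`. -/

/-- The charge after an arc of gain `a`, entered with charge `b`, when the capacity is `B`
(`⊥` if the arc cannot be traversed). -/
def arcCharge (B : ℝ) (b : EReal) (a : ℝ) : EReal :=
  if 0 ≤ b + (a : EReal) then min (b + (a : EReal)) (B : EReal) else ⊥

/-- The charge at the end of the walk given by a list of vertices, started with charge `b`. -/
def finalCharge {V : Type u} (g : V → V → ℝ) (B : ℝ) : EReal → List V → EReal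
  | b, [] => b
  | b, [_] => b
  | b, x :: y :: l => finalCharge g B (arcCharge B b (g x y)) (y :: l)

/-- `P` is a (not necessarily simple) path from `s` to `t`; `[s]` is a path from `s` to `s`. -/
def IsPath {V : Type u} (G : Digraph V) (s t : V) (P : List V) : Prop :=
  P.head? = some s ∧ P.getLast? = some t ∧ P.IsChain G.Adj

/-- The maximum final charge `α_b(s, t)`. -/
def maxFinalCharge {V : Type u} (G : Digraph V) (g : V → V → ℝ) (B : ℝ) (b : ℝ) (s t : V) :
    EReal :=
  ⨆ P : {P : List V // IsPath G s t P}, finalCharge g B (b : EReal) P.1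

/-! ### Randomness -/

/-- A biased coin: `true` with probability `p`, where `p` is first clipped to `[0, 1]`. -/
def coin (p : ℝ) : PMF Bool :=
  PMF.ofFintype
    (fun b => cond b (ENNReal.ofReal (max 0 (min p 1))) (ENNReal.ofReal (1 - max 0 (min p 1))))
    (by
      have h0 : (0 : ℝ) ≤ max 0 (min p 1) := le_max_left _ _
      have h1 : max 0 (min p 1) ≤ 1 := max_le zero_le_one (min_le_right _ _)
      rw [Fintype.sum_bool]
      simp only [cond_true, cond_false]
      rw [← ENNReal.ofReal_add h0 (by linarith)]
      simp)

/-- Independent inclusion of each member of the list with probability `p`. -/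
def sampleList {V : Type u} (p : ℝ) : List V → PMF (Finset V)
  | [] => PMF.pure ∅
  | v :: l => (coin p).bind fun b => (sampleList p l).bind fun S =>
      PMF.pure (if b = true then insert v S else S)

/-- The random set that contains every vertex independently with probability `p`. -/
def sample (V : Type u) [Fintype V] (p : ℝ) : PMF (Finset V) :=
  sampleList p (Finset.univ : Finset V).toList

/-- `k` successive applications of a randomized update. -/
def repeatRandom {α : Type u} (f : α → PMF α) : ℕ → α → PMF α
  | 0, a => PMF.pure a
  | k + 1, a => (f a).bind (repeatRandom f k)

/-- The constants hidden in the `Θ`-notation of the algorithm. -/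
structure HiddenConstants where
  /-- number of outer iterations, `cOuter * log² n` -/
  cOuter : ℝ
  /-- number of inner iterations, `cInner * n ^ (1/2)` -/
  cInner : ℝ
  /-- sampling rate in the computation of long shortcuts -/
  cLong : ℝ
  /-- the parameter `s = cFunnel * n ^ (2/3)` in the computation of funnels -/
  cFunnel : ℝ
  /-- sampling rate in the computation of funnels -/
  cSample : ℝ
  cOuter_pos : 0 < cOuter
  cInner_pos : 0 < cInner
  cLong_pos : 0 < cLong
  cFunnel_pos : 0 < cFunnel
  cSample_pos : 0 < cSample

/-! ### Tables -/

/-- The absolute value on the extended reals. -/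
def eabs (a : EReal) : EReal := max a (-a)

/-- The data structure `D`: `mono x y` is `D[x][y]`, `first x y z` is `D[xy][z]` and
`last x y z` is `D[x][yz]`. -/
structure Tables (V : Type u) where
  mono : V → V → EReal
  first : V → V → V → EReal
  last : V → V → V → EReal

namespace Tables

variable {V : Type u}

/-- The assignment `D[uv][x] ← r`. -/
def setFirst (D : Tables V) (u v x : V) (r : EReal) : Tables V :=
  { D with first := fun u' v' x' => if u' = u ∧ v' = v ∧ x' = x then r else D.first u' v' x' }

/-- The assignment `D[x][vu] ← r`. -/
def setLast (D : Tables V) (x v u : V) (r : EReal) : Tables V :=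
  { D with last := fun x' v' u' => if x' = x ∧ v' = v ∧ u' = u then r else D.last x' v' u' }

end Tables

/-- `D[x][y] = D[x][xy] = D[xy][y] = M[x][y]`, and `⊥` elsewhere. -/
def initDS {V : Type u} (M : V → V → EReal) : Tables V where
  mono := M
  first x y z := if z = y then M x y else ⊥
  last x y z := if y = x then M y z else ⊥

/-! ### Short shortcuts -/

section

variable {V : Type u} [Fintype V]

/-- Shortcuts of an arc of `M` followed by an arc of `N`: ascending if both gains are
nonnegative, and otherwise descending, with charge drops. -/
def combine (B : ℝ) (M N : V → V → EReal) (x z : V) : EReal :=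
  ⨆ y, if 0 ≤ M x y ∧ 0 ≤ N y z then M x y + N y z
    else if -(B : EReal) ≤ min (M x y) 0 + min (N y z) 0 then min (M x y) 0 + min (N y z) 0
    else ⊥

/-- The table with all 2-shortcuts and the easy 3-shortcuts. -/
def trivialShortcuts (B : ℝ) (M : V → V → EReal) (x z : V) : EReal :=
  max (M x z) (max (combine B M M x z) (combine B M (combine B M M) x z))

/-- The largest gain of `y a z` over the `a` with `-M[x][y] ≤ M[y][a] ≤ 0`. -/
def gainAbove (M : V → V → EReal) (x y z : V) : EReal :=
  ⨆ a, if -(M x y) ≤ M y a ∧ M y a ≤ 0 then M y a + M a z else ⊥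

/-- The largest gain of `y a z` over the `a` with `0 ≤ M[y][a] ≤ |M[x][y]|`. -/
def gainBelow (M : V → V → EReal) (x y z : V) : EReal :=
  ⨆ a, if 0 ≤ M y a ∧ M y a ≤ eabs (M x y) then M y a + M a z else ⊥

/-- The largest `M[a][z]` over the `a` with `|M[x][y]| ≤ M[y][a]`. -/
def lastArcOver (M : V → V → EReal) (x y z : V) : EReal :=
  ⨆ a, if eabs (M x y) ≤ M y a then M a z else ⊥

/-- The candidates of the three remaining sign patterns of 3-shortcuts, via `y`. -/
def hardShortcut (B : ℝ) (M : V → V → EReal) (x y z : V) : EReal :=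
  max (if 0 ≤ M x y ∧ M x y ≤ M x y + gainAbove M x y z then M x y + gainAbove M x y z else ⊥) <|
  max (if M x y ≤ 0 ∧ M x y + gainBelow M x y z ≤ M x y ∧
        -(B : EReal) ≤ M x y + gainBelow M x y z then M x y + gainBelow M x y z else ⊥) <|
  max (if M x y ≤ 0 ∧ M x y ≤ M x y + gainBelow M x y z then M x y else ⊥)
    (if M x y ≤ 0 then min (M x y) (lastArcOver M x y z) else ⊥)

/-- Short-Shortcuts. -/
def shortShortcuts (B : ℝ) (M : V → V → EReal) (x z : V) : EReal :=
  max (trivialShortcuts B M x z) (⨆ y, hardShortcut B M x y z)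

/-! ### Funnels -/

/-- An arc of gain `m` adjacent to an arc of gain `c` is of the opposite sign and not longer:
`m ∈ [-c, 0]` if `c ≥ 0`, and `m ∈ [0, |c|]` if `c < 0`. -/
def Opposing (c m : EReal) : Prop :=
  if 0 ≤ c then -c ≤ m ∧ m ≤ 0 else 0 ≤ m ∧ m ≤ eabs c

/-- Breadth-Search: all queries are answered by range trees built beforehand. -/
def breadthSearch (M : V → V → EReal) (D : Tables V) : Tables V where
  mono := D.mono
  first x y z := max (D.first x y z)
    (M x y + ⨆ a, if Opposing (M x y) (M y a) then D.first y a z else ⊥)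
  last z y x := max (D.last z y x)
    ((⨆ a, if Opposing (M y x) (M a y) then D.last z a y else ⊥) + M y x)

/-- The list of all quadruples of a product of four sets of vertices, in some fixed order. -/
def quadruples (U Y W X : Finset V) : List (V × V × V × V) :=
  (U ×ˢ Y ×ˢ W ×ˢ X).toList

/-- First half of the body of Concatenate (paths bounded by the first arc `uv`). `D₀` is the
data structure from which the range trees were built, `D` the current one. -/
def concatenateFirst (M : V → V → EReal) (D₀ D : Tables V) (u v w x : V) : Tables V :=
  if M u v < 0 then
    D.setFirst u v x (max (D.first u v x)
      (D.first u v w + ⨆ a, if -(D.first u v w - M u v) ≤ M w a ∧ M w a ≤ 0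
        then D₀.first w a x else ⊥))
  else D

/-- Second half of the body of Concatenate (paths bounded by the last arc `vu`). -/
def concatenateLast (M : V → V → EReal) (D₀ D : Tables V) (u v w x : V) : Tables V :=
  if M v u < 0 then
    D.setLast x v u (max (D.last x v u)
      ((⨆ a, if -(D.last w v u - M v u) ≤ M a w ∧ M a w ≤ 0
        then D₀.last x a w else ⊥) + D.last w v u))
  else D

/-- Concatenate. -/
def concatenate (M : V → V → EReal) (U W X : Finset V) (D₀ : Tables V) : Tables V :=
  (quadruples U Finset.univ W X).foldl
    (fun D q => concatenateLast M D₀ (concatenateFirst M D₀ D q.1 q.2.1 q.2.2.1 q.2.2.2)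
      q.1 q.2.1 q.2.2.1 q.2.2.2) D₀

/-- The base-2 logarithm of the number of vertices. -/
def logn (V : Type u) [Fintype V] : ℝ := Real.logb 2 (Fintype.card V)

/-- The parameter `s = Θ(n ^ (2/3))`. -/
def funnelParam (κ : HiddenConstants) (V : Type u) [Fintype V] : ℝ :=
  κ.cFunnel * (Fintype.card V : ℝ) ^ (2 / 3 : ℝ)

/-- `⌈n / s⌉` applications of Breadth-Search. -/
def breadthRounds (κ : HiddenConstants) (M : V → V → EReal) (D : Tables V) : Tables V :=
  (breadthSearch M)^[⌈(Fintype.card V : ℝ) / funnelParam κ V⌉₊] D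

/-- Compute-Funnels. -/
def computeFunnels (κ : HiddenConstants) (M : V → V → EReal) : PMF (Tables V) :=
  (sample V (κ.cSample * logn V * funnelParam κ V / (Fintype.card V : ℝ))).bind fun S =>
    PMF.pure <|
      let D₁ := breadthRounds κ M (initDS M)
      let D₂ := (concatenate M S S S)^[⌈logn V⌉₊] D₁
      let D₃ := concatenate M S S Finset.univ D₂
      breadthRounds κ M D₃

/-! ### Long shortcuts -/

/-- First half of the body of Concatenate-Opposite: a path bounded by the negative first arc `uv`
is continued by a path bounded by its nonnegative last arc `ax`. -/
def concatenateOppositeFirst (M : V → V → EReal) (D₀ D : Tables V) (u v w x : V) : Tables V :=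
  if M u v < 0 then
    let D' := D.setFirst u v x (max (D.first u v x)
      (D.first u v w + ⨆ a, if 0 ≤ M a x ∧ M a x - D₀.last w a x ≤ D.first u v w - M u v ∧
        D₀.last w a x ≤ eabs (D.first u v w) then D₀.last w a x else ⊥))
    if ∃ a, 0 ≤ M a x ∧ eabs (D'.first u v w) ≤ D₀.last w a x ∧ M a x ≤ eabs (M u v)
    then D'.setFirst u v x 0 else D'
  else D

/-- Second half of the body of Concatenate-Opposite: a path bounded by the negative last arc `vu`
is preceded by a path bounded by its nonnegative first arc `xa`. -/
def concatenateOppositeLast (M : V → V → EReal) (D₀ D : Tables V) (u v w x : V) : Tables V :=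
  if M v u < 0 then
    let D' := D.setLast x v u (max (D.last x v u)
      ((⨆ a, if 0 ≤ M x a ∧ M x a - D₀.first x a w ≤ D.last w v u - M v u ∧
        D₀.first x a w ≤ eabs (D.last w v u) then D₀.first x a w else ⊥) + D.last w v u))
    if ∃ a, 0 ≤ M x a ∧ eabs (D'.last w v u) ≤ D₀.first x a w ∧ M x a ≤ eabs (M v u)
    then D'.setLast x v u 0 else D'
  else D

/-- Concatenate-Opposite. -/
def concatenateOpposite (M : V → V → EReal) (U W X : Finset V) (D₀ : Tables V) : Tables V :=
  (quadruples U Finset.univ W X).foldl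
    (fun D q => concatenateOppositeLast M D₀
      (concatenateOppositeFirst M D₀ D q.1 q.2.1 q.2.2.1 q.2.2.2)
      q.1 q.2.1 q.2.2.1 q.2.2.2) D₀

/-- Arc-Bounded-To-Monotone: the resulting shortcut table. Each supremum collects the values that
are assigned, over all quadruples in `T × V³`, to the entry `p q`. -/
def arcBoundedToMonotone (B : ℝ) (M : V → V → EReal) (T : Finset V) (D : Tables V) (p q : V) :
    EReal :=
  let fwd : V → V → V → V → EReal := fun u v x y => D.first u v x + M x y
  let bwd : V → V → V → V → EReal := fun u v x y => M y x + D.last x v u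
  max (D.mono p q) <|
  max (⨆ v, ⨆ x, if p ∈ T ∧ M p v ≤ 0 ∧ -(B : EReal) ≤ fwd p v x q ∧ fwd p v x q ≤ M p v
        then fwd p v x q else ⊥) <|
  max (⨆ v, ⨆ x, if p ∈ T ∧ M p v ≤ 0 ∧ M p v ≤ fwd p v x q then M p v else ⊥) <|
  max (⨆ u, ⨆ x, if u ∈ T ∧ M u p ≤ 0 ∧ 0 ≤ fwd u p x q then -(M u p) + fwd u p x q else ⊥) <|
  max (⨆ v, ⨆ x, if q ∈ T ∧ M v q ≤ 0 ∧ -(B : EReal) ≤ bwd q v x p ∧ bwd q v x p ≤ M v q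
        then bwd q v x p else ⊥) <|
  max (⨆ v, ⨆ x, if q ∈ T ∧ M v q ≤ 0 ∧ M v q ≤ bwd q v x p then M v q else ⊥)
    (⨆ u, ⨆ x, if u ∈ T ∧ M q u ≤ 0 ∧ 0 ≤ bwd u q x p then bwd u q x p - M q u else ⊥)

/-- The sampling loop of Long-Shortcuts: `k` iterations, the first of which has index `i`. -/
def longLoop (κ : HiddenConstants) (M : V → V → EReal) :
    ℕ → ℕ → Tables V × Finset V → PMF (Tables V × Finset V)
  | 0, _, st => PMF.pure st
  | k + 1, i, st =>
    (sample V (κ.cLong * logn V ^ 2 / (2 ^ i * (Fintype.card V : ℝ) ^ (1 / 2 : ℝ)))).bind fun Tᵢ =>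
      longLoop κ M k (i + 1)
        ((fun D => concatenate M Tᵢ Finset.univ Finset.univ
            (concatenateOpposite M Tᵢ Finset.univ Finset.univ D))^[2 ^ i] st.1,
          st.2 ∪ Tᵢ)

/-- Long-Shortcuts. -/
def longShortcuts (κ : HiddenConstants) (B : ℝ) (M : V → V → EReal) : PMF (V → V → EReal) :=
  (computeFunnels κ M).bind fun D =>
    (longLoop κ M ⌈Real.logb 2 ((Fintype.card V : ℝ) ^ (1 / 2 : ℝ) * logn V ^ 2)⌉₊ 1
      (D, ∅)).bind fun st =>
        PMF.pure (arcBoundedToMonotone B M st.2 st.1)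

/-! ### The first stage -/

/-- The initial table: `0` on the diagonal and the gains of the arcs. -/
def initialShortcuts (G : Digraph V) (g : V → V → ℝ) (i j : V) : EReal :=
  max (if i = j then 0 else ⊥) (if G.Adj i j then (g i j : EReal) else ⊥)

/-- The number `r` of inner iterations. -/
def innerRounds (κ : HiddenConstants) (V : Type u) [Fintype V] : ℕ :=
  ⌈κ.cInner * (Fintype.card V : ℝ) ^ (1 / 2 : ℝ)⌉₊

/-- An inner iteration of Update-Shortcuts, acting on the pair `(M, M')`. -/
def innerIteration (κ : HiddenConstants) (B : ℝ) (st : (V → V → EReal) × (V → V → EReal)) :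
    PMF ((V → V → EReal) × (V → V → EReal)) :=
  (coin (logn V / innerRounds κ V)).bind fun b =>
    if b = true then
      (longShortcuts κ B st.1).bind fun L => PMF.pure (shortShortcuts B st.1, st.2 ⊔ L)
    else PMF.pure (shortShortcuts B st.1, st.2)

/-- Update-Shortcuts. -/
def updateShortcuts (κ : HiddenConstants) (B : ℝ) (M : V → V → EReal) : PMF (V → V → EReal) :=
  (repeatRandom (innerIteration κ B) (innerRounds κ V) (M, M)).bind fun st =>
    PMF.pure (st.1 ⊔ st.2)

/-- Compute-Shortcuts. -/
def computeShortcuts (κ : HiddenConstants) (G : Digraph V) (g : V → V → ℝ) (B : ℝ) :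
    PMF (V → V → EReal) :=
  repeatRandom (updateShortcuts κ B) ⌈κ.cOuter * logn V ^ 2⌉₊ (initialShortcuts G g)

/-! ### The second stage -/

/-- The graph `H` on `V × {0, B}`: `(v, false)` stands for `v⁰` and `(v, true)` for `vᴮ`. -/
def H (B : ℝ) (M : V → V → EReal) : V × Bool → V × Bool → Prop
  | (x, false), (z, false) => ∃ y, 0 ≤ M x y + M y z ∧ 0 ≤ M x y
  | (x, false), (y, true) => (B : EReal) ≤ M x y ∨ (0 < M x y + M y x ∧ 0 < M x y)
  | (x, true), (y, false) => M x y ≠ ⊥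
  | (x, true), (z, true) => ∃ y, 0 ≤ M x y + M y z ∧ 0 ≤ M y z

/-- The transitive closure `H*` of `H`. -/
def HStar (B : ℝ) (M : V → V → EReal) : V × Bool → V × Bool → Prop :=
  Relation.TransGen (H B M)

/-- The table `A_B`. -/
def tableA (B : ℝ) (M : V → V → EReal) (D : Tables V) (y t : V) : EReal :=
  ⨆ x, if M y x ≤ 0 then (B : EReal) + D.first y x t else ⊥

/-- The table that is returned, computed from `H*` and `A_B`. -/
def chargeTable (B : ℝ) (M : V → V → EReal) (D : Tables V) (s t : V) : EReal :=
  max (if HStar B M (s, true) (t, true) then (B : EReal) else ⊥)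
    (⨆ y, if HStar B M (s, true) (y, true) then tableA B M D y t else ⊥)

/-- Algorithm MFC. -/
def mfc (κ : HiddenConstants) (B : ℝ) (M : V → V → EReal) : PMF (V → V → EReal) :=
  (computeFunnels κ M).bind fun D => PMF.pure (chargeTable B M D)

/-- Both stages: Compute-Shortcuts, and then MFC on the shortcut table it returns. -/
def allPairsMFC (κ : HiddenConstants) (G : Digraph V) (g : V → V → ℝ) (B : ℝ) :
    PMF (V → V → EReal) :=
  (computeShortcuts κ G g B).bind (mfc κ B)

end

end ElectricCar

end

open scoped ENNReal

set_option linter.unusedSectionVars false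

noncomputable section

open Classical

namespace ElectricCar

universe u

/-! ### Expectations over probability mass functions -/

/-! The argument separates soundness, which holds for every random outcome, from completeness, which
holds with high probability. Soundness says that each entry of each table is realized by an actual
drive. It is proved for an abstract `ChargeRel`, because reversing the graph and replacing charges
by deficits gives another such relation. A statement about walks bounded by their last arc is
therefore the mirror image of one about walks bounded by their first arc (`SoundTables.of_swap`,
`funnelsOf_swap`, `longRound_swap`).

Funnels. An alternating walk with shrinking gains stays between its first two levels, so funnel
entries can be concatenated. A best funnel with given first arc and end may be assumed to leave no
vertex twice along a negative arc, except possibly its first vertex. A sample that hits every window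
of `n / s` arcs of such a funnel lets repeated doubling find it (`funnelsOf_complete`). A union
bound over one best funnel per triple of vertices gives `computeFunnels_prob`.

First stage. Consider a simple path whose levels lie between those of its ends. Where two
consecutive gains agree in sign, or the middle one of three alternating gains is the smallest, there
is a defect, and short shortcuts contract the path. With at least about `l / √n` defects on `l`
arcs, a round of short shortcuts saves a fraction of order `1 / √n` (`short_progress`). With fewer
defects, in one of the two directions a constant fraction of the arcs start long excursions, which
stay within the range of their first arc for at least `2√n` arcs and contain few defects
(`card_goodArcs`). An excursion of about `2 ^ i √n` arcs has fewer than `2 ^ i` defects. A round of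
the long-shortcut loop crosses a defect-free stretch (`longRound_advance`), so `2 ^ i` rounds
suffice. Sampled excursions are then skipped greedily, which saves a fraction of order `1 / log n`
(`longShortcuts_prob`). An update thus either finds enough short savings or many iterations in which
long shortcuts are likely to help, and it saves a fraction of order `1 / log n` with constant
probability (`updateShortcuts_prob`). Markov's inequality after `log² n` updates gives
`computeShortcuts_prob` and `captures_prob`.

Second stage. On a table that captures all such paths, `H*` witnesses every run between empty and
full charges, because a gaining lap can be pumped up to the capacity (`Run.hStar`). After its last
full vertex, an optimal run is simple and stays below the capacity. Its optimality makes the table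
exact on each stretch whose charges lie between those of its ends (`BelowRun.tight`). Cutting at
successive last extrema turns the run into a funnel (`exists_funnel_walk`), which the funnel table
dominates. With soundness this gives `chargeTable_eq`. -/

/-- The expectation of a nonnegative extended real function. -/
def expect {α : Type*} (p : PMF α) (f : α → ℝ≥0∞) : ℝ≥0∞ := ∑' a, p a * f a

section Expect

variable {α β : Type*}

lemma expect_pure (a : α) (f : α → ℝ≥0∞) : expect (PMF.pure a) f = f a := by
  unfold expect
  rw [tsum_eq_single a]
  · simp
  · intro b hb
    simp [PMF.pure_apply, hb]

lemma expect_bind (p : PMF α) (k : α → PMF β) (f : β → ℝ≥0∞) :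
    expect (p.bind k) f = expect p fun a => expect (k a) f := by
  unfold expect
  simp only [PMF.bind_apply, ← ENNReal.tsum_mul_right, ← ENNReal.tsum_mul_left]
  rw [ENNReal.tsum_comm]
  simp only [mul_assoc]

lemma expect_mono_support (p : PMF α) {f g : α → ℝ≥0∞} (h : ∀ a ∈ p.support, f a ≤ g a) :
    expect p f ≤ expect p g := by
  refine ENNReal.tsum_le_tsum fun a => ?_
  by_cases ha : a ∈ p.support
  · exact mul_le_mul_right (h a ha) _
  · simp [(PMF.apply_eq_zero_iff p a).2 ha]

lemma expect_mono (p : PMF α) {f g : α → ℝ≥0∞} (h : ∀ a, f a ≤ g a) :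
    expect p f ≤ expect p g :=
  expect_mono_support p fun a _ => h a

lemma expect_const (p : PMF α) (c : ℝ≥0∞) : expect p (fun _ => c) = c := by
  unfold expect
  rw [ENNReal.tsum_mul_right, p.tsum_coe, one_mul]

lemma expect_add (p : PMF α) (f g : α → ℝ≥0∞) :
    expect p (fun a => f a + g a) = expect p f + expect p g := by
  unfold expect
  simp only [mul_add]
  exact ENNReal.tsum_add

lemma expect_mul_left (p : PMF α) (c : ℝ≥0∞) (f : α → ℝ≥0∞) :
    expect p (fun a => c * f a) = c * expect p f := by
  unfold expect
  rw [← ENNReal.tsum_mul_left]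
  exact tsum_congr fun a => by ring

lemma expect_sum {ι : Type*} (s : Finset ι) (p : PMF α) (f : ι → α → ℝ≥0∞) :
    expect p (fun a => ∑ i ∈ s, f i a) = ∑ i ∈ s, expect p (f i) := by
  induction s using Finset.induction_on with
  | empty => simp [expect]
  | insert i s hi ih => simp only [Finset.sum_insert hi, expect_add, ih]

/-- The indicator of the failure of a proposition. -/
def failInd (P : Prop) : ℝ≥0∞ := if P then 0 else 1

lemma failInd_of {P : Prop} (h : P) : failInd P = 0 := if_pos h

lemma failInd_of_not {P : Prop} (h : ¬P) : failInd P = 1 := if_neg h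

lemma failInd_le_one (P : Prop) : failInd P ≤ 1 := by
  unfold failInd; split_ifs <;> simp

/-- The probability that a predicate fails. -/
def failProb (p : PMF α) (P : α → Prop) : ℝ≥0∞ := expect p fun a => failInd (P a)

lemma failProb_le_one (p : PMF α) (P : α → Prop) : failProb p P ≤ 1 := by
  exact (expect_mono p (g := fun _ => 1) fun a => failInd_le_one _).trans (expect_const p 1).le

lemma failProb_mono (p : PMF α) {P Q : α → Prop} (h : ∀ a ∈ p.support, P a → Q a) :
    failProb p Q ≤ failProb p P := by
  refine expect_mono_support p fun a ha => ?_
  by_cases hP : P a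
  · rw [failInd_of (h a ha hP)]; exact zero_le
  · rw [failInd_of_not hP]; exact failInd_le_one _

lemma failProb_forall_le {ι : Type*} (s : Finset ι) (p : PMF α) (P : ι → α → Prop) :
    failProb p (fun a => ∀ i ∈ s, P i a) ≤ ∑ i ∈ s, failProb p (P i) := by
  unfold failProb
  rw [← expect_sum]
  refine expect_mono p fun a => ?_
  by_cases h : ∀ i ∈ s, P i a
  · rw [failInd_of h]; exact zero_le
  · rw [failInd_of_not h]
    push Not at h
    obtain ⟨i, hi, hP⟩ := h
    calc (1 : ℝ≥0∞) = failInd (P i a) := (failInd_of_not hP).symm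
      _ ≤ _ := Finset.single_le_sum (f := fun i => failInd (P i a))
          (fun _ _ => zero_le) hi

lemma failProb_and_le (p : PMF α) (P Q : α → Prop) :
    failProb p (fun a => P a ∧ Q a) ≤ failProb p P + failProb p Q := by
  unfold failProb
  rw [← expect_add]
  refine expect_mono p fun a => ?_
  by_cases h : P a <;> by_cases h' : Q a <;> simp [failInd, h, h']

lemma failProb_bind (p : PMF α) (k : α → PMF β) (P : β → Prop) :
    failProb (p.bind k) P = expect p fun a => failProb (k a) P := expect_bind _ _ _

lemma failProb_pure (a : α) (P : α → Prop) : failProb (PMF.pure a) P = failInd (P a) :=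
  expect_pure _ _

lemma failProb_bind_le (p : PMF α) (k : α → PMF β) (Q : α → Prop) (P : β → Prop) (ε : ℝ≥0∞)
    (h : ∀ a ∈ p.support, Q a → failProb (k a) P ≤ ε) :
    failProb (p.bind k) P ≤ failProb p Q + ε := by
  rw [failProb_bind]
  calc _ ≤ expect p (fun a => failInd (Q a) + ε) := by
        refine expect_mono_support p fun a ha => ?_
        by_cases hQ : Q a
        · simpa [failInd_of hQ] using h a ha hQ
        · rw [failInd_of_not hQ]
          exact (failProb_le_one _ _).trans le_self_add
    _ = _ := by rw [expect_add, expect_const]; rfl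

lemma one_sub_failProb_le (p : PMF α) (P : α → Prop) :
    1 - failProb p P ≤ p.toOuterMeasure {a | P a} := by
  rw [tsub_le_iff_right, PMF.toOuterMeasure_apply]
  unfold failProb expect
  rw [← ENNReal.tsum_add, ← p.tsum_coe]
  refine ENNReal.tsum_le_tsum fun a => ?_
  by_cases h : P a <;> simp [Set.indicator, failInd, h]

end Expect

/-! ### Random samples -/

lemma expect_coin (p : ℝ) (f : Bool → ℝ≥0∞) :
    expect (coin p) f = ENNReal.ofReal (max 0 (min p 1)) * f true
      + ENNReal.ofReal (1 - max 0 (min p 1)) * f false := by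
  unfold expect coin
  rw [tsum_fintype, Fintype.sum_bool]
  simp [PMF.ofFintype_apply]

/-- Independence enters here: each list member in `U` contributes a factor `1 - p`, and any other
member leaves the event unchanged. -/
lemma sampleList_miss {V : Type u} (p : ℝ) (U : Finset V) (l : List V) :
    failProb (sampleList p l) (fun S => ∃ v ∈ U, v ∈ S)
      ≤ ENNReal.ofReal (1 - max 0 (min p 1)) ^ (l.filter (· ∈ U)).length := by
  induction l with
  | nil => simpa using failProb_le_one _ _
  | cons v l ih =>
    unfold sampleList
    rw [failProb_bind, expect_coin]
    simp only [failProb_bind, failProb_pure, if_true, Bool.false_eq_true, if_false]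
    have h1 : (ENNReal.ofReal (max 0 (min p 1)) + ENNReal.ofReal (1 - max 0 (min p 1))) = 1 := by
      rw [← ENNReal.ofReal_add (le_max_left _ _) (by simp)]
      simp
    by_cases hv : v ∈ U
    · have h0 : expect (sampleList p l) (fun S => failInd (∃ w ∈ U, w ∈ insert v S)) = 0 := by
        have : (fun S : Finset V => failInd (∃ w ∈ U, w ∈ insert v S)) = fun _ => 0 := by
          funext S
          exact failInd_of ⟨v, hv, by simp⟩
        rw [this, expect_const]
      rw [h0, mul_zero, zero_add]
      simp only [hv, decide_true, List.filter_cons_of_pos, List.length_cons, pow_succ']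
      exact mul_le_mul_right ih _
    · have h0 : expect (sampleList p l) (fun S => failInd (∃ w ∈ U, w ∈ insert v S))
          = failProb (sampleList p l) (fun S => ∃ v ∈ U, v ∈ S) := by
        unfold failProb
        congr 1
        funext a
        congr 1
        apply propext
        constructor
        · rintro ⟨w, hw, h⟩
          rcases Finset.mem_insert.1 h with rfl | h
          · exact absurd hw hv
          · exact ⟨w, hw, h⟩
        · rintro ⟨w, hw, h⟩
          exact ⟨w, hw, Finset.mem_insert_of_mem h⟩
      rw [h0, ← failProb, ← add_mul, h1, one_mul]
      simpa [hv] using ih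

lemma one_sub_clip_pow_le (p : ℝ) (m : ℕ) :
    (1 - max 0 (min p 1)) ^ m ≤ Real.exp (-(p * m)) := by
  rcases Nat.eq_zero_or_pos m with rfl | hm
  · simp
  · have hc : 1 - max 0 (min p 1) ≤ Real.exp (-p) := by
      rcases le_total p 1 with h | h
      · have := Real.add_one_le_exp (-p)
        have h2 : p ≤ max 0 (min p 1) := by rw [min_eq_left h]; exact le_max_right _ _
        linarith
      · rw [min_eq_right h]
        have := (Real.exp_pos (-p)).le
        simpa using this
    calc _ ≤ Real.exp (-p) ^ m := pow_le_pow_left₀ (by simp) hc _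
      _ = _ := by rw [← Real.exp_nat_mul]; ring_nf

lemma sample_miss {V : Type u} [Fintype V] (p : ℝ) (U : Finset V) :
    failProb (sample V p) (fun S => ∃ v ∈ U, v ∈ S)
      ≤ ENNReal.ofReal (Real.exp (-(p * U.card))) := by
  refine (sampleList_miss p U _).trans ?_
  have hlen : ((Finset.univ : Finset V).toList.filter (· ∈ U)).length = U.card := by
    rw [← List.toFinset_card_of_nodup ((Finset.nodup_toList _).filter _)]
    congr 1
    ext v
    simp
  rw [hlen, ← ENNReal.ofReal_pow (by simp)]
  exact ENNReal.ofReal_le_ofReal (one_sub_clip_pow_le p _)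

/-! ### Predicates on extended reals -/

/-- `e` is `⊥` or a real number satisfying `Q`. -/
def OnReal (Q : ℝ → Prop) (e : EReal) : Prop := e ≠ ⊤ ∧ ∀ d : ℝ, e = d → Q d

lemma onReal_bot (Q : ℝ → Prop) : OnReal Q ⊥ := ⟨bot_ne_top, fun d h => by simp at h⟩

lemma onReal_coe {Q : ℝ → Prop} {d : ℝ} (h : Q d) : OnReal Q (d : EReal) :=
  ⟨EReal.coe_ne_top d, fun d' h' => by rwa [← EReal.coe_eq_coe_iff.1 h']⟩

lemma OnReal.max {Q : ℝ → Prop} {a b : EReal} (ha : OnReal Q a) (hb : OnReal Q b) :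
    OnReal Q (max a b) := by
  rcases max_choice a b with h | h <;> rwa [h]

lemma exists_eq_iSup_or_bot {ι : Type*} [Finite ι] (f : ι → EReal) :
    (∃ i, ⨆ i, f i = f i) ∨ ⨆ i, f i = ⊥ := by
  rcases isEmpty_or_nonempty ι with h | h
  · right; simp
  · left
    obtain ⟨i, hi⟩ := exists_eq_ciSup_of_finite (f := f)
    exact ⟨i, hi.symm⟩

lemma OnReal.iSup {ι : Type*} [Finite ι] {Q : ℝ → Prop} {f : ι → EReal}
    (h : ∀ i, OnReal Q (f i)) : OnReal Q (⨆ i, f i) := by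
  rcases exists_eq_iSup_or_bot f with ⟨i, hi⟩ | hi
  · rw [hi]; exact h i
  · rw [hi]; exact onReal_bot Q

lemma OnReal.ite {Q : ℝ → Prop} {P : Prop} [Decidable P] {a : EReal} (h : P → OnReal Q a) :
    OnReal Q (if P then a else ⊥) := by
  split_ifs with hP
  · exact h hP
  · exact onReal_bot Q

lemma eq_bot_or_coe {e : EReal} (h : e ≠ ⊤) : e = ⊥ ∨ ∃ d : ℝ, e = d := by
  induction e with
  | bot => exact Or.inl rfl
  | top => exact absurd rfl h
  | coe d => exact Or.inr ⟨d, rfl⟩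

lemma exists_real_of_le {e : EReal} (h : e ≠ ⊤) {d : ℝ} (hd : (d : EReal) ≤ e) :
    ∃ d' : ℝ, e = d' ∧ d ≤ d' := by
  rcases eq_bot_or_coe h with rfl | ⟨d', rfl⟩
  · exact absurd hd (by simp)
  · exact ⟨d', rfl, EReal.coe_le_coe_iff.1 hd⟩

lemma OnReal.add {Q : ℝ → Prop} {a b : EReal} (ha : a ≠ ⊤) (hb : b ≠ ⊤)
    (h : ∀ x y : ℝ, a = x → b = y → Q (x + y)) : OnReal Q (a + b) := by
  rcases eq_bot_or_coe ha with rfl | ⟨x, rfl⟩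
  · rw [EReal.bot_add]; exact onReal_bot Q
  rcases eq_bot_or_coe hb with rfl | ⟨y, rfl⟩
  · rw [EReal.add_bot]; exact onReal_bot Q
  rw [← EReal.coe_add]
  exact onReal_coe (h x y rfl rfl)

lemma OnReal.cases {Q : ℝ → Prop} {e : EReal} (h : OnReal Q e) :
    e = ⊥ ∨ ∃ d : ℝ, e = d ∧ Q d := by
  rcases eq_bot_or_coe h.1 with h' | ⟨d, hd⟩
  · exact Or.inl h'
  · exact Or.inr ⟨d, hd, h.2 d hd⟩

lemma eabs_coe (a : ℝ) : eabs (a : EReal) = ((|a| : ℝ) : EReal) := by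
  unfold eabs
  rw [← EReal.coe_neg, abs_eq_max_neg]
  exact (EReal.coe_strictMono.monotone.map_max).symm

lemma eabs_bot : eabs ⊥ = ⊤ := by simp [eabs]

/-! ### Charge relations -/

/-- An abstract reachability relation between vertices with charges in `[0, B]`. -/
structure ChargeRel (V : Type u) (B : ℝ) where
  /-- `rel x b y c`: with charge `b` at `x` one can reach `y` with charge at least `c` -/
  rel : V → ℝ → V → ℝ → Prop
  refl : ∀ {x b c}, 0 ≤ c → c ≤ b → b ≤ B → rel x b x c
  trans : ∀ {x b y c z d}, rel x b y c → rel y c z d → rel x b z d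
  bounds : ∀ {x b y c}, rel x b y c → 0 ≤ b ∧ b ≤ B ∧ 0 ≤ c ∧ c ≤ B

namespace ChargeRel

variable {V : Type u} {B : ℝ} (ρ : ChargeRel V B)

lemma lower {x b y c c'} (h : ρ.rel x b y c) (h0 : 0 ≤ c') (h1 : c' ≤ c) : ρ.rel x b y c' :=
  ρ.trans h (ρ.refl h0 h1 (ρ.bounds h).2.2.2)

lemma raise {x b b' y c} (h : ρ.rel x b y c) (h0 : b ≤ b') (h1 : b' ≤ B) : ρ.rel x b' y c :=
  ρ.trans (ρ.refl (ρ.bounds h).1 h0 h1) h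

/-- The relation of the reversed graph, with charges replaced by charge deficits. -/
def reverse : ChargeRel V B where
  rel x b y c := ρ.rel y (B - c) x (B - b)
  refl h0 h1 h2 := ρ.refl (by linarith) (by linarith) (by linarith)
  trans h h' := ρ.trans h' h
  bounds h := by have := ρ.bounds h; refine ⟨?_, ?_, ?_, ?_⟩ <;> linarith [this.1, this.2.1, this.2.2.1, this.2.2.2]

end ChargeRel

/-- The transposed table. -/
def tr {V : Type u} (M : V → V → EReal) : V → V → EReal := fun x y => M y x

/-- Every entry is realized by the relation. -/
def SoundTable {V : Type u} {B : ℝ} (ρ : ChargeRel V B) (M : V → V → EReal) : Prop :=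
  ∀ x y, OnReal (fun m => -B ≤ m ∧
    ∀ b, 0 ≤ b → b ≤ B → 0 ≤ b + m → ρ.rel x b y (min (b + m) B)) (M x y)

/-- Every entry `F u v x` is realized by a path that starts with the arc `uv`. -/
def SoundFirst {V : Type u} {B : ℝ} (ρ : ChargeRel V B) (M : V → V → EReal)
    (F : V → V → V → EReal) : Prop :=
  ∀ u v x, OnReal (fun d => ∃ m : ℝ, M u v = m ∧
    (m ≤ 0 → ∀ b, 0 ≤ b → b ≤ B + m → ρ.rel v b x (b - m + d)) ∧
    (0 ≤ m → ∀ b, m ≤ b → b ≤ B → ρ.rel v b x (b - m + d))) (F u v x)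

/-- All entries of a data structure are realized. -/
structure SoundTables {V : Type u} {B : ℝ} (ρ : ChargeRel V B) (M : V → V → EReal)
    (D : Tables V) : Prop where
  mono : D.mono = M
  first : SoundFirst ρ M D.first
  last : SoundFirst ρ.reverse (tr M) (fun u v x => D.last x v u)

lemma iSup_ite_eq_coe {ι : Type*} [Finite ι] {P : ι → Prop} [∀ a, Decidable (P a)] {f : ι → EReal} {d : ℝ}
    (h : (⨆ a, if P a then f a else ⊥) = (d : EReal)) : ∃ a, P a ∧ f a = d := by
  rcases exists_eq_iSup_or_bot (fun a => if P a then f a else ⊥) with ⟨i, hi⟩ | hi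
  · rw [h] at hi
    by_cases hP : P i
    · exact ⟨i, hP, by simpa [hP] using hi.symm⟩
    · simp [hP] at hi
  · rw [h] at hi; simp at hi

lemma iSup_ite_ne_top {ι : Type*} [Finite ι] {P : ι → Prop} [∀ a, Decidable (P a)] {f : ι → EReal}
    (h : ∀ a, f a ≠ ⊤) : (⨆ a, if P a then f a else ⊥) ≠ ⊤ :=
  (OnReal.iSup (Q := fun _ => True) fun a => OnReal.ite fun _ => ⟨h a, fun _ _ => trivial⟩).1

lemma opposing_coe {c m : ℝ} : Opposing (c : EReal) (m : EReal) ↔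
    (0 ≤ c ∧ -c ≤ m ∧ m ≤ 0) ∨ (c < 0 ∧ 0 ≤ m ∧ m ≤ -c) := by
  unfold Opposing
  rw [eabs_coe]
  by_cases h : 0 ≤ c
  · rw [if_pos (by exact_mod_cast h)]
    have : ¬ c < 0 := not_lt.2 h
    simp only [h, this, true_and, false_and, or_false]
    norm_cast
  · rw [if_neg (by exact_mod_cast h)]
    have h' : c < 0 := not_le.1 h
    simp only [h, h', true_and, false_and, false_or, abs_of_neg h']
    norm_cast

/-! ### Soundness of the elementary operations on tables -/

section Sound

variable {V : Type u} {B : ℝ} {ρ : ChargeRel V B} {M : V → V → EReal}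

lemma SoundTable.step (hM : SoundTable ρ M) {x y : V} {m : ℝ} (h : M x y = m) {b c : ℝ}
    (hb : 0 ≤ b) (hb' : b ≤ B) (hc : 0 ≤ c) (hc' : c ≤ B) (hcb : c ≤ b + m) : ρ.rel x b y c :=
  ρ.lower (((hM x y).2 m h).2 b hb hb' (by linarith)) hc (le_min hcb hc')

lemma SoundTable.ge (hM : SoundTable ρ M) {x y : V} {m : ℝ} (h : M x y = m) : -B ≤ m :=
  ((hM x y).2 m h).1

lemma SoundTable.of_step {x y : V} {e : EReal} (he : e ≠ ⊤)
    (h : ∀ m : ℝ, e = m → -B ≤ m ∧ ∀ b c, 0 ≤ b → b ≤ B → 0 ≤ c → c ≤ B → c ≤ b + m →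
      ρ.rel x b y c) (hB : 0 ≤ B) :
    OnReal (fun m => -B ≤ m ∧
      ∀ b, 0 ≤ b → b ≤ B → 0 ≤ b + m → ρ.rel x b y (min (b + m) B)) e :=
  ⟨he, fun m hm => ⟨(h m hm).1, fun b h0 h1 h2 =>
    (h m hm).2 b _ h0 h1 (le_min h2 hB) (min_le_right _ _) (min_le_left _ _)⟩⟩

lemma SoundTable.transpose (hB : 0 ≤ B) (hM : SoundTable ρ M) : SoundTable ρ.reverse (tr M) := by
  intro x y
  refine SoundTable.of_step (hM y x).1 (fun m hm => ⟨hM.ge hm, ?_⟩) hB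
  intro b c h0 h1 h2 h3 h4
  exact hM.step hm (by linarith) (by linarith) (by linarith) (by linarith) (by linarith)

/-- In `SoundFirst` the charge `b` is measured after the arc `uv`. Starting there with the largest
admissible charge `B + m`, the walk ends with `B + d`, which cannot exceed `B`. -/
lemma SoundFirst.nonpos (hF : SoundFirst ρ M F) {u v x : V} {m d : ℝ}
    (hm : M u v = m) (hd : F u v x = d) (h0 : m ≤ 0) (h1 : -B ≤ m) : d ≤ 0 := by
  obtain ⟨m', hm', h, -⟩ := (hF u v x).2 d hd
  rw [hm, EReal.coe_eq_coe_iff] at hm'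
  subst hm'
  have := (ρ.bounds (h h0 (B + m) (by linarith) le_rfl)).2.2.2
  linarith

lemma soundTables_initDS (hB : 0 ≤ B) (hM : SoundTable ρ M) : SoundTables ρ M (initDS M) := by
  have key : ∀ (ρ : ChargeRel V B) (M : V → V → EReal), SoundTable ρ M →
      SoundFirst ρ M (fun x y z => if z = y then M x y else ⊥) := by
    intro ρ M hM u v x
    refine OnReal.ite ?_
    rintro rfl
    refine ⟨(hM u x).1, fun d hd => ⟨d, hd, fun h b h0 h1 => ?_, fun h b h0 h1 => ?_⟩⟩ <;>
    exact ρ.refl (by linarith) (by linarith) (by linarith)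
  refine ⟨rfl, key ρ M hM, ?_⟩
  have := key ρ.reverse (tr M) (hM.transpose hB)
  intro u v x
  have h := this u v x
  simp only [initDS]
  by_cases hvx : v = x
  · subst hvx; simpa [tr] using h
  · rw [if_neg hvx]; exact onReal_bot _

/-- If the second arc opposes the first and is not longer, every charge admissible after the first
arc can traverse it without meeting `0` or `B`, and leaves a charge admissible for the entry `F y a
z`. -/
lemma soundFirst_step [Finite V] (hM : SoundTable ρ M) {F : V → V → V → EReal}
    (hF : SoundFirst ρ M F) : SoundFirst ρ M (fun x y z => max (F x y z)
      (M x y + ⨆ a, if Opposing (M x y) (M y a) then F y a z else ⊥)) := by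
  intro x y z
  refine (hF x y z).max (OnReal.add (hM x y).1 (iSup_ite_ne_top fun a => (hF y a z).1) ?_)
  intro m d hm hd
  obtain ⟨a, ha, hd⟩ := iSup_ite_eq_coe hd
  obtain ⟨m', hm', h1, h2⟩ := (hF y a z).2 d hd
  rw [hm, hm', opposing_coe] at ha
  have hge := hM.ge hm
  refine ⟨m, hm, fun h b hb hb' => ?_, fun h b hb hb' => ?_⟩
  · rcases ha with ha | ha
    -- A zero gain satisfies both clauses of `SoundFirst`, but `Opposing` treats it as nonnegative
    -- and then forces `m' = 0`.
    · have hm0 : m = 0 := le_antisymm h ha.1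
      have hm'0 : m' = 0 := by linarith [ha.2.1, ha.2.2]
      subst hm0 hm'0
      refine ρ.trans (hM.step hm' hb (by linarith) hb (by linarith) (by linarith)) ?_
      convert h1 le_rfl b hb (by linarith) using 1
      ring
    · refine ρ.trans (hM.step hm' hb (by linarith) (c := b + m') (by linarith) (by linarith)
        (by linarith)) ?_
      convert h2 ha.2.1 (b + m') (by linarith) (by linarith) using 1
      ring
  · rcases ha with ha | ha
    · refine ρ.trans (hM.step hm' (by linarith) (by linarith) (c := b + m') (by linarith)
        (by linarith) (by linarith)) ?_
      convert h1 ha.2.2 (b + m') (by linarith) (by linarith) using 1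
      ring
    · linarith [ha.1]

lemma soundTables_breadthSearch [Fintype V] (hB : 0 ≤ B) (hM : SoundTable ρ M) {D : Tables V}
    (hD : SoundTables ρ M D) : SoundTables ρ M (breadthSearch M D) := by
  refine ⟨hD.mono, soundFirst_step hM hD.first, ?_⟩
  have := soundFirst_step (hM.transpose hB) hD.last
  intro u v x
  have h := this u v x
  simp only [breadthSearch]
  rw [add_comm]
  exact h

lemma soundFirst_set {F : V → V → V → EReal} (hF : SoundFirst ρ M F) (u v x : V) (r : EReal)
    (hr : OnReal (fun d => ∃ m : ℝ, M u v = m ∧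
      (m ≤ 0 → ∀ b, 0 ≤ b → b ≤ B + m → ρ.rel v b x (b - m + d)) ∧
      (0 ≤ m → ∀ b, m ≤ b → b ≤ B → ρ.rel v b x (b - m + d))) r) :
    SoundFirst ρ M (fun u' v' x' => if u' = u ∧ v' = v ∧ x' = x then r else F u' v' x') := by
  intro u' v' x'
  dsimp only
  split_ifs with h
  · obtain ⟨rfl, rfl, rfl⟩ := h
    exact hr
  · exact hF u' v' x'

/-- The walk arrives at `w` with `b - m + d₁ ≥ d₁ - m`. The window for `M w a` therefore bounds its
loss by a charge that is certainly available. -/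
lemma soundFirst_concatenate [Finite V] (hM : SoundTable ρ M) {F₀ F : V → V → V → EReal}
    (hF₀ : SoundFirst ρ M F₀) (hF : SoundFirst ρ M F) (u v w x : V) (huv : M u v < 0) :
    SoundFirst ρ M (fun u' v' x' => if u' = u ∧ v' = v ∧ x' = x then (max (F u v x)
      (F u v w + ⨆ a, if -(F u v w - M u v) ≤ M w a ∧ M w a ≤ 0 then F₀ w a x else ⊥))
      else F u' v' x') := by
  refine soundFirst_set hF u v x _ ((hF u v x).max
    (OnReal.add (hF u v w).1 (iSup_ite_ne_top fun a => (hF₀ w a x).1) ?_))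
  intro d₁ d₂ hd₁ hd₂
  obtain ⟨a, ha, hd₂⟩ := iSup_ite_eq_coe hd₂
  obtain ⟨m, hm, h1, -⟩ := (hF u v w).2 d₁ hd₁
  obtain ⟨m', hm', h2, -⟩ := (hF₀ w a x).2 d₂ hd₂
  rw [hm] at huv
  rw [hd₁, hm, hm'] at ha
  norm_cast at huv ha
  refine ⟨m, hm, fun h b hb hb' => ?_, fun h => by linarith⟩
  have r1 := h1 h b hb hb'
  have bd := ρ.bounds r1
  refine ρ.trans r1 (ρ.trans (hM.step hm' bd.2.2.1 bd.2.2.2 (c := b - m + d₁ + m')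
    (by linarith) (by linarith) le_rfl) ?_)
  convert h2 ha.2 (b - m + d₁ + m') (by linarith) (by linarith) using 1
  ring

/-- The first side condition keeps the charge at `a`, namely `b - m + d₁ + d₂ - m'`, nonnegative.
The second gives `d₁ + d₂ ≤ 0`, so the charge at `x` is at most `b - m ≤ B`. -/
lemma soundFirst_concatenateOpposite [Finite V] (hM : SoundTable ρ M)
    {L₀ F : V → V → V → EReal} (hL₀ : SoundFirst ρ.reverse (tr M) (fun u v x => L₀ x v u))
    (hF : SoundFirst ρ M F) (u v w x : V) (huv : M u v < 0) :
    SoundFirst ρ M (fun u' v' x' => if u' = u ∧ v' = v ∧ x' = x then (max (F u v x)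
      (F u v w + ⨆ a, if 0 ≤ M a x ∧ M a x - L₀ w a x ≤ F u v w - M u v ∧
        L₀ w a x ≤ eabs (F u v w) then L₀ w a x else ⊥)) else F u' v' x') := by
  refine soundFirst_set hF u v x _ ((hF u v x).max
    (OnReal.add (hF u v w).1 (iSup_ite_ne_top fun a => (hL₀ x a w).1) ?_))
  intro d₁ d₂ hd₁ hd₂
  obtain ⟨a, ha, hd₂⟩ := iSup_ite_eq_coe hd₂
  obtain ⟨m, hm, h1, -⟩ := (hF u v w).2 d₁ hd₁
  obtain ⟨m', hm', -, h2⟩ := (hL₀ x a w).2 d₂ hd₂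
  simp only [tr] at hm'
  rw [hm] at huv
  have hge := hM.ge hm
  rw [hd₁, hm, hm', hd₂, eabs_coe] at ha
  norm_cast at huv ha
  have hd0 := hF.nonpos hm hd₁ huv.le hge
  rw [abs_of_nonpos hd0] at ha
  refine ⟨m, hm, fun h b hb hb' => ?_, fun h => by linarith⟩
  have r1 := h1 h b hb hb'
  have bd := ρ.bounds r1
  have r2 := h2 ha.1 (B - (b - m + d₁ + d₂ - m')) (by linarith) (by linarith)
  simp only [ChargeRel.reverse] at r2
  have r3 : ρ.rel a (b - m + d₁ + d₂ - m') x (b - m + d₁ + d₂) :=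
    hM.step hm' (by linarith) (by linarith) (by linarith) (by linarith) (by linarith)
  refine ρ.trans r1 ?_
  convert ρ.trans (y := a) (c := b - m + d₁ + d₂ - m') (b := b - m + d₁) ?_ r3 using 1
  · ring
  · convert r2 using 1 <;> ring

/-- Here the second walk gains at least what the first one loses. Surplus charge is discarded at
`w`, down to `b - m - d₂`, so that `x` is reached with exactly `b - m`; the bound on `M a x` keeps
the charge at `a` at least `b`. -/
lemma soundFirst_setZero (hM : SoundTable ρ M)
    {L₀ F : V → V → V → EReal} (hL₀ : SoundFirst ρ.reverse (tr M) (fun u v x => L₀ x v u))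
    (hF : SoundFirst ρ M F) (u v w x : V) (huv : M u v < 0)
    (h : ∃ a, 0 ≤ M a x ∧ eabs (F u v w) ≤ L₀ w a x ∧ M a x ≤ eabs (M u v)) :
    SoundFirst ρ M (fun u' v' x' => if u' = u ∧ v' = v ∧ x' = x then 0 else F u' v' x') := by
  refine soundFirst_set hF u v x _ ?_
  obtain ⟨a, ha0, ha1, ha2⟩ := h
  have hFt : F u v w ≠ ⊥ := by
    intro hb
    rw [hb, eabs_bot, top_le_iff] at ha1
    exact (hL₀ x a w).1 ha1
  rcases (hF u v w).cases with hb | ⟨d₁, hd₁, m, hm, h1, -⟩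
  · exact absurd hb hFt
  rcases (hL₀ x a w).cases with hb | ⟨d₂, hd₂, m', hm', -, h2⟩
  · dsimp only at hb
    rw [hb, hd₁, eabs_coe] at ha1
    simp at ha1
  dsimp only at hd₂
  simp only [tr] at hm'
  rw [hm] at huv
  have hge := hM.ge hm
  rw [hd₁, hd₂, eabs_coe] at ha1
  rw [hm', hm, eabs_coe] at ha2
  rw [hm'] at ha0
  norm_cast at huv ha0 ha1 ha2
  have hd0 := hF.nonpos hm hd₁ huv.le hge
  rw [abs_of_nonpos hd0] at ha1
  rw [abs_of_neg huv] at ha2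
  refine onReal_coe (d := 0) ⟨m, hm, fun h b hb hb' => ?_, fun h => by linarith⟩
  have r1 := h1 h b hb hb'
  have r2 := h2 ha0 (B - (b - m - m')) (by linarith) (by linarith)
  simp only [ChargeRel.reverse] at r2
  have bd := ρ.bounds r2
  have r3 : ρ.rel a (b - m - m') x (b - m) :=
    hM.step hm' (by linarith) (by linarith) (by linarith) (by linarith) (by linarith)
  refine ρ.trans (ρ.lower r1 bd.1 (by linarith)) (ρ.trans (c := b - m - m') ?_ ?_ (y := a))
  · convert r2 using 1; ring
  · convert r3 using 1; ring

end Sound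

/-! ### Mirror symmetry -/

namespace Tables

variable {V : Type u}

/-- The data structure of the reversed graph. -/
def swap (D : Tables V) : Tables V where
  mono x y := D.mono y x
  first u v x := D.last x v u
  last x v u := D.first u v x

@[simp] lemma swap_swap (D : Tables V) : D.swap.swap = D := rfl

lemma setFirst_swap (D : Tables V) (u v x : V) (r : EReal) :
    D.swap.setFirst u v x r = (D.setLast x v u r).swap := by
  unfold setFirst setLast swap
  congr 1
  funext u' v' x'
  dsimp only
  by_cases h : u' = u ∧ v' = v ∧ x' = x
  · rw [if_pos h, if_pos ⟨h.2.2, h.2.1, h.1⟩]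
  · rw [if_neg h, if_neg fun h' => h ⟨h'.2.2, h'.2.1, h'.1⟩]

end Tables

section Swap

variable {V : Type u} {B : ℝ}

@[simp] lemma tr_tr (M : V → V → EReal) : tr (tr M) = M := rfl

lemma ChargeRel.reverse_reverse (ρ : ChargeRel V B) : ρ.reverse.reverse = ρ := by
  cases ρ
  simp [ChargeRel.reverse]

lemma initDS_swap (M : V → V → EReal) : initDS (tr M) = (initDS M).swap := by
  simp only [initDS, Tables.swap, tr, eq_comm]
  rfl

lemma concatenateFirst_swap [Fintype V] (M : V → V → EReal) (D₀ D : Tables V) (u v w x : V) :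
    concatenateFirst (tr M) D₀.swap D.swap u v w x = (concatenateLast M D₀ D u v w x).swap := by
  unfold concatenateFirst concatenateLast
  by_cases h : M v u < 0
  · rw [if_pos h, if_pos (show tr M u v < 0 from h), Tables.setFirst_swap]
    exact congrArg (fun r => (D.setLast x v u (max (D.last x v u) r)).swap) (add_comm _ _)
  · rw [if_neg h, if_neg (show ¬ tr M u v < 0 from h)]

lemma concatenateOppositeFirst_swap [Fintype V] (M : V → V → EReal) (D₀ D : Tables V)
    (u v w x : V) : concatenateOppositeFirst (tr M) D₀.swap D.swap u v w x
      = (concatenateOppositeLast M D₀ D u v w x).swap := by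
  unfold concatenateOppositeFirst concatenateOppositeLast
  by_cases h : M v u < 0
  · rw [if_pos h, if_pos (show tr M u v < 0 from h)]
    have h1 : D.swap.setFirst u v x (max (D.swap.first u v x) (D.swap.first u v w +
        ⨆ a, if 0 ≤ tr M a x ∧ tr M a x - D₀.swap.last w a x ≤ D.swap.first u v w - tr M u v ∧
          D₀.swap.last w a x ≤ eabs (D.swap.first u v w) then D₀.swap.last w a x else ⊥))
        = (D.setLast x v u (max (D.last x v u) ((⨆ a, if 0 ≤ M x a ∧
          M x a - D₀.first x a w ≤ D.last w v u - M v u ∧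
          D₀.first x a w ≤ eabs (D.last w v u) then D₀.first x a w else ⊥)
            + D.last w v u))).swap := by
      rw [Tables.setFirst_swap]
      exact congrArg (fun r => (D.setLast x v u (max (D.last x v u) r)).swap) (add_comm _ _)
    dsimp only
    rw [h1, Tables.setFirst_swap]
    exact (apply_ite Tables.swap _ _ _).symm
  · rw [if_neg h, if_neg (show ¬ tr M u v < 0 from h)]

/-- The swap reverses the order of the two halves of each step. They commute, since each writes one
component of `D` and reads only that component of the current `D`. -/
lemma concatenate_swap [Fintype V] (M : V → V → EReal) (U W X : Finset V) (D : Tables V) :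
    concatenate (tr M) U W X D.swap = (concatenate M U W X D).swap := by
  unfold concatenate
  refine List.foldl_hom (f := Tables.swap) (H := ?_)
  intro D' q
  rw [concatenateFirst_swap]
  have h := concatenateFirst_swap (tr M) D.swap
    (concatenateLast M D D' q.1 q.2.1 q.2.2.1 q.2.2.2).swap q.1 q.2.1 q.2.2.1 q.2.2.2
  rw [Tables.swap_swap, Tables.swap_swap, tr_tr] at h
  rw [← Tables.swap_swap (concatenateLast (tr M) _ _ _ _ _ _), ← h]
  congr 1
  unfold concatenateFirst concatenateLast Tables.setFirst Tables.setLast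
  split_ifs <;> rfl

lemma concatenateOppositeFirst_frame [Fintype V] (M : V → V → EReal) (D₀ D : Tables V)
    (u v w x : V) : (concatenateOppositeFirst M D₀ D u v w x).mono = D.mono ∧
      (concatenateOppositeFirst M D₀ D u v w x).last = D.last := by
  unfold concatenateOppositeFirst
  dsimp only
  split_ifs <;> exact ⟨rfl, rfl⟩

lemma concatenateOppositeFirst_congr [Fintype V] (M : V → V → EReal) (D₀ : Tables V)
    {D D' : Tables V} (h : D.first = D'.first) (u v w x : V) :
    (concatenateOppositeFirst M D₀ D u v w x).first
      = (concatenateOppositeFirst M D₀ D' u v w x).first := by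
  unfold concatenateOppositeFirst
  dsimp only [Tables.setFirst]
  rw [← h]
  split_ifs <;> first | rfl | exact h

/-- The halves read each other's component only from the frozen copy `D₀`, so their order is
immaterial. -/
lemma concatenateOpposite_comm [Fintype V] (M : V → V → EReal) (D₀ D : Tables V) (u v w x : V) :
    concatenateOppositeFirst M D₀ (concatenateOppositeLast M D₀ D u v w x) u v w x
      = concatenateOppositeLast M D₀ (concatenateOppositeFirst M D₀ D u v w x) u v w x := by
  have hl : ∀ D : Tables V, concatenateOppositeLast M D₀ D u v w x
      = (concatenateOppositeFirst (tr M) D₀.swap D.swap u v w x).swap := fun D => by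
    rw [concatenateOppositeFirst_swap, Tables.swap_swap]
  have ext : ∀ D D' : Tables V, D.mono = D'.mono → D.first = D'.first → D.last = D'.last →
      D = D' := by
    rintro ⟨⟩ ⟨⟩ rfl rfl rfl; rfl
  have sm : ∀ D : Tables V, D.swap.mono = tr D.mono := fun _ => rfl
  have sl : ∀ D : Tables V, D.swap.last = fun x v u => D.first u v x := fun _ => rfl
  have sf : ∀ D : Tables V, D.swap.first = fun u v x => D.last x v u := fun _ => rfl
  have fr := concatenateOppositeFirst_frame M D₀ (u := u) (v := v) (w := w) (x := x)
  have fr' := concatenateOppositeFirst_frame (tr M) D₀.swap (u := u) (v := v) (w := w) (x := x)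
  apply ext
  · rw [(fr _).1, hl, hl, sm, sm, (fr' _).1, (fr' _).1, sm, sm, (fr _).1]
  · have h1 : ∀ D, (concatenateOppositeLast M D₀ D u v w x).first = D.first := fun D => by
      rw [hl, sf, (fr' _).2]; rfl
    rw [h1]
    exact concatenateOppositeFirst_congr M D₀ (h1 D) u v w x
  · rw [(fr _).2, hl, hl, sl, sl]
    have : D.swap.first = (concatenateOppositeFirst M D₀ D u v w x).swap.first := by
      rw [sf, sf, (fr _).2]
    rw [concatenateOppositeFirst_congr (tr M) D₀.swap this]

lemma concatenateOpposite_swap [Fintype V] (M : V → V → EReal) (U W X : Finset V)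
    (D : Tables V) :
    concatenateOpposite (tr M) U W X D.swap = (concatenateOpposite M U W X D).swap := by
  unfold concatenateOpposite
  refine List.foldl_hom (f := Tables.swap) (H := ?_)
  intro D' q
  rw [concatenateOppositeFirst_swap]
  have h := concatenateOppositeFirst_swap (tr M) D.swap
    (concatenateOppositeLast M D D' q.1 q.2.1 q.2.2.1 q.2.2.2).swap q.1 q.2.1 q.2.2.1 q.2.2.2
  rw [Tables.swap_swap, Tables.swap_swap, tr_tr] at h
  rw [← Tables.swap_swap (concatenateOppositeLast (tr M) _ _ _ _ _ _), ← h]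
  exact congrArg Tables.swap (concatenateOpposite_comm M D D' _ _ _ _)

lemma breadthSearch_swap [Fintype V] (M : V → V → EReal) (D : Tables V) :
    breadthSearch (tr M) D.swap = (breadthSearch M D).swap := by
  unfold breadthSearch Tables.swap tr
  simp only [add_comm]

lemma iterate_swap {f g : Tables V → Tables V} (h : ∀ D, g D.swap = (f D).swap) (k : ℕ)
    (D : Tables V) : g^[k] D.swap = (f^[k] D).swap := by
  induction k generalizing D with
  | zero => rfl
  | succ k ih => rw [Function.iterate_succ_apply, Function.iterate_succ_apply, h, ih]

/-- The outcome of Compute-Funnels when the sample is `S`. -/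
def funnelsOf [Fintype V] (κ : HiddenConstants) (M : V → V → EReal) (S : Finset V) : Tables V :=
  breadthRounds κ M (concatenate M S S Finset.univ
    ((concatenate M S S S)^[⌈logn V⌉₊] (breadthRounds κ M (initDS M))))

lemma computeFunnels_eq [Fintype V] (κ : HiddenConstants) (M : V → V → EReal) :
    computeFunnels κ M =
      (sample V (κ.cSample * logn V * funnelParam κ V / (Fintype.card V : ℝ))).bind fun S =>
        PMF.pure (funnelsOf κ M S) := rfl

lemma funnelsOf_swap [Fintype V] (κ : HiddenConstants) (M : V → V → EReal) (S : Finset V) :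
    funnelsOf κ (tr M) S = (funnelsOf κ M S).swap := by
  unfold funnelsOf breadthRounds
  rw [initDS_swap, iterate_swap (breadthSearch_swap M), iterate_swap (concatenate_swap M S S S),
    concatenate_swap, iterate_swap (breadthSearch_swap M)]

/-- A round of the loop of Long-Shortcuts. -/
def longRound [Fintype V] (M : V → V → EReal) (T : Finset V) (D : Tables V) : Tables V :=
  concatenate M T Finset.univ Finset.univ (concatenateOpposite M T Finset.univ Finset.univ D)

lemma longRound_swap [Fintype V] (M : V → V → EReal) (T : Finset V) (D : Tables V) :
    longRound (tr M) T D.swap = (longRound M T D).swap := by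
  unfold longRound
  rw [concatenateOpposite_swap, concatenate_swap]

/-- The shortcuts obtained from the entries of the first table by Arc-Bounded-To-Monotone. -/
def arcForward (B : ℝ) (M : V → V → EReal) (T : Finset V) (F : V → V → V → EReal) (p q : V) :
    EReal :=
  max (⨆ v, ⨆ x, if p ∈ T ∧ M p v ≤ 0 ∧ -(B : EReal) ≤ F p v x + M x q ∧ F p v x + M x q ≤ M p v
        then F p v x + M x q else ⊥) <|
  max (⨆ v, ⨆ x, if p ∈ T ∧ M p v ≤ 0 ∧ M p v ≤ F p v x + M x q then M p v else ⊥)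
    (⨆ u, ⨆ x, if u ∈ T ∧ M u p ≤ 0 ∧ 0 ≤ F u p x + M x q then -(M u p) + (F u p x + M x q)
      else ⊥)

/-- The last three suprema are the first three for the reversed graph, so only `arcForward` needs an
analysis. -/
lemma arcBoundedToMonotone_eq (B : ℝ) (M : V → V → EReal) (T : Finset V) (D : Tables V)
    (p q : V) : arcBoundedToMonotone B M T D p q = max (D.mono p q)
      (max (arcForward B M T D.first p q)
        (arcForward B (tr M) T (fun u v x => D.last x v u) q p)) := by
  unfold arcBoundedToMonotone arcForward
  simp only [tr, sub_eq_add_neg, add_comm, max_assoc]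

end Swap

/-! ### Soundness of Concatenate, Concatenate-Opposite and the funnel tables -/

section SoundOps

variable {V : Type u} {B : ℝ} {ρ : ChargeRel V B} {M : V → V → EReal}

lemma SoundTables.swap {D : Tables V} (h : SoundTables ρ M D) :
    SoundTables ρ.reverse (tr M) D.swap :=
  ⟨by funext x y; simp [Tables.swap, tr, h.mono], h.last,
    by rw [ChargeRel.reverse_reverse]; exact h.first⟩

lemma SoundTables.of_swap {D : Tables V} (h : SoundTables ρ.reverse (tr M) D.swap) :
    SoundTables ρ M D := by
  have := h.swap
  rwa [ChargeRel.reverse_reverse] at this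

variable [Fintype V]

lemma SoundTables.concatenateFirst (hM : SoundTable ρ M) {D₀ D : Tables V}
    (h₀ : SoundTables ρ M D₀) (h : SoundTables ρ M D) (u v w x : V) :
    SoundTables ρ M (concatenateFirst M D₀ D u v w x) := by
  unfold ElectricCar.concatenateFirst
  split_ifs with huv
  · exact ⟨h.mono, soundFirst_concatenate hM h₀.first h.first u v w x huv, h.last⟩
  · exact h

lemma SoundTables.concatenateOppositeFirst (hM : SoundTable ρ M) {D₀ D : Tables V}
    (h₀ : SoundTables ρ M D₀) (h : SoundTables ρ M D) (u v w x : V) :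
    SoundTables ρ M (concatenateOppositeFirst M D₀ D u v w x) := by
  unfold ElectricCar.concatenateOppositeFirst
  split_ifs with huv
  · have h' := soundFirst_concatenateOpposite hM h₀.last h.first u v w x huv
    dsimp only
    split_ifs with hz
    · exact ⟨h.mono, soundFirst_setZero hM h₀.last h' u v w x huv hz, h.last⟩
    · exact ⟨h.mono, h', h.last⟩
  · exact h

lemma SoundTables.concatenateLast (hB : 0 ≤ B) (hM : SoundTable ρ M) {D₀ D : Tables V}
    (h₀ : SoundTables ρ M D₀) (h : SoundTables ρ M D) (u v w x : V) :
    SoundTables ρ M (concatenateLast M D₀ D u v w x) :=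
  .of_swap <| by
    rw [← concatenateFirst_swap]
    exact .concatenateFirst (hM.transpose hB) h₀.swap h.swap u v w x

lemma SoundTables.concatenateOppositeLast (hB : 0 ≤ B) (hM : SoundTable ρ M) {D₀ D : Tables V}
    (h₀ : SoundTables ρ M D₀) (h : SoundTables ρ M D) (u v w x : V) :
    SoundTables ρ M (concatenateOppositeLast M D₀ D u v w x) :=
  .of_swap <| by
    rw [← concatenateOppositeFirst_swap]
    exact .concatenateOppositeFirst (hM.transpose hB) h₀.swap h.swap u v w x

lemma foldl_invariant {α β : Type*} {f : α → β → α} {I : α → Prop}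
    (h : ∀ a b, I a → I (f a b)) (l : List β) (a : α) (ha : I a) : I (l.foldl f a) := by
  induction l generalizing a with
  | nil => exact ha
  | cons b l ih => exact ih _ (h a b ha)

lemma SoundTables.concatenate (hB : 0 ≤ B) (hM : SoundTable ρ M) {D : Tables V}
    (h : SoundTables ρ M D) (U W X : Finset V) : SoundTables ρ M (concatenate M U W X D) :=
  foldl_invariant (fun _ q h' => .concatenateLast hB hM h (.concatenateFirst hM h h' _ _ _ _)
    q.1 q.2.1 q.2.2.1 q.2.2.2) _ _ h

lemma SoundTables.concatenateOpposite (hB : 0 ≤ B) (hM : SoundTable ρ M) {D : Tables V}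
    (h : SoundTables ρ M D) (U W X : Finset V) :
    SoundTables ρ M (concatenateOpposite M U W X D) :=
  foldl_invariant (fun _ q h' => .concatenateOppositeLast hB hM h
    (.concatenateOppositeFirst hM h h' _ _ _ _) q.1 q.2.1 q.2.2.1 q.2.2.2) _ _ h

lemma iterate_invariant {α : Type*} {f : α → α} {I : α → Prop} (h : ∀ a, I a → I (f a)) (k : ℕ)
    (a : α) (ha : I a) : I (f^[k] a) := by
  induction k generalizing a with
  | zero => exact ha
  | succ k ih => rw [Function.iterate_succ_apply]; exact ih _ (h a ha)

lemma SoundTables.breadthRounds (hB : 0 ≤ B) (hM : SoundTable ρ M) (κ : HiddenConstants)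
    {D : Tables V} (h : SoundTables ρ M D) : SoundTables ρ M (breadthRounds κ M D) :=
  iterate_invariant (fun _ h => soundTables_breadthSearch hB hM h) _ _ h

lemma soundTables_funnelsOf (hB : 0 ≤ B) (hM : SoundTable ρ M) (κ : HiddenConstants)
    (S : Finset V) : SoundTables ρ M (funnelsOf κ M S) := by
  have h1 := SoundTables.breadthRounds hB hM κ (soundTables_initDS hB hM)
  have h2 := iterate_invariant (f := ElectricCar.concatenate M S S S) (I := SoundTables ρ M)
    (fun _ h => SoundTables.concatenate hB hM h S S S) ⌈logn V⌉₊ _ h1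
  exact .breadthRounds hB hM κ (.concatenate hB hM h2 _ _ _)

lemma SoundTables.longRound (hB : 0 ≤ B) (hM : SoundTable ρ M) {D : Tables V}
    (h : SoundTables ρ M D) (T : Finset V) : SoundTables ρ M (longRound M T D) :=
  .concatenate hB hM (.concatenateOpposite hB hM h _ _ _) _ _ _

end SoundOps

/-! ### Soundness of the shortcut tables -/

section SoundShort

variable {V : Type u} {B : ℝ} {ρ : ChargeRel V B} {M N : V → V → EReal}

/-- The single entry `e` at `(x, y)` is realized. -/
def SoundEntry (ρ : ChargeRel V B) (x y : V) (e : EReal) : Prop :=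
  OnReal (fun m => -B ≤ m ∧
    ∀ b, 0 ≤ b → b ≤ B → 0 ≤ b + m → ρ.rel x b y (min (b + m) B)) e

lemma soundEntry_coe {x y : V} {m : ℝ} (hB : 0 ≤ B) (hm : -B ≤ m)
    (h : ∀ b c, 0 ≤ b → b ≤ B → 0 ≤ c → c ≤ B → c ≤ b + m → ρ.rel x b y c) :
    SoundEntry ρ x y (m : EReal) :=
  SoundTable.of_step (EReal.coe_ne_top m)
    (fun m' hm' => by rw [EReal.coe_eq_coe_iff] at hm'; subst hm'; exact ⟨hm, h⟩) hB

lemma SoundEntry.of_reverse (hB : 0 ≤ B) {x y : V} {e : EReal}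
    (h : SoundEntry ρ.reverse y x e) : SoundEntry ρ x y e := by
  rcases OnReal.cases h with rfl | ⟨m, rfl, hm, hr⟩
  · exact onReal_bot _
  · refine soundEntry_coe hB hm fun b c h0 h1 h2 h3 h4 => ?_
    have r := hr (B - c) (by linarith) (by linarith) (by linarith)
    simp only [ChargeRel.reverse, sub_sub_cancel] at r
    have h5 : B - b ≤ min (B - c + m) B := le_min (by linarith) (by linarith)
    have bd := ρ.bounds r
    exact ρ.raise r (by linarith) h1

lemma coe_min_zero (m : ℝ) : min (m : EReal) 0 = ((min m 0 : ℝ) : EReal) := by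
  rw [← EReal.coe_zero]
  exact (EReal.coe_strictMono.monotone.map_min).symm

lemma SoundTable.combine [Finite V] (hB : 0 ≤ B) (hM : SoundTable ρ M) (hN : SoundTable ρ N) :
    SoundTable ρ (combine B M N) := by
  intro x z
  refine OnReal.iSup fun y => ?_
  change SoundEntry ρ x z _
  rcases (hM x y).cases with hm | ⟨m, hm, hmB, -⟩
  · rw [hm]; simpa [SoundEntry] using onReal_bot _
  rcases (hN y z).cases with hn | ⟨n, hn, hnB, -⟩
  · rw [hn]; simpa [SoundEntry] using onReal_bot _
  rw [hm, hn]
  split_ifs with h1 h2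
  · norm_cast at h1
    rw [← EReal.coe_add]
    refine soundEntry_coe hB (by linarith [h1.1, h1.2]) fun b c b0 b1 c0 c1 hc => ?_
    refine ρ.trans (hM.step hm b0 b1 (c := min (b + m) B) (le_min (by linarith [h1.1]) hB)
      (min_le_right _ _) (min_le_left _ _)) (hN.step hn (le_min (by linarith [h1.1]) hB)
      (min_le_right _ _) c0 c1 ?_)
    rcases min_choice (b + m) B with h | h <;> rw [h] <;> linarith [h1.2]
  · rw [coe_min_zero, coe_min_zero, ← EReal.coe_add] at h2 ⊢
    norm_cast at h2
    refine soundEntry_coe hB h2 fun b c b0 b1 c0 c1 hc => ?_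
    have e1 := min_le_left m 0
    have e2 := min_le_right m 0
    have e3 := min_le_left n 0
    have e4 := min_le_right n 0
    exact ρ.trans (hM.step hm b0 b1 (c := b + min m 0) (by linarith) (by linarith) (by linarith))
      (hN.step hn (by linarith) (by linarith) c0 c1 (by linarith))
  · exact onReal_bot _

lemma soundEntry_hardShortcut [Fintype V] (hB : 0 ≤ B) (hM : SoundTable ρ M) (x y z : V) :
    SoundEntry ρ x z (hardShortcut B M x y z) := by
  have hsum : ∀ (P : V → Prop) [∀ a, Decidable (P a)],
      (⨆ a, if P a then M y a + M a z else ⊥) = ⊥ ∨ ∃ a, ∃ m₁ m₂ : ℝ, P a ∧ M y a = m₁ ∧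
        M a z = m₂ ∧ (⨆ a, if P a then M y a + M a z else ⊥) = ((m₁ + m₂ : ℝ) : EReal) := by
    intro P _
    have hnt : ∀ a, M y a + M a z ≠ ⊤ := fun a =>
      (OnReal.add (Q := fun _ => True) (hM y a).1 (hM a z).1 fun _ _ _ _ => trivial).1
    rcases eq_bot_or_coe (iSup_ite_ne_top (P := P) hnt) with h | ⟨k, hk⟩
    · exact Or.inl h
    · obtain ⟨a, ha, hk'⟩ := iSup_ite_eq_coe hk
      rcases (hM y a).cases with h₁ | ⟨m₁, h₁, -⟩
      · simp [h₁] at hk'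
      rcases (hM a z).cases with h₂ | ⟨m₂, h₂, -⟩
      · simp [h₂] at hk'
      refine Or.inr ⟨a, m₁, m₂, ha, h₁, h₂, ?_⟩
      rw [hk, ← hk', h₁, h₂, EReal.coe_add]
  unfold hardShortcut
  rcases (hM x y).cases with hm | ⟨m, hm, hmB, -⟩
  · simp only [hm]
    simpa [SoundEntry] using onReal_bot _
  refine OnReal.max (OnReal.ite fun h => ?_) (OnReal.max (OnReal.ite fun h => ?_)
    (OnReal.max (OnReal.ite fun h => ?_) (OnReal.ite fun h => ?_)))
  · unfold gainAbove at h ⊢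
    rcases hsum (fun a => -(M x y) ≤ M y a ∧ M y a ≤ 0) with hk | ⟨a, m₁, m₂, ha, h₁, h₂, hk⟩
    · rw [hk, EReal.add_bot]; exact onReal_bot _
    rw [hk, hm, ← EReal.coe_add] at h ⊢
    rw [hm, h₁] at ha
    norm_cast at h ha
    have g1 := hM.ge h₁
    refine soundEntry_coe hB (by linarith) fun b c b0 b1 c0 c1 hc => ?_
    -- The capacity may cut `b + m` down to `B`; the middle arc stays traversable because both `-m ≤
    -- m₁` and `-B ≤ m₁`.
    have e1 : 0 ≤ min (b + m) B + m₁ := by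
      rcases min_choice (b + m) B with h | h <;> rw [h] <;> linarith
    refine ρ.trans (hM.step hm b0 b1 (c := min (b + m) B) (le_min (by linarith) hB)
      (min_le_right _ _) (min_le_left _ _)) (ρ.trans (hM.step h₁ (le_min (by linarith) hB)
      (min_le_right _ _) (c := min (b + m) B + m₁) e1 ?_ le_rfl)
      (hM.step h₂ e1 ?_ c0 c1 ?_))
    · linarith [min_le_right (b + m) B]
    · linarith [min_le_right (b + m) B]
    · rcases min_choice (b + m) B with h | h <;> rw [h] <;> linarith
  · unfold gainBelow at h ⊢
    rcases hsum (fun a => 0 ≤ M y a ∧ M y a ≤ eabs (M x y)) with hk | ⟨a, m₁, m₂, ha, h₁, h₂, hk⟩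
    · rw [hk, EReal.add_bot]; exact onReal_bot _
    rw [hk, hm, ← EReal.coe_add] at h ⊢
    rw [hm, h₁, eabs_coe] at ha
    norm_cast at h ha
    rw [abs_of_nonpos h.1] at ha
    refine soundEntry_coe hB (by linarith) fun b c b0 b1 c0 c1 hc => ?_
    exact ρ.trans (hM.step hm b0 b1 (c := b + m) (by linarith) (by linarith) le_rfl)
      (ρ.trans (hM.step h₁ (by linarith) (by linarith) (c := b + m + m₁) (by linarith)
        (by linarith) le_rfl) (hM.step h₂ (by linarith) (by linarith) c0 c1 (by linarith)))
  · unfold gainBelow at h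
    rcases hsum (fun a => 0 ≤ M y a ∧ M y a ≤ eabs (M x y)) with hk | ⟨a, m₁, m₂, ha, h₁, h₂, hk⟩
    · rw [hk, EReal.add_bot, hm] at h
      simp at h
    rw [hk, hm, ← EReal.coe_add] at h
    rw [hm]
    rw [hm, h₁, eabs_coe] at ha
    norm_cast at h ha
    rw [abs_of_nonpos h.1] at ha
    refine soundEntry_coe hB (by linarith) fun b c b0 b1 c0 c1 hc => ?_
    exact ρ.trans (hM.step hm b0 b1 (c := b + m) (by linarith) (by linarith) le_rfl)
      (ρ.trans (hM.step h₁ (by linarith) (by linarith) (c := b + m + m₁) (by linarith)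
        (by linarith) le_rfl) (hM.step h₂ (by linarith) (by linarith) c0 c1 (by linarith)))
  · unfold lastArcOver
    rcases eq_bot_or_coe (iSup_ite_ne_top (P := fun a => eabs (M x y) ≤ M y a)
      (f := fun a => M a z) fun a => (hM a z).1) with hk | ⟨m₂, hk⟩
    · rw [hk]; simpa using onReal_bot _
    obtain ⟨a, ha, h₂⟩ := iSup_ite_eq_coe hk
    rw [hk, hm, ← EReal.coe_strictMono.monotone.map_min]
    rw [hm, eabs_coe] at ha
    rw [hm] at h
    norm_cast at h
    rw [abs_of_nonpos h] at ha
    obtain ⟨m₁, h₁, ha⟩ := exists_real_of_le (hM y a).1 ha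
    have g2 := hM.ge h₂
    refine soundEntry_coe hB (le_min hmB g2) fun b c b0 b1 c0 c1 hc => ?_
    have e1 := min_le_left m m₂
    have e2 := min_le_right m m₂
    -- The middle arc regains at least what the first one lost; anything above the initial charge
    -- `b` is dropped.
    exact ρ.trans (hM.step hm b0 b1 (c := b + m) (by linarith) (by linarith) le_rfl)
      (ρ.trans (hM.step h₁ (by linarith) (by linarith) (c := b) (by linarith)
        (by linarith) (by linarith)) (hM.step h₂ (by linarith) (by linarith) c0 c1 (by linarith)))

lemma SoundTable.shortShortcuts [Fintype V] (hB : 0 ≤ B) (hM : SoundTable ρ M) :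
    SoundTable ρ (shortShortcuts B M) := fun x z =>
  OnReal.max (OnReal.max (hM x z) (OnReal.max (hM.combine hB hM x z)
    (hM.combine hB (hM.combine hB hM) x z))) (OnReal.iSup fun y => soundEntry_hardShortcut hB hM x y z)

lemma soundEntry_arcForward [Fintype V] (hB : 0 ≤ B) (hM : SoundTable ρ M)
    {F : V → V → V → EReal} (hF : SoundFirst ρ M F) (T : Finset V) (p q : V) :
    SoundEntry ρ p q (arcForward B M T F p q) := by
  refine OnReal.max (OnReal.iSup fun v => OnReal.iSup fun x => OnReal.ite fun h => ?_)
    (OnReal.max (OnReal.iSup fun v => OnReal.iSup fun x => OnReal.ite fun h => ?_)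
      (OnReal.iSup fun v => OnReal.iSup fun x => OnReal.ite fun h => ?_))
  · rcases (hF p v x).cases with hd | ⟨d, hd, m, hm, h1, -⟩
    · rw [hd, EReal.bot_add]; exact onReal_bot _
    rcases (hM x q).cases with hn | ⟨n, hn, -⟩
    · rw [hn, EReal.add_bot]; exact onReal_bot _
    rw [hd, hn, hm, ← EReal.coe_add] at h
    rw [hd, hn, ← EReal.coe_add]
    norm_cast at h
    refine soundEntry_coe hB (by linarith) fun b c b0 b1 c0 c1 hc => ?_
    have r1 := h1 (by linarith) (b + m) (by linarith) (by linarith)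
    have bd := ρ.bounds r1
    exact ρ.trans (hM.step hm b0 b1 (c := b + m) (by linarith) (by linarith) le_rfl)
      (ρ.trans r1 (hM.step hn bd.2.2.1 bd.2.2.2 c0 c1 (by linarith)))
  · rcases (hF p v x).cases with hd | ⟨d, hd, m, hm, h1, -⟩
    · rw [hd, EReal.bot_add, le_bot_iff] at h
      rw [h.2.2]; exact onReal_bot _
    rcases (hM x q).cases with hn | ⟨n, hn, -⟩
    · rw [hn, EReal.add_bot, le_bot_iff] at h
      rw [h.2.2]; exact onReal_bot _
    rw [hd, hn, hm, ← EReal.coe_add] at h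
    rw [hm]
    norm_cast at h
    refine soundEntry_coe hB (hM.ge hm) fun b c b0 b1 c0 c1 hc => ?_
    have r1 := h1 (by linarith) (b + m) (by linarith) (by linarith)
    have bd := ρ.bounds r1
    exact ρ.trans (hM.step hm b0 b1 (c := b + m) (by linarith) (by linarith) le_rfl)
      (ρ.trans r1 (hM.step hn bd.2.2.1 bd.2.2.2 c0 c1 (by linarith)))
  · rcases (hF v p x).cases with hd | ⟨d, hd, m, hm, h1, -⟩
    · rw [hd, EReal.bot_add] at h
      simp at h
    rcases (hM x q).cases with hn | ⟨n, hn, -⟩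
    · rw [hn, EReal.add_bot] at h
      simp at h
    rw [hd, hn, hm, ← EReal.coe_add] at h
    rw [hd, hn, hm, ← EReal.coe_add, ← EReal.coe_neg, ← EReal.coe_add]
    norm_cast at h
    have hge := hM.ge hm
    refine soundEntry_coe hB (by linarith) fun b c b0 b1 c0 c1 hc => ?_
    -- `SoundFirst` admits only charges up to `B + m`. Cutting a larger `b` down to `B + m` costs
    -- nothing, since the walk then ends with at least `B + (d + n) ≥ B`.
    have e1 := min_le_left b (B + m)
    have e2 := min_le_right b (B + m)
    have e3 : 0 ≤ min b (B + m) := le_min b0 (by linarith)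
    have r1 := h1 (by linarith) (min b (B + m)) e3 e2
    have bd := ρ.bounds r1
    refine ρ.trans (ρ.refl e3 e1 b1) (ρ.trans r1 (hM.step hn bd.2.2.1 bd.2.2.2 c0 c1 ?_))
    rcases min_choice b (B + m) with h' | h' <;> rw [h'] <;> linarith

lemma SoundTable.arcBoundedToMonotone [Fintype V] (hB : 0 ≤ B) (hM : SoundTable ρ M)
    {D : Tables V} (hD : SoundTables ρ M D) (T : Finset V) :
    SoundTable ρ (arcBoundedToMonotone B M T D) := by
  intro p q
  rw [arcBoundedToMonotone_eq, hD.mono]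
  exact OnReal.max (hM p q) (OnReal.max (soundEntry_arcForward hB hM hD.first T p q)
    (SoundEntry.of_reverse hB (soundEntry_arcForward hB (hM.transpose hB) hD.last T q p)))

lemma SoundTable.sup (hM : SoundTable ρ M) (hN : SoundTable ρ N) : SoundTable ρ (M ⊔ N) :=
  fun x y => OnReal.max (hM x y) (hN x y)

variable [Fintype V]

lemma soundTables_of_mem_computeFunnels (hB : 0 ≤ B) (hM : SoundTable ρ M) (κ : HiddenConstants)
    {D : Tables V} (hD : D ∈ (computeFunnels κ M).support) : SoundTables ρ M D := by
  rw [computeFunnels_eq, PMF.mem_support_bind_iff] at hD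
  obtain ⟨S, -, hS⟩ := hD
  rw [PMF.mem_support_pure_iff] at hS
  exact hS ▸ soundTables_funnelsOf hB hM κ S

lemma soundTables_of_mem_longLoop (hB : 0 ≤ B) (hM : SoundTable ρ M) (κ : HiddenConstants)
    (k i : ℕ) {st st' : Tables V × Finset V} (h : SoundTables ρ M st.1)
    (h' : st' ∈ (longLoop κ M k i st).support) : SoundTables ρ M st'.1 := by
  induction k generalizing i st with
  | zero =>
    rw [longLoop, PMF.mem_support_pure_iff] at h'
    exact h' ▸ h
  | succ k ih =>
    rw [longLoop, PMF.mem_support_bind_iff] at h'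
    obtain ⟨T, -, hT⟩ := h'
    exact ih (i + 1) (iterate_invariant (f := longRound M T) (I := SoundTables ρ M)
      (fun _ h => h.longRound hB hM T) _ _ h) hT

lemma soundTable_of_mem_longShortcuts (hB : 0 ≤ B) (hM : SoundTable ρ M) (κ : HiddenConstants)
    {L : V → V → EReal} (hL : L ∈ (longShortcuts κ B M).support) : SoundTable ρ L := by
  rw [longShortcuts, PMF.mem_support_bind_iff] at hL
  obtain ⟨D, hD, hL⟩ := hL
  rw [PMF.mem_support_bind_iff] at hL
  obtain ⟨st, hst, hL⟩ := hL
  rw [PMF.mem_support_pure_iff] at hL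
  rw [hL]
  exact hM.arcBoundedToMonotone hB (soundTables_of_mem_longLoop hB hM κ _ _
    (soundTables_of_mem_computeFunnels hB hM κ hD) hst) _

lemma repeatRandom_support {α : Type u} {f : α → PMF α} {I : α → Prop}
    (h : ∀ a, I a → ∀ b ∈ (f a).support, I b) (k : ℕ) {a b : α} (ha : I a)
    (hb : b ∈ (repeatRandom f k a).support) : I b := by
  induction k generalizing a with
  | zero =>
    rw [repeatRandom, PMF.mem_support_pure_iff] at hb
    exact hb ▸ ha
  | succ k ih =>
    rw [repeatRandom, PMF.mem_support_bind_iff] at hb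
    obtain ⟨c, hc, hb⟩ := hb
    exact ih (h a ha c hc) hb

lemma soundTable_of_mem_updateShortcuts (hB : 0 ≤ B) (hM : SoundTable ρ M) (κ : HiddenConstants)
    {L : V → V → EReal} (hL : L ∈ (updateShortcuts κ B M).support) : SoundTable ρ L := by
  rw [updateShortcuts, PMF.mem_support_bind_iff] at hL
  obtain ⟨st, hst, hL⟩ := hL
  rw [PMF.mem_support_pure_iff] at hL
  have : SoundTable ρ st.1 ∧ SoundTable ρ st.2 := by
    refine repeatRandom_support (I := fun st => SoundTable ρ st.1 ∧ SoundTable ρ st.2)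
      ?_ _ (a := (M, M)) ⟨hM, hM⟩ hst
    rintro ⟨N, N'⟩ ⟨hN, hN'⟩ st' hst'
    rw [innerIteration, PMF.mem_support_bind_iff] at hst'
    obtain ⟨b, -, hst'⟩ := hst'
    split_ifs at hst' with hb
    · rw [PMF.mem_support_bind_iff] at hst'
      obtain ⟨L, hL, hst'⟩ := hst'
      rw [PMF.mem_support_pure_iff] at hst'
      rw [hst']
      exact ⟨hN.shortShortcuts hB, hN'.sup (soundTable_of_mem_longShortcuts hB hN κ hL)⟩
    · rw [PMF.mem_support_pure_iff] at hst'
      rw [hst']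
      exact ⟨hN.shortShortcuts hB, hN'⟩
  rw [hL]
  exact this.1.sup this.2

lemma soundTable_of_mem_computeShortcuts (hB : 0 ≤ B) {G : Digraph V} {g : V → V → ℝ}
    (h0 : SoundTable ρ (initialShortcuts G g)) (κ : HiddenConstants)
    {L : V → V → EReal} (hL : L ∈ (computeShortcuts κ G g B).support) : SoundTable ρ L :=
  repeatRandom_support (fun _ hM _ hL => soundTable_of_mem_updateShortcuts hB hM κ hL) _ h0 hL

end SoundShort

/-! ### Funnels -/

section Funnel

variable {V : Type u} {M : V → V → EReal}

/-- On the positions from `s` to `t`, the walk `w` follows entries of `M`, and its levels are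
given by `r`. -/
def Walk (M : V → V → EReal) (w : ℕ → V) (r : ℕ → ℝ) (s t : ℕ) : Prop :=
  ∀ i, s ≤ i → i < t → M (w i) (w (i + 1)) = ((r (i + 1) - r i : ℝ) : EReal)

/-- The gains between the positions `s` and `t` alternate in sign and decrease in size. -/
def Funnel (r : ℕ → ℝ) (s t : ℕ) : Prop :=
  ∀ i, s ≤ i → i + 1 < t → (r (i + 1) - r i) * (r (i + 2) - r (i + 1)) < 0 ∧
    |r (i + 2) - r (i + 1)| ≤ |r (i + 1) - r i|

/-- The table dominates the gains of all funnels. -/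
def FunnelComplete (M : V → V → EReal) (F : V → V → V → EReal) : Prop :=
  ∀ (w : ℕ → V) (r : ℕ → ℝ) (s t : ℕ), s < t → Walk M w r s t → Funnel r s t →
    ((r t - r s : ℝ) : EReal) ≤ F (w s) (w (s + 1)) (w t)

lemma Walk.mono {w : ℕ → V} {r : ℕ → ℝ} {s t s' t' : ℕ} (h : Walk M w r s t) (hs : s ≤ s')
    (ht : t' ≤ t) : Walk M w r s' t' := fun i h1 h2 => h i (by omega) (by omega)

lemma Funnel.mono {r : ℕ → ℝ} {s t s' t' : ℕ} (h : Funnel r s t) (hs : s ≤ s')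
    (ht : t' ≤ t) : Funnel r s' t' := fun i h1 h2 => h i (by omega) (by omega)

lemma zigzag_cases {a b : ℝ} (h : a * b < 0) (h' : |b| ≤ |a|) :
    (a < 0 ∧ 0 < b ∧ b ≤ -a) ∨ (0 < a ∧ b < 0 ∧ -b ≤ a) := by
  rcases mul_neg_iff.1 h with ⟨h1, h2⟩ | ⟨h1, h2⟩
  · right; rw [abs_of_neg h2, abs_of_pos h1] at h'; exact ⟨h1, h2, h'⟩
  · left; rw [abs_of_neg h1, abs_of_pos h2] at h'; exact ⟨h1, h2, h'⟩

/-- Alternation and shrinking make the level intervals of consecutive arcs nested, so all levels lie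
in the interval of the first arc. -/
lemma Funnel.range {r : ℕ → ℝ} {t : ℕ} (n : ℕ) : ∀ {s : ℕ}, s + n + 1 = t → Funnel r s t →
    ∀ i, s ≤ i → i ≤ t → (r (s + 1) ≤ r s → r (s + 1) ≤ r i ∧ r i ≤ r s) ∧
      (r s ≤ r (s + 1) → r s ≤ r i ∧ r i ≤ r (s + 1)) := by
  induction n with
  | zero =>
    intro s hs _ i h1 h2
    rcases (show i = s ∨ i = s + 1 by omega) with rfl | rfl <;>
    exact ⟨fun h => by simp [h], fun h => by simp [h]⟩
  | succ n ih =>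
    intro s hs hF i h1 h2
    rcases Nat.eq_or_lt_of_le h1 with rfl | h1
    · exact ⟨fun h => by simp [h], fun h => by simp [h]⟩
    · have h := ih (s := s + 1) (by omega) (hF.mono (by omega) le_rfl) i h1 h2
      have hz := hF s le_rfl (by omega)
      rcases zigzag_cases hz.1 hz.2 with hz | hz
      · have := h.2 (by linarith)
        exact ⟨fun _ => ⟨by linarith, by linarith⟩, fun h' => by linarith⟩
      · have := h.1 (by linarith)
        exact ⟨fun h' => by linarith, fun _ => ⟨by linarith, by linarith⟩⟩

lemma Funnel.range_neg {r : ℕ → ℝ} {s t i : ℕ} (hF : Funnel r s t) (hst : s < t)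
    (h : r (s + 1) ≤ r s) (h1 : s ≤ i) (h2 : i ≤ t) : r (s + 1) ≤ r i ∧ r i ≤ r s :=
  (Funnel.range (t - s - 1) (by omega) hF i h1 h2).1 h

/-- The loops update their table in place. It suffices to follow one quadruple: earlier iterations
preserve `I`, that iteration establishes `G`, and later ones preserve `G`. -/
lemma foldl_reaches {α β : Type*} {f : α → β → α} {I G : α → Prop}
    (hI : ∀ a b, I a → I (f a b)) (hG : ∀ a b, I a → G a → G (f a b)) {b : β}
    (hr : ∀ a, I a → G (f a b)) (l : List β) (hb : b ∈ l) (a : α) (ha : I a) :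
    G (l.foldl f a) := by
  induction l generalizing a with
  | nil => simp at hb
  | cons c l ih =>
    rcases List.mem_cons.1 hb with rfl | hb
    · exact (foldl_invariant (I := fun a => I a ∧ G a)
        (fun a b h => ⟨hI a b h.1, hG a b h.1 h.2⟩) l _ ⟨hI _ _ ha, hr a ha⟩).2
    · exact ih hb _ (hI a c ha)

variable [Fintype V]

lemma first_le_breadthSearch (D : Tables V) (u v x : V) :
    D.first u v x ≤ (breadthSearch M D).first u v x := le_max_left _ _

lemma first_le_breadthSearch_iterate (D : Tables V) (k : ℕ) (u v x : V) :
    D.first u v x ≤ ((breadthSearch M)^[k] D).first u v x := by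
  refine iterate_invariant (I := fun D' : Tables V => D.first u v x ≤ D'.first u v x)
    (fun D' h => h.trans (first_le_breadthSearch _ _ _ _)) k D le_rfl

lemma breadthSearch_funnel {D : Tables V} {w : ℕ → V} {r : ℕ → ℝ} {s t : ℕ}
    (hW : Walk M w r s t) (hF : Funnel r s t) (hst : s + 1 < t)
    (h : ((r t - r (s + 1) : ℝ) : EReal) ≤ D.first (w (s + 1)) (w (s + 2)) (w t)) :
    ((r t - r s : ℝ) : EReal) ≤ (breadthSearch M D).first (w s) (w (s + 1)) (w t) := by
  refine le_trans ?_ (le_max_right _ _)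
  have h1 := hW s le_rfl (by omega)
  have h2 := hW (s + 1) (by omega) (by omega)
  have h3 := hF s le_rfl hst
  have hop : Opposing (M (w s) (w (s + 1))) (M (w (s + 1)) (w (s + 2))) := by
    rw [h1, h2, opposing_coe]
    rcases zigzag_cases h3.1 h3.2 with h | h
    · right; exact ⟨h.1, h.2.1.le, h.2.2⟩
    · left; exact ⟨h.1.le, by linarith, h.2.1.le⟩
  rw [h1, show r t - r s = (r (s + 1) - r s) + (r t - r (s + 1)) by ring, EReal.coe_add]
  refine add_le_add_right (h.trans ?_) _
  refine le_trans ?_ (le_iSup (fun a => if Opposing ((r (s + 1) - r s : ℝ) : EReal)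
    (M (w (s + 1)) a) then D.first (w (s + 1)) a (w t) else ⊥) (w (s + 2)))
  rw [h1] at hop
  rw [if_pos hop]

lemma breadthSearch_iterate_funnel {D : Tables V} {w : ℕ → V} {r : ℕ → ℝ} {a t : ℕ} (hat : a < t)
    (h : ((r t - r a : ℝ) : EReal) ≤ D.first (w a) (w (a + 1)) (w t)) (k : ℕ) : ∀ {s : ℕ},
    s ≤ a → a ≤ s + k → Walk M w r s t → Funnel r s t →
    ((r t - r s : ℝ) : EReal) ≤ ((breadthSearch M)^[k] D).first (w s) (w (s + 1)) (w t) := by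
  induction k with
  | zero =>
    intro s h1 h2 _ _
    obtain rfl : s = a := by omega
    exact h
  | succ k ih =>
    intro s h1 h2 hW hF
    rcases Nat.eq_or_lt_of_le h1 with rfl | h1
    · exact h.trans (first_le_breadthSearch_iterate _ _ _ _ _)
    · rw [Function.iterate_succ_apply']
      exact breadthSearch_funnel hW hF (by omega)
        (ih (by omega) (by omega) (hW.mono (by omega) le_rfl) (hF.mono (by omega) le_rfl))

/-- `initDS` covers one arc and each round one more, hence the `1 +` in the bound on the length. -/
lemma breadthRounds_init_funnel {w : ℕ → V} {r : ℕ → ℝ} {s t : ℕ} (κ : HiddenConstants)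
    (hst : s < t) (hk : t ≤ s + 1 + ⌈(Fintype.card V : ℝ) / funnelParam κ V⌉₊)
    (hW : Walk M w r s t) (hF : Funnel r s t) :
    ((r t - r s : ℝ) : EReal)
      ≤ (breadthRounds κ M (initDS M)).first (w s) (w (s + 1)) (w t) := by
  refine breadthSearch_iterate_funnel (a := t - 1) (by omega) ?_ _ (by omega) (by omega) hW hF
  have e : t - 1 + 1 = t := by omega
  have := hW (t - 1) (by omega) (by omega)
  rw [e] at this
  rw [e]
  simp [initDS, this]

lemma concatenateFirst_le (D₀ D : Tables V) (u v w x a b c : V) :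
    D.first a b c ≤ (concatenateFirst M D₀ D u v w x).first a b c := by
  unfold concatenateFirst
  split_ifs
  · dsimp only [Tables.setFirst]
    split_ifs with h
    · obtain ⟨rfl, rfl, rfl⟩ := h
      exact le_max_left _ _
    · exact le_rfl
  · exact le_rfl

lemma concatenateLast_first (D₀ D : Tables V) (u v w x : V) :
    (concatenateLast M D₀ D u v w x).first = D.first := by
  unfold concatenateLast
  split_ifs <;> rfl

lemma first_le_concatenate (U W X : Finset V) (D : Tables V) (a b c : V) :
    D.first a b c ≤ (concatenate M U W X D).first a b c := by
  refine foldl_invariant (I := fun D' : Tables V => D.first a b c ≤ D'.first a b c)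
    (fun D' q h => ?_) _ _ le_rfl
  rw [concatenateLast_first]
  exact h.trans (concatenateFirst_le _ _ _ _ _ _ _ _ _)

lemma mem_quadruples {U Y W X : Finset V} {u y w x : V} (hu : u ∈ U) (hy : y ∈ Y) (hw : w ∈ W)
    (hx : x ∈ X) : (u, y, w, x) ∈ quadruples U Y W X := by
  simp [quadruples, hu, hy, hw, hx]

lemma le_concatenate {U W X : Finset V} {D : Tables V} {u v w a x : V} (hu : u ∈ U) (hw : w ∈ W)
    (hx : x ∈ X) {m m' d₁ d₂ : ℝ} (hm : M u v = m) (hm0 : m < 0) (hm' : M w a = m')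
    (h0 : m' ≤ 0) (hwin : -(d₁ - m) ≤ m') (h₁ : (d₁ : EReal) ≤ D.first u v w)
    (h₂ : (d₂ : EReal) ≤ D.first w a x) :
    ((d₁ + d₂ : ℝ) : EReal) ≤ (concatenate M U W X D).first u v x := by
  refine foldl_reaches (I := fun D' : Tables V => (d₁ : EReal) ≤ D'.first u v w)
    (G := fun D' : Tables V => ((d₁ + d₂ : ℝ) : EReal) ≤ D'.first u v x) ?_ ?_ ?_ _
    (mem_quadruples hu (Finset.mem_univ v) hw hx) _ h₁
  · intro D' q h
    rw [concatenateLast_first]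
    exact h.trans (concatenateFirst_le _ _ _ _ _ _ _ _ _)
  · intro D' q _ h
    rw [concatenateLast_first]
    exact h.trans (concatenateFirst_le _ _ _ _ _ _ _ _ _)
  · intro D' h
    rw [concatenateLast_first]
    dsimp only
    unfold concatenateFirst
    rw [if_pos (by rw [hm]; exact_mod_cast hm0)]
    dsimp only [Tables.setFirst]
    rw [if_pos ⟨rfl, rfl, rfl⟩, EReal.coe_add]
    refine le_trans (add_le_add h ?_) (le_max_right _ _)
    refine le_trans (h₂.trans ?_) (le_iSup (fun a => if -(D'.first u v w - M u v) ≤ M w a ∧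
      M w a ≤ 0 then D.first w a x else ⊥) a)
    rw [if_pos]
    refine ⟨?_, by rw [hm']; exact_mod_cast h0⟩
    rw [hm, hm']
    -- The current entry may exceed `d₁`; a larger entry only widens the window.
    refine le_trans ?_ (show ((-(d₁ - m) : ℝ) : EReal) ≤ m' by exact_mod_cast hwin)
    rw [EReal.coe_neg, EReal.coe_sub]
    exact EReal.neg_le_neg_iff.2 (EReal.sub_le_sub h le_rfl)

/-- The sample `S` hits each window of the funnel. -/
def HitsFunnel (β : ℕ) (S : Finset V) (w : ℕ → V) (r : ℕ → ℝ) (k : ℕ) : Prop :=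
  ∀ a, 1 ≤ a → a + β ≤ k → ∃ i, a ≤ i ∧ i < a + β ∧ r (i + 1) < r i ∧ w i ∈ S

/-- The member of `P` with exactly `c` members before it in the interval halves the count; this
drives the doubling in `funnelsOf_complete`. -/
lemma exists_middle (P : Finset ℕ) {s t c : ℕ}
    (h1 : c < (P.filter fun i => s ≤ i ∧ i < t).card)
    (h2 : (P.filter fun i => s ≤ i ∧ i < t).card ≤ 2 * c) :
    ∃ m ∈ P, s < m ∧ m < t ∧ (P.filter fun i => s ≤ i ∧ i < m).card ≤ c ∧
      (P.filter fun i => m ≤ i ∧ i < t).card ≤ c := by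
  have hex : ∃ m, c < (P.filter fun i => s ≤ i ∧ i < m + 1).card :=
    ⟨t, h1.trans_le (Finset.card_le_card fun i hi => by
      rw [Finset.mem_filter] at hi ⊢; exact ⟨hi.1, hi.2.1, by omega⟩)⟩
  obtain ⟨m, hm, hmin⟩ : ∃ m, c < (P.filter fun i => s ≤ i ∧ i < m + 1).card ∧
      ∀ k < m, ¬ c < (P.filter fun i => s ≤ i ∧ i < k + 1).card :=
    ⟨Nat.find hex, Nat.find_spec hex, fun k hk => Nat.find_min hex hk⟩
  have hle : (P.filter fun i => s ≤ i ∧ i < m).card ≤ c := by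
    rcases Nat.eq_zero_or_pos m with h | h
    · rw [h]; simp
    · have := hmin (m - 1) (by omega)
      rw [Nat.sub_add_cancel h] at this
      omega
  have hmP : m ∈ P := by
    by_contra hmP
    have : (P.filter fun i => s ≤ i ∧ i < m + 1) = P.filter fun i => s ≤ i ∧ i < m := by
      apply Finset.filter_congr
      intro i hi
      have : i ≠ m := fun h => hmP (h ▸ hi)
      omega
    rw [this] at hm
    omega
  have hsm : s < m := by
    by_contra hsm
    have : (P.filter fun i => s ≤ i ∧ i < m + 1) ⊆ {s} := by
      intro i hi
      rw [Finset.mem_filter] at hi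
      rw [Finset.mem_singleton]
      omega
    have := Finset.card_le_card this
    rw [Finset.card_singleton] at this
    omega
  have hmt : m < t := by
    by_contra hmt
    have : (P.filter fun i => s ≤ i ∧ i < t).card ≤ (P.filter fun i => s ≤ i ∧ i < m).card :=
      Finset.card_le_card fun i hi => by
        rw [Finset.mem_filter] at hi ⊢; exact ⟨hi.1, hi.2.1, by omega⟩
    omega
  refine ⟨m, hmP, hsm, hmt, hle, ?_⟩
  have hsplit : (P.filter fun i => s ≤ i ∧ i < t).card
      = (P.filter fun i => s ≤ i ∧ i < m).card + (P.filter fun i => m ≤ i ∧ i < t).card := by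
    rw [← Finset.card_union_of_disjoint]
    · congr 1
      ext i
      simp only [Finset.mem_union, Finset.mem_filter]
      constructor
      · rintro ⟨h1, h2, h3⟩
        rcases Nat.lt_or_ge i m with h | h
        · exact Or.inl ⟨h1, h2, h⟩
        · exact Or.inr ⟨h1, h, h3⟩
      · rintro (⟨h1, h2, h3⟩ | ⟨h1, h2, h3⟩)
        · exact ⟨h1, h2, by omega⟩
        · exact ⟨h1, by omega, h3⟩
    · rw [Finset.disjoint_left]
      intro i hi hi'
      simp only [Finset.mem_filter] at hi hi'
      omega
  have hge : c ≤ (P.filter fun i => s ≤ i ∧ i < m).card := by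
    have : (P.filter fun i => s ≤ i ∧ i < m + 1) ⊆ insert m (P.filter fun i => s ≤ i ∧ i < m) := by
      intro i hi
      simp only [Finset.mem_insert, Finset.mem_filter] at hi ⊢
      by_cases h : i = m
      · exact Or.inl h
      · exact Or.inr ⟨hi.1, hi.2.1, by omega⟩
    have := (Finset.card_le_card this).trans (Finset.card_insert_le _ _)
    omega
  omega

/-- Only sampled positions with negative gain serve as joints, as Concatenate requires. Between
neighbouring joints breadth search suffices, `⌈log n⌉` concatenations double the number of joints
spanned, one more reaches the unsampled end, and the second breadth search extends the entry back to
the start. -/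
lemma funnelsOf_complete (κ : HiddenConstants) {S : Finset V} {w : ℕ → V} {r : ℕ → ℝ} {k : ℕ}
    (hk : 0 < k) (hW : Walk M w r 0 k) (hF : Funnel r 0 k)
    (hinj : ∀ i j, 1 ≤ i → i < j → j < k → r (i + 1) < r i → r (j + 1) < r j → w i ≠ w j)
    (hS : HitsFunnel ⌈(Fintype.card V : ℝ) / funnelParam κ V⌉₊ S w r k) :
    ((r k - r 0 : ℝ) : EReal) ≤ (funnelsOf κ M S).first (w 0) (w 1) (w k) := by
  set β := ⌈(Fintype.card V : ℝ) / funnelParam κ V⌉₊ with hβ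
  set D₁ := breadthRounds κ M (initDS M) with hD₁
  set D₂ := (concatenate M S S S)^[⌈logn V⌉₊] D₁ with hD₂
  have hbase : ∀ {s t : ℕ}, s < t → t ≤ k → t ≤ s + 1 + β →
      ((r t - r s : ℝ) : EReal) ≤ D₁.first (w s) (w (s + 1)) (w t) := fun h1 h2 h3 =>
    breadthRounds_init_funnel κ h1 h3 (hW.mono (Nat.zero_le _) h2) (hF.mono (Nat.zero_le _) h2)
  have hmono : ∀ (j : ℕ) (a b c : V),
      D₁.first a b c ≤ ((concatenate M S S S)^[j] D₁).first a b c := fun j a b c =>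
    iterate_invariant (I := fun D' : Tables V => D₁.first a b c ≤ D'.first a b c)
      (fun D' h => h.trans (first_le_concatenate _ _ _ _ _ _ _)) j D₁ le_rfl
  have h23 : ∀ a b c, D₁.first a b c ≤ (funnelsOf κ M S).first a b c := fun a b c =>
    ((hmono ⌈logn V⌉₊ a b c).trans (first_le_concatenate S S Finset.univ _ a b c)).trans
      (first_le_breadthSearch_iterate _ _ _ _ _)
  rcases Nat.lt_or_ge (1 + β) k with hkβ | hkβ
  swap
  · exact (hbase hk le_rfl (by omega)).trans (h23 _ _ _)
  set P : Finset ℕ := (Finset.range k).filter fun i => 1 ≤ i ∧ r (i + 1) < r i ∧ w i ∈ S with hP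
  have memP : ∀ {i}, i ∈ P ↔ i < k ∧ 1 ≤ i ∧ r (i + 1) < r i ∧ w i ∈ S := by
    intro i; simp [hP]
  have hPS : ∀ a, 1 ≤ a → a + β ≤ k → ∃ i ∈ P, a ≤ i ∧ i < a + β := by
    intro a h1 h2
    obtain ⟨i, hi1, hi2, hi3, hi4⟩ := hS a h1 h2
    exact ⟨i, memP.2 ⟨by omega, by omega, hi3, hi4⟩, hi1, hi2⟩
  have hPc : P.card ≤ Fintype.card V := by
    refine Finset.card_le_card_of_injOn w (fun _ _ => Finset.mem_univ _) ?_
    intro i hi j hj hij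
    rw [Finset.mem_coe, memP] at hi hj
    by_contra hne
    rcases Nat.lt_or_gt_of_ne hne with h | h
    · exact hinj i j hi.2.1 h hj.1 hi.2.2.1 hj.2.2.1 hij
    · exact hinj j i hj.2.1 h hi.1 hj.2.2.1 hi.2.2.1 hij.symm
  -- The window condition of Concatenate is the nesting of funnels: `r (m + 1)` lies above the lower
  -- bound `r (s + 1)`.
  have hwin : ∀ {s m : ℕ}, s < m → m < k → r (s + 1) < r s →
      -((r m - r s) - (r (s + 1) - r s)) ≤ r (m + 1) - r m := by
    intro s m h1 h2 h3
    have := (hF.mono (Nat.zero_le s) (le_refl k)).range_neg (by omega) h3.le (i := m + 1)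
      (by omega) (by omega)
    linarith [this.1]
  have hdouble : ∀ (j : ℕ) {s t : ℕ}, s ∈ P → t ∈ P → s < t →
      (P.filter fun i => s ≤ i ∧ i < t).card ≤ 2 ^ j → ((r t - r s : ℝ) : EReal)
        ≤ ((concatenate M S S S)^[j] D₁).first (w s) (w (s + 1)) (w t) := by
    intro j
    induction j with
    | zero =>
      intro s t hs ht hst hc
      have ht' := memP.1 ht
      refine hbase hst ht'.1.le ?_
      -- The only joint in `[s, t)` is `s` itself, so a gap of more than `β + 1` arcs would leave a
      -- window without a sample.
      by_contra hlong
      obtain ⟨i, hi, h1, h2⟩ := hPS (s + 1) (by omega) (by omega)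
      have : ({s, i} : Finset ℕ) ⊆ P.filter fun i => s ≤ i ∧ i < t := by
        intro a ha
        rw [Finset.mem_insert, Finset.mem_singleton] at ha
        rw [Finset.mem_filter]
        rcases ha with rfl | rfl
        · exact ⟨hs, le_rfl, hst⟩
        · exact ⟨hi, by omega, by omega⟩
      have := Finset.card_le_card this
      rw [Finset.card_pair (by omega)] at this
      omega
    | succ j ih =>
      intro s t hs ht hst hc
      rw [Function.iterate_succ_apply']
      rcases Nat.lt_or_ge (2 ^ j) (P.filter fun i => s ≤ i ∧ i < t).card with h | h
      · obtain ⟨m, hm, h1, h2, h3, h4⟩ := exists_middle P h (by omega)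
        have hs' := memP.1 hs
        have hm' := memP.1 hm
        have ht' := memP.1 ht
        have := le_concatenate (M := M) (U := S) (W := S) (X := S) hs'.2.2.2 hm'.2.2.2 ht'.2.2.2
          (hW s (by omega) (by omega)) (by linarith [hs'.2.2.1]) (hW m (by omega) (by omega))
          (by linarith [hm'.2.2.1]) (hwin h1 hm'.1 hs'.2.2.1) (ih hs hm h1 h3) (ih hm ht h2 h4)
        convert this using 2
        ring
      · exact (ih hs ht hst h).trans (first_le_concatenate _ _ _ _ _ _ _)
  have hlog : Fintype.card V ≤ 2 ^ ⌈logn V⌉₊ := by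
    rcases Nat.eq_zero_or_pos (Fintype.card V) with h | h
    · rw [h]; exact Nat.zero_le _
    · have h1 : (Fintype.card V : ℝ) = 2 ^ logn V := by
        unfold logn
        rw [Real.rpow_logb two_pos (by norm_num) (by exact_mod_cast h)]
      have h2 : (2 : ℝ) ^ logn V ≤ 2 ^ (⌈logn V⌉₊ : ℝ) :=
        Real.rpow_le_rpow_of_exponent_le (by norm_num) (Nat.le_ceil _)
      rw [Real.rpow_natCast, ← h1] at h2
      exact_mod_cast h2
  obtain ⟨s₀, hs₀, h0, h0'⟩ := hPS 1 le_rfl (by omega)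
  have hs := memP.1 hs₀
  have hmain : ((r k - r s₀ : ℝ) : EReal)
      ≤ (concatenate M S S Finset.univ D₂).first (w s₀) (w (s₀ + 1)) (w k) := by
    obtain ⟨t, ht, htmax⟩ := Finset.exists_max_image P id ⟨s₀, hs₀⟩
    have ht' := memP.1 ht
    have hkt : k ≤ t + 1 + β := by
      by_contra hlong
      obtain ⟨i, hi, h1, -⟩ := hPS (t + 1) (by omega) (by omega)
      have := htmax i hi
      simp only [id] at this
      omega
    have h2 : ((r k - r t : ℝ) : EReal) ≤ D₂.first (w t) (w (t + 1)) (w k) :=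
      (hbase ht'.1 le_rfl hkt).trans (hmono _ _ _ _)
    rcases Nat.eq_or_lt_of_le (htmax s₀ hs₀) with h | h
    · simp only [id] at h
      rw [h]
      exact h2.trans (first_le_concatenate _ _ _ _ _ _ _)
    · simp only [id] at h
      have h1 := hdouble ⌈logn V⌉₊ hs₀ ht h
        (((Finset.card_filter_le _ _).trans hPc).trans hlog)
      have := le_concatenate (M := M) (U := S) (W := S) (X := Finset.univ) hs.2.2.2 ht'.2.2.2
        (Finset.mem_univ (w k))
        (hW s₀ (by omega) (by omega)) (by linarith [hs.2.2.1]) (hW t (by omega) (by omega))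
        (by linarith [ht'.2.2.1]) (hwin h ht'.1 hs.2.2.1) h1 h2
      convert this using 2
      ring
  -- The window at position `1` is hit, so `s₀ ≤ β` and the `β` breadth rounds reach position `0`.
  exact breadthSearch_iterate_funnel hs.1 hmain _ (Nat.zero_le _) (by omega) hW hF

end Funnel

/-! ### Best funnels and the success probability of Compute-Funnels -/

section FunnelProbability

variable {V : Type u} {M : V → V → EReal}

/-- The vertices from which the walk leaves along a negative arc, except the first vertex, are
distinct. -/
def Reduced (w : ℕ → V) (r : ℕ → ℝ) (k : ℕ) : Prop :=
  ∀ i j, 1 ≤ i → i < j → j < k → r (i + 1) < r i → r (j + 1) < r j → w i ≠ w j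

lemma Funnel.abs_anti {r : ℕ → ℝ} {k : ℕ} (hF : Funnel r 0 k) {i j : ℕ} (hij : i ≤ j)
    (hj : j < k) : |r (j + 1) - r j| ≤ |r (i + 1) - r i| := by
  induction j, hij using Nat.le_induction with
  | base => exact le_rfl
  | succ j hij ih => exact (hF j (Nat.zero_le _) hj).2.trans (ih (by omega))

/-- If two negative arcs leave the same vertex at positions `i < j`, cut out the loop. This loses no
gain because `r j ≤ r i`, and it leaves a funnel because the arc after the cut is again negative and
not longer than the one it replaces. The position `0` is exempt since cutting there could change the
first arc. -/
lemma exists_reduced (k : ℕ) : ∀ (w : ℕ → V) (r : ℕ → ℝ), 0 < k → Walk M w r 0 k →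
    Funnel r 0 k → ∃ (k' : ℕ) (w' : ℕ → V) (r' : ℕ → ℝ), 0 < k' ∧ Walk M w' r' 0 k' ∧
      Funnel r' 0 k' ∧ Reduced w' r' k' ∧ w' 0 = w 0 ∧ w' 1 = w 1 ∧ w' k' = w k ∧
      r k - r 0 ≤ r' k' - r' 0 := by
  induction k using Nat.strong_induction_on with
  | _ k ih =>
    intro w r hk hW hF
    by_cases hR : Reduced w r k
    · exact ⟨k, w, r, hk, hW, hF, hR, rfl, rfl, rfl, le_rfl⟩
    unfold Reduced at hR
    push Not at hR
    obtain ⟨i, j, hi, hij, hj, hni, hnj, hw⟩ := hR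
    set w' : ℕ → V := fun n => if n ≤ i then w n else w (n + (j - i)) with hw'
    set r' : ℕ → ℝ := fun n => if n ≤ i then r n else r (n + (j - i)) - (r j - r i) with hr'
    have eij : i + (j - i) = j := by omega
    have wlo : ∀ n, n ≤ i → w' n = w n := fun n h => if_pos h
    have rlo : ∀ n, n ≤ i → r' n = r n := fun n h => if_pos h
    have whi : ∀ n, i ≤ n → w' n = w (n + (j - i)) := by
      intro n h
      rcases Nat.eq_or_lt_of_le h with rfl | h
      · rw [wlo _ le_rfl, eij, hw]
      · exact if_neg (by omega)
    have rhi : ∀ n, i ≤ n → r' n = r (n + (j - i)) - (r j - r i) := by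
      intro n h
      rcases Nat.eq_or_lt_of_le h with rfl | h
      · rw [rlo _ le_rfl, eij]; ring
      · exact if_neg (by omega)
    have dhi : ∀ n, i ≤ n → r' (n + 1) - r' n = r (n + (j - i) + 1) - r (n + (j - i)) := by
      intro n h
      rw [rhi n h, rhi (n + 1) (by omega), Nat.add_right_comm]; ring
    have hW' : Walk M w' r' 0 (k - (j - i)) := by
      intro n _ hn
      rcases Nat.lt_or_ge n i with h | h
      · rw [wlo n h.le, wlo (n + 1) h, rlo n h.le, rlo (n + 1) h]
        exact hW n (Nat.zero_le _) (by omega)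
      · rw [whi n h, whi (n + 1) (by omega), dhi n h, Nat.add_right_comm]
        exact hW (n + (j - i)) (Nat.zero_le _) (by omega)
    have hF' : Funnel r' 0 (k - (j - i)) := by
      intro n _ hn
      rcases Nat.lt_or_ge n i with h | h
      · rcases Nat.lt_or_ge (n + 1) i with h2 | h2
        · rw [rlo n h.le, rlo (n + 1) h, rlo (n + 2) h2]
          exact hF n (Nat.zero_le _) (by omega)
        · have hn1 : n + 1 = i := by omega
          have e := dhi (n + 1) h2
          rw [hn1, eij] at e
          rw [show n + 2 = i + 1 by omega, hn1, e, rlo n h.le, rlo i le_rfl]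
          have h3 := hF n (Nat.zero_le _) (by omega)
          rw [show n + 2 = i + 1 by omega, hn1] at h3
          refine ⟨?_, (hF.abs_anti hij.le hj).trans h3.2⟩
          rcases zigzag_cases h3.1 h3.2 with h4 | h4
          · linarith [h4.2.1]
          · exact mul_neg_of_pos_of_neg h4.1 (by linarith)
      · have e := dhi (n + 1) (by omega)
        rw [show n + 1 + (j - i) = n + (j - i) + 1 by omega] at e
        rw [dhi n h, e]
        exact hF (n + (j - i)) (Nat.zero_le _) (by omega)
    obtain ⟨k', w'', r'', h1, h2, h3, h4, h5, h6, h7, h8⟩ :=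
      ih (k - (j - i)) (by omega) w' r' (by omega) hW' hF'
    refine ⟨k', w'', r'', h1, h2, h3, h4, ?_, ?_, ?_, ?_⟩
    · rw [h5, wlo 0 (Nat.zero_le _)]
    · rw [h6, wlo 1 hi]
    · rw [h7, whi _ (by omega)]; congr 1; omega
    · refine le_trans ?_ h8
      rw [rlo 0 (Nat.zero_le _), rhi _ (by omega), show k - (j - i) + (j - i) = k by omega]
      have := (hF.mono (Nat.zero_le i) (le_refl k)).range_neg (by omega) hni.le (i := j)
        hij.le hj.le
      linarith [this.2]

/-- Gains alternate, so one of any two consecutive arcs inside the funnel is negative. -/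
lemma card_negative_ge {r : ℕ → ℝ} {k : ℕ} (hF : Funnel r 0 k) (a c : ℕ) (h : a + 2 * c ≤ k) :
    c ≤ ((Finset.Ico a (a + 2 * c)).filter fun i => r (i + 1) < r i).card := by
  induction c with
  | zero => exact Nat.zero_le _
  | succ c ih =>
    have ih' := ih (by omega)
    obtain ⟨i, hi1, hi2, hi3⟩ : ∃ i, a + 2 * c ≤ i ∧ i < a + 2 * (c + 1) ∧ r (i + 1) < r i := by
      have := hF (a + 2 * c) (Nat.zero_le _) (by omega)
      rcases zigzag_cases this.1 this.2 with h | h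
      · exact ⟨a + 2 * c, le_rfl, by omega, by linarith⟩
      · exact ⟨a + 2 * c + 1, by omega, by omega, by
          have := h.2.1
          rw [show a + 2 * c + 2 = a + 2 * c + 1 + 1 by omega] at this
          linarith⟩
    have hsub : insert i ((Finset.Ico a (a + 2 * c)).filter fun i => r (i + 1) < r i) ⊆
        (Finset.Ico a (a + 2 * (c + 1))).filter fun i => r (i + 1) < r i := by
      intro n hn
      rw [Finset.mem_insert] at hn
      rw [Finset.mem_filter, Finset.mem_Ico]
      rcases hn with rfl | hn
      · exact ⟨⟨by omega, hi2⟩, hi3⟩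
      · rw [Finset.mem_filter, Finset.mem_Ico] at hn
        exact ⟨⟨hn.1.1, by omega⟩, hn.2⟩
    have := Finset.card_le_card hsub
    rw [Finset.card_insert_of_notMem] at this
    · omega
    · rw [Finset.mem_filter, Finset.mem_Ico]
      omega

lemma Reduced.injOn {w : ℕ → V} {r : ℕ → ℝ} {k : ℕ} (hR : Reduced w r k) {a b : ℕ} (ha : 1 ≤ a)
    (hb : b ≤ k) : Set.InjOn w ((Finset.Ico a b).filter fun i => r (i + 1) < r i) := by
  intro i hi j hj hij
  rw [Finset.mem_coe, Finset.mem_filter, Finset.mem_Ico] at hi hj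
  by_contra hne
  rcases Nat.lt_or_gt_of_ne hne with h | h
  · exact hR i j (by omega) h (by omega) hi.2 hj.2 hij
  · exact hR j i (by omega) h (by omega) hj.2 hi.2 hij.symm

variable [Fintype V]

lemma Reduced.length_le {w : ℕ → V} {r : ℕ → ℝ} {k : ℕ} (hF : Funnel r 0 k)
    (hR : Reduced w r k) : k ≤ 2 * Fintype.card V + 2 := by
  by_contra hk
  have h1 := card_negative_ge hF 1 (Fintype.card V + 1) (by omega)
  have h2 := Finset.card_le_card_of_injOn w (fun _ _ => Finset.mem_univ _)
    (hR.injOn (a := 1) (b := 1 + 2 * (Fintype.card V + 1)) le_rfl (by omega))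
  rw [Finset.card_univ] at h2
  omega

/-- A gain over `k` arcs is a sum of `k` values from a finite table. Finiteness makes best walks
exist, here for funnels and later for runs below the capacity. -/
lemma finite_walk_gains (k : ℕ) :
    {g : ℝ | ∃ (w : ℕ → V) (r : ℕ → ℝ), Walk M w r 0 k ∧ r k - r 0 = g}.Finite := by
  induction k with
  | zero =>
    refine (Set.finite_singleton (0 : ℝ)).subset ?_
    rintro g ⟨w, r, -, rfl⟩
    simp
  | succ k ih =>
    refine (Set.Finite.image2 (· + ·) ih
      (Set.finite_range fun p : V × V => (M p.1 p.2).toReal)).subset ?_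
    rintro g ⟨w, r, hW, rfl⟩
    refine ⟨r k - r 0, ⟨w, r, hW.mono le_rfl (by omega), rfl⟩, r (k + 1) - r k,
      ⟨(w k, w (k + 1)), ?_⟩, by simp⟩
    simp only [hW k (Nat.zero_le _) (by omega), EReal.toReal_coe]

/-- A reduced funnel from `x` through `y` to `z` that has the largest gain. -/
structure BestFunnel (M : V → V → EReal) (x y z : V) where
  /-- the vertices -/
  w : ℕ → V
  /-- the levels -/
  r : ℕ → ℝ
  /-- the length -/
  k : ℕ
  pos : 0 < k
  walk : Walk M w r 0 k
  funnel : Funnel r 0 k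
  reduced : Reduced w r k
  start : w 0 = x
  next : w 1 = y
  last : w k = z
  best : ∀ (w' : ℕ → V) (r' : ℕ → ℝ) (k' : ℕ), 0 < k' → Walk M w' r' 0 k' → Funnel r' 0 k' →
    w' 0 = x → w' 1 = y → w' k' = z → r' k' - r' 0 ≤ r k - r 0

/-- Reduced funnels have bounded length, so the largest gain is attained, and by `exists_reduced` it
dominates all funnels with the same first arc and end. Such a representative depends on the table
but not on the sample. -/
lemma nonempty_bestFunnel {w : ℕ → V} {r : ℕ → ℝ} {k : ℕ} (hk : 0 < k) (hW : Walk M w r 0 k)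
    (hF : Funnel r 0 k) : Nonempty (BestFunnel M (w 0) (w 1) (w k)) := by
  set A : Set ℝ := {g | ∃ (k' : ℕ) (w' : ℕ → V) (r' : ℕ → ℝ), 0 < k' ∧ Walk M w' r' 0 k' ∧
      Funnel r' 0 k' ∧ Reduced w' r' k' ∧ w' 0 = w 0 ∧ w' 1 = w 1 ∧ w' k' = w k ∧
      r' k' - r' 0 = g} with hA
  have hfin : A.Finite := by
    refine (Set.Finite.biUnion (Set.finite_Iic (2 * Fintype.card V + 2))
      fun k _ => finite_walk_gains (M := M) k).subset ?_
    rintro g ⟨k', w', r', -, h2, h3, h4, -, -, -, h⟩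
    exact Set.mem_biUnion (Set.mem_Iic.2 (h4.length_le h3)) ⟨w', r', h2, h⟩
  have hne : A.Nonempty := by
    obtain ⟨k', w', r', h1, h2, h3, h4, h5, h6, h7, -⟩ := exists_reduced k w r hk hW hF
    exact ⟨_, k', w', r', h1, h2, h3, h4, h5, h6, h7, rfl⟩
  obtain ⟨g, hg, hmax⟩ := Set.exists_max_image A id hfin hne
  obtain ⟨k', w', r', h1, h2, h3, h4, h5, h6, h7, rfl⟩ := hg
  refine ⟨⟨w', r', k', h1, h2, h3, h4, h5, h6, h7, ?_⟩⟩
  intro w₁ r₁ k₁ g1 g2 g3 g4 g5 g6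
  obtain ⟨k'', w'', r'', f1, f2, f3, f4, f5, f6, f7, f8⟩ := exists_reduced k₁ w₁ r₁ g1 g2 g3
  exact f8.trans (hmax _ ⟨k'', w'', r'', f1, f2, f3, f4, f5.trans g4, f6.trans g5,
    f7.trans g6, rfl⟩)

/-- A window of `β` arcs contains at least `⌊β / 2⌋` negative arcs, which leave distinct vertices by
reducedness. There are at most `2 n + 2` windows. -/
lemma hitsFunnel_prob (p : ℝ) (hp : 0 ≤ p) (β : ℕ) {w : ℕ → V} {r : ℕ → ℝ} {k : ℕ}
    (hF : Funnel r 0 k) (hR : Reduced w r k) :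
    failProb (sample V p) (fun S => HitsFunnel β S w r k)
      ≤ (2 * Fintype.card V + 2 : ℕ) * ENNReal.ofReal (Real.exp (-(p * (β / 2 : ℕ)))) := by
  have h1 : failProb (sample V p) (fun S => HitsFunnel β S w r k)
      ≤ failProb (sample V p) (fun S => ∀ a ∈ Finset.Ico 1 (k + 1), a + β ≤ k →
        ∃ i, a ≤ i ∧ i < a + β ∧ r (i + 1) < r i ∧ w i ∈ S) := by
    refine failProb_mono _ fun S _ h a h1 h2 => h a ?_ h2
    rw [Finset.mem_Ico]; omega
  refine h1.trans ((failProb_forall_le _ _ _).trans ?_)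
  refine (Finset.sum_le_card_nsmul _ _ (ENNReal.ofReal (Real.exp (-(p * (β / 2 : ℕ)))))
    fun a ha => ?_).trans ?_
  · rw [Finset.mem_Ico] at ha
    by_cases hb : a + β ≤ k
    · set U : Finset V := ((Finset.Ico a (a + 2 * (β / 2))).filter
        fun i => r (i + 1) < r i).image w
      have hU : β / 2 ≤ U.card := by
        rw [Finset.card_image_of_injOn (hR.injOn ha.1 (by omega))]
        exact card_negative_ge hF a (β / 2) (by omega)
      refine le_trans (failProb_mono _ (P := fun S => ∃ v ∈ U, v ∈ S) ?_)
        ((sample_miss p U).trans (ENNReal.ofReal_le_ofReal (Real.exp_le_exp.2 ?_)))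
      · rintro S - ⟨v, hv, hvS⟩ -
        obtain ⟨i, hi, rfl⟩ := Finset.mem_image.1 hv
        rw [Finset.mem_filter, Finset.mem_Ico] at hi
        exact ⟨i, hi.1.1, by omega, hi.2, hvS⟩
      · have : ((β / 2 : ℕ) : ℝ) ≤ U.card := by exact_mod_cast hU
        have := mul_le_mul_of_nonneg_left this hp
        linarith
    · refine le_trans (failProb_mono _ (P := fun _ => True) fun S _ _ h => absurd h hb) ?_
      have : failProb (sample V p) (fun _ => True) = 0 := by
        unfold failProb
        simp only [failInd_of, expect_const]
      rw [this]
      exact zero_le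
  · rw [nsmul_eq_mul]
    refine mul_le_mul_left ?_ _
    rw [Nat.card_Ico]
    exact_mod_cast (show k + 1 - 1 ≤ _ by simpa using hR.length_le hF)

/-- A union bound over the `n ^ 3` triples: a single best funnel represents all funnels with the
same first arc and the same end. -/
lemma funnelComplete_prob (κ : HiddenConstants) (M : V → V → EReal) {p : ℝ} (hp : 0 ≤ p) :
    failProb (sample V p) (fun S => FunnelComplete M (funnelsOf κ M S).first)
      ≤ (Fintype.card V ^ 3 * (2 * Fintype.card V + 2) : ℕ) * ENNReal.ofReal
        (Real.exp (-(p * (⌈(Fintype.card V : ℝ) / funnelParam κ V⌉₊ / 2 : ℕ)))) := by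
  set β := ⌈(Fintype.card V : ℝ) / funnelParam κ V⌉₊ with hβ
  set E : V × V × V → Finset V → Prop := fun t S =>
    if h : Nonempty (BestFunnel M t.1 t.2.1 t.2.2) then HitsFunnel β S h.some.w h.some.r h.some.k
    else True with hE
  refine (failProb_mono _ (P := fun S => ∀ t ∈ Finset.univ, E t S) ?_).trans
    ((failProb_forall_le _ _ _).trans ((Finset.sum_le_card_nsmul _ _
      ((2 * Fintype.card V + 2 : ℕ) * ENNReal.ofReal (Real.exp (-(p * (β / 2 : ℕ)))))
      fun t _ => ?_).trans ?_))
  · intro S _ hS w r s t hst hW hF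
    have hW' : Walk M (fun i => w (s + i)) (fun i => r (s + i)) 0 (t - s) := fun i _ h =>
      hW (s + i) (by omega) (by omega)
    have hF' : Funnel (fun i => r (s + i)) 0 (t - s) := fun i _ h =>
      hF (s + i) (by omega) (by omega)
    have hn := nonempty_bestFunnel (by omega) hW' hF'
    simp only [Nat.add_zero, show s + (t - s) = t by omega] at hn
    have h := hS (w s, w (s + 1), w t) (Finset.mem_univ _)
    rw [hE] at h
    dsimp only at h
    rw [dif_pos hn] at h
    set b := hn.some
    have h1 := funnelsOf_complete κ b.pos b.walk b.funnel b.reduced h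
    rw [b.start, b.next, b.last] at h1
    refine le_trans ?_ h1
    have h2 := b.best _ _ (t - s) (by omega) hW' hF' rfl rfl (by simp [show s + (t - s) = t by omega])
    simp only [Nat.add_zero, show s + (t - s) = t by omega] at h2
    exact_mod_cast h2
  · rw [hE]
    by_cases h : Nonempty (BestFunnel M t.1 t.2.1 t.2.2)
    · simp only [dif_pos h]
      exact hitsFunnel_prob p hp β h.some.funnel h.some.reduced
    · simp only [dif_neg h]
      unfold failProb
      simp only [failInd_of, expect_const]
      exact zero_le
  · rw [nsmul_eq_mul, ← mul_assoc, Finset.card_univ]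
    refine mul_le_mul_left (le_of_eq ?_) _
    simp only [Fintype.card_prod]
    push_cast
    ring

/-- Both tables dominate the gains of all funnels. -/
def FunnelsComplete (M : V → V → EReal) (D : Tables V) : Prop :=
  FunnelComplete M D.first ∧ FunnelComplete (tr M) (fun u v x => D.last x v u)

lemma log_le_logn (h : 1 ≤ Fintype.card V) : Real.log (Fintype.card V) ≤ logn V := by
  unfold logn Real.logb
  have h1 : 0 ≤ Real.log (Fintype.card V) := Real.log_nonneg (by exact_mod_cast h)
  have h2 : Real.log 2 ≤ 1 := by have := Real.log_two_lt_d9; linarith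
  rw [le_div_iff₀ (Real.log_pos (by norm_num))]
  nlinarith

lemma exp_neg_mul_logn_le (h : 1 ≤ Fintype.card V) {a : ℝ} (ha : 0 ≤ a) :
    Real.exp (-(a * logn V)) ≤ (Fintype.card V : ℝ) ^ (-a) := by
  rw [Real.rpow_def_of_pos (by exact_mod_cast h)]
  refine Real.exp_le_exp.2 ?_
  have := mul_le_mul_of_nonneg_left (log_le_logn h) ha
  linarith

lemma one_le_logn (h : 2 ≤ Fintype.card V) : 1 ≤ logn V := by
  unfold logn
  rw [Real.le_logb_iff_rpow_le (by norm_num) (by exact_mod_cast (by omega : 0 < Fintype.card V))]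
  simpa using (by exact_mod_cast h : (2 : ℝ) ≤ Fintype.card V)

/-- The exponent collects `n ^ 3 (2 n + 2) ≤ n ^ 6` for one direction, a factor `2 ≤ n` for the two
directions, and `p ⌊β / 2⌋ ≥ p β / 3 ≥ (cSample / 3) log n`, which uses `2 ≤ β`. -/
lemma computeFunnels_prob (κ : HiddenConstants) (hκ : κ.cFunnel = 1) (M : V → V → EReal)
    (hn : 2 ≤ Fintype.card V) :
    failProb (computeFunnels κ M) (FunnelsComplete M)
      ≤ ENNReal.ofReal ((Fintype.card V : ℝ) ^ (7 - κ.cSample / 3)) := by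
  set n := Fintype.card V with hndef
  have hn0 : (0 : ℝ) < n := by exact_mod_cast (by omega : 0 < n)
  have hn2 : (2 : ℝ) ≤ n := by exact_mod_cast hn
  have hs : funnelParam κ V = (n : ℝ) ^ (2 / 3 : ℝ) := by
    unfold funnelParam
    rw [hκ, one_mul]
  have hs0 : 0 < funnelParam κ V := by rw [hs]; exact Real.rpow_pos_of_pos hn0 _
  set p := κ.cSample * logn V * funnelParam κ V / (n : ℝ) with hp
  have hlog := one_le_logn hn
  have hp0 : 0 ≤ p := by
    have := κ.cSample_pos
    positivity
  set β := ⌈(n : ℝ) / funnelParam κ V⌉₊ with hβ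
  have hβ1 : (n : ℝ) / funnelParam κ V ≤ β := Nat.le_ceil _
  have hβ2 : 2 ≤ β := by
    rw [hβ, Nat.succ_le_iff, Nat.lt_ceil, Nat.cast_one, lt_div_iff₀ hs0, one_mul, hs]
    calc (n : ℝ) ^ (2 / 3 : ℝ) < (n : ℝ) ^ (1 : ℝ) :=
          Real.rpow_lt_rpow_of_exponent_lt (by linarith) (by norm_num)
      _ = n := Real.rpow_one _
  have hexp : κ.cSample / 3 * logn V ≤ p * (β / 2 : ℕ) := by
    have h1 : (β : ℝ) / 3 ≤ (β / 2 : ℕ) := by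
      have : β ≤ 3 * (β / 2) := by omega
      have : (β : ℝ) ≤ 3 * (β / 2 : ℕ) := by exact_mod_cast this
      linarith
    have h2 : p * ((n : ℝ) / funnelParam κ V) = κ.cSample * logn V := by
      rw [hp]; field_simp
    calc κ.cSample / 3 * logn V = p * ((n : ℝ) / funnelParam κ V) / 3 := by rw [h2]; ring
      _ ≤ p * (β / 3) := by
          have := mul_le_mul_of_nonneg_left hβ1 hp0
          linarith
      _ ≤ _ := mul_le_mul_of_nonneg_left h1 hp0
  have hc := κ.cSample_pos
  have hone : ∀ N : V → V → EReal,
      failProb (sample V p) (fun S => FunnelComplete N (funnelsOf κ N S).first)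
        ≤ ENNReal.ofReal ((n : ℝ) ^ (6 - κ.cSample / 3)) := by
    intro N
    refine (funnelComplete_prob κ N hp0).trans ?_
    rw [← ENNReal.ofReal_natCast, ← ENNReal.ofReal_mul (by positivity)]
    refine ENNReal.ofReal_le_ofReal ?_
    have h1 : Real.exp (-(p * (β / 2 : ℕ))) ≤ (n : ℝ) ^ (-(κ.cSample / 3)) :=
      (Real.exp_le_exp.2 (by linarith)).trans
        (exp_neg_mul_logn_le (by omega) (by positivity))
    have h2 : ((n ^ 3 * (2 * n + 2) : ℕ) : ℝ) ≤ (n : ℝ) ^ (6 : ℝ) := by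
      rw [show (6 : ℝ) = ((6 : ℕ) : ℝ) by norm_num, Real.rpow_natCast]
      push_cast
      have : 2 * (n : ℝ) + 2 ≤ (n : ℝ) ^ 3 := by
        nlinarith [mul_nonneg hn0.le (sub_nonneg.2 (show (4 : ℝ) ≤ (n : ℝ) ^ 2 by nlinarith))]
      calc (n : ℝ) ^ 3 * (2 * n + 2) ≤ (n : ℝ) ^ 3 * (n : ℝ) ^ 3 := by gcongr
        _ = _ := by ring
    rw [sub_eq_add_neg, Real.rpow_add hn0]
    exact mul_le_mul h2 h1 (Real.exp_pos _).le (by positivity)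
  rw [computeFunnels_eq, failProb_bind]
  simp only [failProb_pure]
  refine (failProb_and_le (sample V p) (fun S => FunnelComplete M (funnelsOf κ M S).first)
    (fun S => FunnelComplete (tr M) (fun u v x => (funnelsOf κ M S).last x v u))).trans ?_
  have h3 := hone (tr M)
  simp only [funnelsOf_swap] at h3
  refine (add_le_add (hone M) h3).trans ?_
  rw [← ENNReal.ofReal_add (by positivity) (by positivity)]
  refine ENNReal.ofReal_le_ofReal ?_
  rw [show 7 - κ.cSample / 3 = 1 + (6 - κ.cSample / 3) by ring, Real.rpow_add hn0, Real.rpow_one]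
  have : 0 < (n : ℝ) ^ (6 - κ.cSample / 3) := Real.rpow_pos_of_pos hn0 _
  nlinarith

end FunnelProbability

/-! ### Level paths and short shortcuts -/

section Short

variable {V : Type u} {B : ℝ} {M N : V → V → EReal}

/-- A path of `m` arcs, with levels `q` between the levels `a` and `b` of its two ends that
underestimate the entries of the table. -/
structure LevelPath (M : V → V → EReal) (p : ℕ → V) (q : ℕ → ℝ) (a b : ℝ) (m : ℕ) : Prop where
  start : q 0 = a
  final : q m = b
  inj : ∀ i j, i < j → j ≤ m → p i ≠ p j
  arc : ∀ i, i < m → ((q (i + 1) - q i : ℝ) : EReal) ≤ M (p i) (p (i + 1))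
  low : ∀ i, i ≤ m → min a b ≤ q i
  high : ∀ i, i ≤ m → q i ≤ max a b

/-- There is a level path of `m` arcs from `x` to `z`. -/
def PathIn (M : V → V → EReal) (a b : ℝ) (x z : V) (m : ℕ) : Prop :=
  ∃ p q, LevelPath M p q a b m ∧ p 0 = x ∧ p m = z

lemma LevelPath.mono {p : ℕ → V} {q : ℕ → ℝ} {a b : ℝ} {m : ℕ} (h : LevelPath M p q a b m)
    (hMN : M ≤ N) : LevelPath N p q a b m :=
  { h with arc := fun i hi => (h.arc i hi).trans (hMN _ _) }

lemma PathIn.mono {a b : ℝ} {x z : V} {m : ℕ} (h : PathIn M a b x z m) (hMN : M ≤ N) :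
    PathIn N a b x z m := by
  obtain ⟨p, q, h, h0, hm⟩ := h
  exact ⟨p, q, h.mono hMN, h0, hm⟩

lemma LevelPath.diff_le {p : ℕ → V} {q : ℕ → ℝ} {a b : ℝ} {m : ℕ} (h : LevelPath M p q a b m)
    (hab : |a - b| ≤ B) {i j : ℕ} (hi : i ≤ m) (hj : j ≤ m) : -B ≤ q j - q i := by
  have h1 := h.low j hj
  have h2 := h.high i hi
  have h3 : max a b - min a b = |a - b| := by
    rw [max_sub_min_eq_abs']
  linarith

/-- `k` successive forward steps of the relation `R` lead from `i` to `j`. -/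
inductive Hops (R : ℕ → ℕ → Prop) : ℕ → ℕ → ℕ → Prop
  | refl (i : ℕ) : Hops R 0 i i
  | cons {k i j l : ℕ} : i < j → R i j → Hops R k j l → Hops R (k + 1) i l

lemma Hops.exists_map {R : ℕ → ℕ → Prop} {k i l : ℕ} (h : Hops R k i l) :
    ∃ σ : ℕ → ℕ, σ 0 = i ∧ σ k = l ∧ ∀ t < k, σ t < σ (t + 1) ∧ R (σ t) (σ (t + 1)) := by
  induction h with
  | refl i => exact ⟨fun _ => i, rfl, rfl, fun t h => absurd h (Nat.not_lt_zero t)⟩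
  | @cons k i j l hij hR _ ih =>
    obtain ⟨σ, h0, hk, hσ⟩ := ih
    refine ⟨fun t => if t = 0 then i else σ (t - 1), rfl, by simpa using hk, fun t ht => ?_⟩
    rcases Nat.eq_zero_or_pos t with rfl | h
    · simpa [h0] using ⟨hij, hR⟩
    · have := hσ (t - 1) (by omega)
      rw [Nat.sub_add_cancel h] at this
      simpa [h.ne'] using this

lemma LevelPath.of_hops {p : ℕ → V} {q : ℕ → ℝ} {a b : ℝ} {m k : ℕ} (h : LevelPath M p q a b m)
    (hk : Hops (fun i j => ((q j - q i : ℝ) : EReal) ≤ N (p i) (p j)) k 0 m) :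
    PathIn N a b (p 0) (p m) k := by
  obtain ⟨σ, h0, hk, hσ⟩ := hk.exists_map
  have hmono : ∀ i j, i < j → j ≤ k → σ i < σ j := by
    intro i j hij
    induction j, hij using Nat.le_induction with
    | base => intro h; exact (hσ i (by omega)).1
    | succ j hij ih => intro h; exact (ih (by omega)).trans (hσ j (by omega)).1
  have hle : ∀ i, i ≤ k → σ i ≤ m := by
    intro i hi
    rcases Nat.eq_or_lt_of_le hi with rfl | hi
    · exact hk.le
    · exact hk ▸ (hmono i k hi le_rfl).le
  refine ⟨p ∘ σ, q ∘ σ, ⟨?_, ?_, ?_, ?_, ?_, ?_⟩, ?_, ?_⟩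
  · simp [h0, h.start]
  · simp [hk, h.final]
  · intro i j hij hj
    exact h.inj _ _ (hmono i j hij hj) (hle j hj)
  · intro i hi
    exact (hσ i hi).2
  · intro i hi
    exact h.low _ (hle i hi)
  · intro i hi
    exact h.high _ (hle i hi)
  · simp [h0]
  · simp [hk]

/-- Two or three arcs from the position `i` on can be replaced by an entry of `N`. -/
def Contractible (N : V → V → EReal) (p : ℕ → V) (q : ℕ → ℝ) (m i : ℕ) : Prop :=
  (i + 2 ≤ m ∧ ((q (i + 2) - q i : ℝ) : EReal) ≤ N (p i) (p (i + 2))) ∨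
    (i + 3 ≤ m ∧ ((q (i + 3) - q i : ℝ) : EReal) ≤ N (p i) (p (i + 3)))

/-- The contractible positions. -/
def contractions (N : V → V → EReal) (p : ℕ → V) (q : ℕ → ℝ) (m : ℕ) : Finset ℕ :=
  (Finset.range m).filter (Contractible N p q m)

lemma card_filter_ge_le (X : Finset ℕ) (i c : ℕ) :
    (X.filter (i ≤ ·)).card ≤ c + (X.filter (i + c ≤ ·)).card := by
  have : X.filter (i ≤ ·) ⊆ Finset.Ico i (i + c) ∪ X.filter (i + c ≤ ·) := by
    intro n hn
    rw [Finset.mem_filter] at hn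
    rw [Finset.mem_union, Finset.mem_Ico, Finset.mem_filter]
    rcases Nat.lt_or_ge n (i + c) with h | h
    · exact Or.inl ⟨hn.2, h⟩
    · exact Or.inr ⟨hn.1, h⟩
  refine (Finset.card_le_card this).trans ((Finset.card_union_le _ _).trans ?_)
  rw [Nat.card_Ico]
  omega

/-- Contract greedily from left to right. Each contraction removes at least one arc and passes over
at most three contractible positions. -/
lemma exists_contracted_hops {p : ℕ → V} {q : ℕ → ℝ} {m : ℕ}
    (harc : ∀ i, i < m → ((q (i + 1) - q i : ℝ) : EReal) ≤ N (p i) (p (i + 1))) (n : ℕ) :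
    ∀ i, i + n = m → ∃ k, Hops (fun i j => ((q j - q i : ℝ) : EReal) ≤ N (p i) (p j)) k i m ∧
      3 * k + ((contractions N p q m).filter (i ≤ ·)).card ≤ 3 * n := by
  induction n using Nat.strong_induction_on with
  | _ n ih =>
    intro i hi
    rcases Nat.eq_zero_or_pos n with rfl | hn
    · obtain rfl : i = m := by omega
      refine ⟨0, Hops.refl i, ?_⟩
      have : (contractions N p q i).filter (i ≤ ·) = ∅ := by
        ext j
        simp only [contractions, Finset.mem_filter, Finset.mem_range, Finset.notMem_empty,
          iff_false]
        omega
      rw [this]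
      simp
    by_cases hc : Contractible N p q m i
    · rcases hc with ⟨h1, h2⟩ | ⟨h1, h2⟩
      · obtain ⟨k, hk, hc⟩ := ih (n - 2) (by omega) (i + 2) (by omega)
        refine ⟨k + 1, Hops.cons (by omega) h2 hk, ?_⟩
        have := card_filter_ge_le (contractions N p q m) i 2
        omega
      · obtain ⟨k, hk, hc⟩ := ih (n - 3) (by omega) (i + 3) (by omega)
        refine ⟨k + 1, Hops.cons (by omega) h2 hk, ?_⟩
        have := card_filter_ge_le (contractions N p q m) i 3
        omega
    · obtain ⟨k, hk, hc'⟩ := ih (n - 1) (by omega) (i + 1) (by omega)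
      refine ⟨k + 1, Hops.cons (by omega) (harc i (by omega)) hk, ?_⟩
      have : (contractions N p q m).filter (i ≤ ·) = (contractions N p q m).filter (i + 1 ≤ ·) := by
        refine Finset.filter_congr fun j hj => ?_
        have : j ≠ i := by
          rintro rfl
          exact hc (Finset.mem_filter.1 hj).2
        omega
      rw [this]
      omega

/-- Two consecutive gains of the same sign, or three alternating gains the middle one of which is
the smallest. -/
def Defect (r : ℕ → ℝ) (m i : ℕ) : Prop :=
  (i + 2 ≤ m ∧ 0 ≤ (r (i + 1) - r i) * (r (i + 2) - r (i + 1))) ∨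
    (i + 3 ≤ m ∧ (r (i + 1) - r i) * (r (i + 2) - r (i + 1)) < 0 ∧
      (r (i + 2) - r (i + 1)) * (r (i + 3) - r (i + 2)) < 0 ∧
      |r (i + 2) - r (i + 1)| ≤ |r (i + 1) - r i| ∧
      |r (i + 2) - r (i + 1)| ≤ |r (i + 3) - r (i + 2)|)

/-- Suppose the gains alternate throughout. The ends have extreme levels, so the second arc is not
longer than the first, and the last but one is not longer than the last. A shortest inner arc is
then the middle of a defect; with only two arcs, alternation itself contradicts the bounds. -/
lemma exists_defect {q : ℕ → ℝ} {m : ℕ} (hm : 2 ≤ m) (hlow : ∀ i, i ≤ m → min (q 0) (q m) ≤ q i)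
    (hhigh : ∀ i, i ≤ m → q i ≤ max (q 0) (q m)) : ∃ i, Defect q m i := by
  by_contra hcon
  push Not at hcon
  have halt : ∀ i, i + 2 ≤ m → (q (i + 1) - q i) * (q (i + 2) - q (i + 1)) < 0 := by
    intro i hi
    by_contra h
    exact hcon i (Or.inl ⟨hi, not_lt.1 h⟩)
  have hfirst : |q 2 - q 1| ≤ |q 1 - q 0| := by
    have h := halt 0 (by omega)
    simp only [Nat.zero_add] at h
    rcases le_total (q 0) (q m) with h' | h'
    · have l1 := hlow 1 (by omega)
      have l2 := hlow 2 (by omega)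
      rw [min_eq_left h'] at l1 l2
      rcases mul_neg_iff.1 h with h | h
      · rw [abs_of_neg h.2, abs_of_pos h.1]; linarith
      · linarith [h.1]
    · have l1 := hhigh 1 (by omega)
      have l2 := hhigh 2 (by omega)
      rw [max_eq_left h'] at l1 l2
      rcases mul_neg_iff.1 h with h | h
      · linarith [h.1]
      · rw [abs_of_neg h.1, abs_of_pos h.2]; linarith
  obtain ⟨c, rfl⟩ : ∃ c, m = c + 2 := ⟨m - 2, by omega⟩
  have hlast : |q (c + 1) - q c| ≤ |q (c + 2) - q (c + 1)| := by
    have h := halt c (by omega)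
    rcases le_total (q 0) (q (c + 2)) with h' | h'
    · have l1 := hhigh c (by omega)
      have l2 := hhigh (c + 1) (by omega)
      rw [max_eq_right h'] at l1 l2
      rcases mul_neg_iff.1 h with h | h
      · linarith [h.2]
      · rw [abs_of_neg h.1, abs_of_pos h.2]; linarith
    · have l1 := hlow c (by omega)
      have l2 := hlow (c + 1) (by omega)
      rw [min_eq_right h'] at l1 l2
      rcases mul_neg_iff.1 h with h | h
      · rw [abs_of_neg h.2, abs_of_pos h.1]; linarith
      · linarith [h.2]
  rcases Nat.eq_zero_or_pos c with rfl | hc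
  · have h := halt 0 (by omega)
    simp only [Nat.zero_add] at h hlow hhigh
    have l1 := hlow 1 (by omega)
    have l2 := hhigh 1 (by omega)
    rcases le_total (q 0) (q 2) with h' | h'
    · rw [min_eq_left h'] at l1
      rw [max_eq_right h'] at l2
      nlinarith
    · rw [min_eq_right h'] at l1
      rw [max_eq_left h'] at l2
      nlinarith
  · obtain ⟨i, hi, hmin⟩ := Finset.exists_min_image (Finset.Icc 1 c) (fun i => |q (i + 1) - q i|)
      ⟨1, Finset.mem_Icc.2 ⟨le_rfl, hc⟩⟩
    rw [Finset.mem_Icc] at hi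
    obtain ⟨j, rfl⟩ : ∃ j, i = j + 1 := ⟨i - 1, by omega⟩
    refine hcon j (Or.inr ⟨by omega, halt j (by omega), halt (j + 1) (by omega), ?_, ?_⟩)
    · rcases Nat.eq_zero_or_pos j with rfl | hj
      · exact hfirst
      · exact hmin j (Finset.mem_Icc.2 ⟨hj, by omega⟩)
    · rcases Nat.eq_or_lt_of_le hi.2 with h | h
      · subst h; exact hlast
      · exact hmin (j + 2) (Finset.mem_Icc.2 ⟨by omega, by omega⟩)

/-- The entries may differ in sign from their lower estimates. For nonpositive estimates this is
harmless, because truncating the entries at `0` keeps them above the estimates. -/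
lemma le_combine {x y z : V} {e₁ e₂ : ℝ} (h₁ : (e₁ : EReal) ≤ M x y)
    (h₂ : (e₂ : EReal) ≤ N y z) (hs : 0 ≤ e₁ * e₂) (hB : -B ≤ e₁ + e₂) :
    ((e₁ + e₂ : ℝ) : EReal) ≤ combine B M N x z := by
  refine le_trans ?_ (le_iSup (fun y => if 0 ≤ M x y ∧ 0 ≤ N y z then M x y + N y z
    else if -(B : EReal) ≤ min (M x y) 0 + min (N y z) 0 then min (M x y) 0 + min (N y z) 0
    else ⊥) y)
  rw [EReal.coe_add]
  split_ifs with h1 h2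
  · exact add_le_add h₁ h₂
  all_goals
    have hneg : e₁ ≤ 0 ∧ e₂ ≤ 0 := by
      rcases mul_nonneg_iff.1 hs with h | h
      · exact absurd ⟨(EReal.coe_nonneg.2 h.1).trans h₁, (EReal.coe_nonneg.2 h.2).trans h₂⟩ h1
      · exact h
    have hle : (e₁ : EReal) + e₂ ≤ min (M x y) 0 + min (N y z) 0 :=
      add_le_add (le_min h₁ (by exact_mod_cast hneg.1)) (le_min h₂ (by exact_mod_cast hneg.2))
  · exact hle
  · refine absurd (le_trans ?_ hle) h2
    rw [← EReal.coe_neg, ← EReal.coe_add]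
    exact_mod_cast hB

variable [Fintype V]

lemma le_shortShortcuts : M ≤ shortShortcuts B M := fun _ _ =>
  (le_max_left _ _).trans (le_max_left _ _)

lemma short_pair {x y z : V} {e₁ e₂ : ℝ} (h₁ : (e₁ : EReal) ≤ M x y)
    (h₂ : (e₂ : EReal) ≤ M y z) (hs : 0 ≤ e₁ * e₂) (hB : -B ≤ e₁ + e₂) :
    ((e₁ + e₂ : ℝ) : EReal) ≤ shortShortcuts B M x z :=
  (le_combine h₁ h₂ hs hB).trans
    (((le_max_left _ _).trans (le_max_right _ _)).trans (le_max_left _ _))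

lemma short_three {x y a z : V} {e₁ e₂ e₃ : ℝ} (h₁ : (e₁ : EReal) ≤ M x y)
    (h₂ : (e₂ : EReal) ≤ M y a) (h₃ : (e₃ : EReal) ≤ M a z) (hs : 0 ≤ e₂ * e₃)
    (hs' : 0 ≤ e₁ * (e₂ + e₃)) (hB' : -B ≤ e₂ + e₃) (hB : -B ≤ e₁ + (e₂ + e₃)) :
    ((e₁ + (e₂ + e₃) : ℝ) : EReal) ≤ shortShortcuts B M x z :=
  (le_combine h₁ (le_combine h₂ h₃ hs hB') hs' hB).trans
    (((le_max_right _ _).trans (le_max_right _ _)).trans (le_max_left _ _))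

/-- If the entries have the signs of their estimates, one of the hard candidates applies. Otherwise
some estimates can be raised to `0`, which leaves gains of one weak sign for `short_three`. -/
lemma short_triple {x y a z : V} {e₁ e₂ e₃ : ℝ} (h₁ : (e₁ : EReal) ≤ M x y)
    (h₂ : (e₂ : EReal) ≤ M y a) (h₃ : (e₃ : EReal) ≤ M a z) (hs : e₁ * e₂ < 0)
    (hs' : e₂ * e₃ < 0) (ha : |e₂| ≤ |e₁|) (ha' : |e₂| ≤ |e₃|) (hB : -B ≤ e₁ + e₂ + e₃)
    (hB0 : 0 ≤ B) :
    ((e₁ + e₂ + e₃ : ℝ) : EReal) ≤ shortShortcuts B M x z := by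
  have hhard : ∀ {e : EReal}, e ≤ hardShortcut B M x y z → e ≤ shortShortcuts B M x z := fun h =>
    (h.trans (le_iSup (fun y => hardShortcut B M x y z) y)).trans (le_max_right _ _)
  rcases mul_neg_iff.1 hs with ⟨p1, p2⟩ | ⟨p1, p2⟩
  · have p3 : 0 < e₃ := by
      rcases mul_neg_iff.1 hs' with h | h
      · linarith [h.1]
      · exact h.2
    rw [abs_of_neg p2, abs_of_pos p1] at ha
    rw [abs_of_neg p2, abs_of_pos p3] at ha'
    rcases le_total (M y a) 0 with h | h
    · refine hhard (le_trans ?_ (le_max_left _ _))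
      have hk : ((e₂ + e₃ : ℝ) : EReal) ≤ gainAbove M x y z := by
        refine le_trans ?_ (le_iSup (fun a => if -(M x y) ≤ M y a ∧ M y a ≤ 0 then M y a + M a z
          else ⊥) a)
        rw [if_pos, EReal.coe_add]
        · exact add_le_add h₂ h₃
        · refine ⟨le_trans (EReal.neg_le_neg_iff.2 h₁) (le_trans ?_ h₂), h⟩
          rw [← EReal.coe_neg]
          exact_mod_cast (by linarith : -e₁ ≤ e₂)
      rw [if_pos]
      · rw [add_assoc, EReal.coe_add]
        exact add_le_add h₁ hk
      · refine ⟨le_trans (by exact_mod_cast p1.le) h₁, le_add_of_nonneg_right (le_trans ?_ hk)⟩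
        exact_mod_cast (by linarith : 0 ≤ e₂ + e₃)
    · have := short_three (B := B) h₁ (e₂ := 0) (by exact_mod_cast h) h₃ (by simp)
        (by rw [zero_add]; positivity) (by linarith) (by linarith)
      refine le_trans ?_ this
      exact_mod_cast (by linarith : e₁ + e₂ + e₃ ≤ e₁ + (0 + e₃))
  · have p3 : e₃ < 0 := by
      rcases mul_neg_iff.1 hs' with h | h
      · exact h.2
      · linarith [h.1]
    rw [abs_of_neg p1, abs_of_pos p2] at ha
    rw [abs_of_neg p3, abs_of_pos p2] at ha'
    rcases le_total 0 (M x y) with h | h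
    -- The first entry is in fact nonnegative; estimating the first two gains by `0` leaves a weakly
    -- descending triple.
    · have := short_three (B := B) (e₁ := 0) (by exact_mod_cast h) (e₂ := 0)
        (le_trans (by exact_mod_cast p2.le) h₂) h₃ (by simp)
        (by simp) (by linarith) (by linarith)
      refine le_trans ?_ this
      exact_mod_cast (by linarith : e₁ + e₂ + e₃ ≤ 0 + (0 + e₃))
    · obtain ⟨m, hm, hem⟩ := exists_real_of_le (fun h' => by rw [h'] at h; simp at h) h₁
      rw [hm] at h
      norm_cast at h
      have hle : ((m : ℝ) : EReal) ≤ 0 := by exact_mod_cast h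
      rcases le_total (M y a) (eabs (M x y)) with h' | h'
      · have hk : ((e₂ + e₃ : ℝ) : EReal) ≤ gainBelow M x y z := by
          refine le_trans ?_ (le_iSup (fun a => if 0 ≤ M y a ∧ M y a ≤ eabs (M x y)
            then M y a + M a z else ⊥) a)
          rw [if_pos ⟨le_trans (by exact_mod_cast p2.le) h₂, h'⟩, EReal.coe_add]
          exact add_le_add h₂ h₃
        have hsum : ((e₁ + e₂ + e₃ : ℝ) : EReal) ≤ M x y + gainBelow M x y z := by
          rw [add_assoc, EReal.coe_add]
          exact add_le_add h₁ hk
        have hsB : -(B : EReal) ≤ M x y + gainBelow M x y z := by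
          refine le_trans ?_ hsum
          rw [← EReal.coe_neg]
          exact_mod_cast hB
        rcases le_total (M x y + gainBelow M x y z) (M x y) with h2 | h2
        · refine hhard (le_trans ?_ ((le_max_left _ _).trans (le_max_right _ _)))
          rw [if_pos ⟨by rw [hm]; exact hle, h2, hsB⟩]
          exact hsum
        · refine hhard (le_trans ?_ (((le_max_left _ _).trans (le_max_right _ _)).trans
            (le_max_right _ _)))
          rw [if_pos ⟨by rw [hm]; exact hle, h2⟩, hm]
          exact_mod_cast (by linarith : e₁ + e₂ + e₃ ≤ m)
      · refine hhard (le_trans ?_ (((le_max_right _ _).trans (le_max_right _ _)).trans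
            (le_max_right _ _)))
        rw [if_pos (by rw [hm]; exact hle)]
        refine le_min ?_ ?_
        · rw [hm]
          exact_mod_cast (by linarith : e₁ + e₂ + e₃ ≤ m)
        · refine le_trans ?_ (le_iSup (fun a => if eabs (M x y) ≤ M y a then M a z else ⊥) a)
          rw [if_pos h']
          refine le_trans ?_ h₃
          exact_mod_cast (by linarith : e₁ + e₂ + e₃ ≤ e₃)

/-- Defects are read off the exact levels `r`, while contractions are needed for the estimates `q`.
The increments of `q` are smaller, and its spread of at most `B` guarantees the lower bound required
of a shortcut. -/
lemma contractible_of_defect {p : ℕ → V} {q r : ℕ → ℝ} {m i : ℕ} (hB : 0 ≤ B)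
    (harc : ∀ i, i < m → ((r (i + 1) - r i : ℝ) : EReal) ≤ M (p i) (p (i + 1)))
    (hqr : ∀ i, i < m → q (i + 1) - q i ≤ r (i + 1) - r i)
    (hqB : ∀ i j, i ≤ m → j ≤ m → -B ≤ q j - q i) (h : Defect r m i) :
    Contractible (shortShortcuts B M) p q m i := by
  rcases h with ⟨h1, h2⟩ | ⟨h1, h2, h3, h4, h5⟩
  · left
    have q1 := hqr i (by omega)
    have q2 := hqr (i + 1) (by omega)
    have q3 := hqB i (i + 2) (by omega) h1
    refine ⟨h1, le_trans ?_ (short_pair (harc i (by omega)) (harc (i + 1) (by omega)) h2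
      (by linarith))⟩
    exact_mod_cast (by linarith : q (i + 2) - q i ≤ r (i + 1) - r i + (r (i + 2) - r (i + 1)))
  · right
    have q1 := hqr i (by omega)
    have q2 := hqr (i + 1) (by omega)
    have q3 := hqr (i + 2) (by omega)
    have q4 := hqB i (i + 3) (by omega) h1
    refine ⟨h1, le_trans ?_ (short_triple (harc i (by omega)) (harc (i + 1) (by omega))
      (harc (i + 2) (by omega)) h2 h3 h4 h5 (by linarith) hB)⟩
    exact_mod_cast (by linarith : q (i + 3) - q i ≤
      r (i + 1) - r i + (r (i + 2) - r (i + 1)) + (r (i + 3) - r (i + 2)))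

/-- A round of short shortcuts contracts a level path. -/
lemma LevelPath.short {p : ℕ → V} {q : ℕ → ℝ} {a b : ℝ} {m : ℕ} (h : LevelPath M p q a b m) :
    ∃ k, PathIn (shortShortcuts B M) a b (p 0) (p m) k ∧
      3 * k + (contractions (shortShortcuts B M) p q m).card ≤ 3 * m := by
  obtain ⟨k, hk, hc⟩ := exists_contracted_hops (h.mono (le_shortShortcuts (B := B))).arc m 0
    (Nat.zero_add m)
  refine ⟨k, h.of_hops hk, ?_⟩
  simpa using hc

lemma LevelPath.contractions_pos {p : ℕ → V} {q : ℕ → ℝ} {a b : ℝ} {m : ℕ}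
    (h : LevelPath M p q a b m) (hm : 2 ≤ m) (hab : |a - b| ≤ B) :
    0 < (contractions (shortShortcuts B M) p q m).card := by
  obtain ⟨i, hi⟩ := exists_defect (q := q) hm (by rw [h.start, h.final]; exact h.low)
    (by rw [h.start, h.final]; exact h.high)
  refine Finset.card_pos.2 ⟨i, Finset.mem_filter.2 ⟨?_, contractible_of_defect
    ((abs_nonneg _).trans hab) h.arc (fun _ _ => le_rfl)
    (fun i j hi hj => h.diff_le hab hi hj) hi⟩⟩
  rw [Finset.mem_range]
  rcases hi with hi | hi <;> omega

end Short

/-! ### Long shortcuts along excursions -/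

section Rounds

variable {V : Type u} [Fintype V] {B : ℝ} {ρ : ChargeRel V B} {M : V → V → EReal}

/-- The assignment of `0` is not a maximum. It cannot decrease the entry, since sound entries with
`M u v < 0` are nonpositive. -/
lemma first_le_concatenateOppositeFirst (hM : SoundTable ρ M) {D₀ D : Tables V}
    (h₀ : SoundTables ρ M D₀) (h : SoundTables ρ M D) (u v w x a b c : V) :
    D.first a b c ≤ (concatenateOppositeFirst M D₀ D u v w x).first a b c := by
  unfold concatenateOppositeFirst
  split_ifs with huv
  · dsimp only
    have h1 : D.first a b c ≤ (D.setFirst u v x (max (D.first u v x)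
      (D.first u v w + ⨆ a, if 0 ≤ M a x ∧ M a x - D₀.last w a x ≤ D.first u v w - M u v ∧
        D₀.last w a x ≤ eabs (D.first u v w) then D₀.last w a x else ⊥))).first a b c := by
      dsimp only [Tables.setFirst]
      split_ifs with h'
      · obtain ⟨rfl, rfl, rfl⟩ := h'
        exact le_max_left _ _
      · exact le_rfl
    split_ifs with hz
    · have hs := soundFirst_concatenateOpposite hM h₀.last h.first u v w x huv
      refine h1.trans ?_
      conv_rhs => rw [Tables.setFirst]
      dsimp only
      split_ifs with h'
      · obtain ⟨rfl, rfl, rfl⟩ := h'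
        rcases (hs a b c).cases with hb | ⟨d, hd, m, hm, -⟩
        · refine le_trans (le_of_eq hb) bot_le
        · refine le_trans (le_of_eq hd) ?_
          rw [hm] at huv
          norm_cast at huv
          exact_mod_cast hs.nonpos hm hd huv.le (hM.ge hm)
      · exact le_rfl
    · exact h1
  · exact le_rfl

lemma concatenateOppositeLast_first (D₀ D : Tables V) (u v w x : V) :
    (concatenateOppositeLast M D₀ D u v w x).first = D.first := by
  unfold concatenateOppositeLast
  dsimp only
  split_ifs <;> rfl

lemma first_le_concatenateOpposite (hB : 0 ≤ B) (hM : SoundTable ρ M) {D : Tables V}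
    (h : SoundTables ρ M D) (U W X : Finset V) :
    D.first ≤ (concatenateOpposite M U W X D).first :=
  (foldl_invariant (I := fun D' : Tables V => SoundTables ρ M D' ∧ D.first ≤ D'.first)
    (fun D' q h' => ⟨.concatenateOppositeLast hB hM h
      (.concatenateOppositeFirst hM h h'.1 _ _ _ _) q.1 q.2.1 q.2.2.1 q.2.2.2, by
        rw [concatenateOppositeLast_first]
        exact h'.2.trans fun a b c => first_le_concatenateOppositeFirst hM h h'.1 _ _ _ _ a b c⟩)
    _ _ ⟨h, le_rfl⟩).2

lemma first_le_longRound (hB : 0 ≤ B) (hM : SoundTable ρ M) {D : Tables V}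
    (h : SoundTables ρ M D) (T : Finset V) : D.first ≤ (longRound M T D).first :=
  (first_le_concatenateOpposite hB hM h T Finset.univ Finset.univ).trans
    fun a b c => first_le_concatenate _ _ _ _ a b c

lemma FunnelComplete.mono {F F' : V → V → V → EReal} (h : FunnelComplete M F) (hF : F ≤ F') :
    FunnelComplete M F' := fun w r s t hst hW hR => (h w r s t hst hW hR).trans (hF _ _ _)

lemma FunnelsComplete.swap {D : Tables V} (h : FunnelsComplete M D) :
    FunnelsComplete (tr M) D.swap := ⟨h.2, h.1⟩

lemma FunnelsComplete.longRound (hB : 0 ≤ B) (hM : SoundTable ρ M) {D : Tables V}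
    (h : SoundTables ρ M D) (hF : FunnelsComplete M D) (T : Finset V) :
    FunnelsComplete M (longRound M T D) := by
  refine ⟨hF.1.mono (first_le_longRound hB hM h T), hF.2.mono ?_⟩
  have := first_le_longRound hB (hM.transpose hB) h.swap T
  rw [longRound_swap] at this
  exact this

/-- Either the second rule fires and yields `0 ≥ d₁ + d₂`, or its failure supplies the missing
condition `D.last w a x ≤ |D.first u v w|` of the first rule. The hypothesis `w ≠ x` ensures that
the first rule does not change the entry tested by the second. -/
lemma le_concatenateOpposite (hB : 0 ≤ B) (hM : SoundTable ρ M) {D : Tables V}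
    (h : SoundTables ρ M D) {U W X : Finset V} {u v w a x : V} (hu : u ∈ U) (hw : w ∈ W)
    (hx : x ∈ X) (hwx : w ≠ x) {m m' d₁ d₂ : ℝ} (hm : M u v = m) (hm0 : m < 0)
    (hm' : M a x = m') (h0 : 0 ≤ m') (hmm : m' ≤ -m) (hwin : m' - d₂ ≤ d₁ - m)
    (h12 : d₁ + d₂ ≤ 0) (h₁ : (d₁ : EReal) ≤ D.first u v w) (h₂ : (d₂ : EReal) ≤ D.last w a x) :
    ((d₁ + d₂ : ℝ) : EReal) ≤ (concatenateOpposite M U W X D).first u v x := by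
  have hIfirst : ∀ D', SoundTables ρ M D' → ∀ q : V × V × V × V, SoundTables ρ M
      (concatenateOppositeLast M D (concatenateOppositeFirst M D D' q.1 q.2.1 q.2.2.1 q.2.2.2)
        q.1 q.2.1 q.2.2.1 q.2.2.2) := fun D' h' q =>
    .concatenateOppositeLast hB hM h (.concatenateOppositeFirst hM h h' _ _ _ _) _ _ _ _
  refine foldl_reaches
    (I := fun D' : Tables V => SoundTables ρ M D' ∧ (d₁ : EReal) ≤ D'.first u v w)
    (G := fun D' : Tables V => ((d₁ + d₂ : ℝ) : EReal) ≤ D'.first u v x) ?_ ?_ ?_ _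
    (mem_quadruples hu (Finset.mem_univ v) hw hx) _ ⟨h, h₁⟩
  · intro D' q h'
    refine ⟨hIfirst D' h'.1 q, ?_⟩
    rw [concatenateOppositeLast_first]
    exact h'.2.trans (first_le_concatenateOppositeFirst hM h h'.1 _ _ _ _ _ _ _)
  · intro D' q h' hG
    rw [concatenateOppositeLast_first]
    exact hG.trans (first_le_concatenateOppositeFirst hM h h'.1 _ _ _ _ _ _ _)
  · rintro D' ⟨hs, h'⟩
    rw [concatenateOppositeLast_first]
    dsimp only
    unfold concatenateOppositeFirst
    rw [if_pos (by rw [hm]; exact_mod_cast hm0)]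
    dsimp only
    split_ifs with hz
    · dsimp only [Tables.setFirst]
      rw [if_pos ⟨rfl, rfl, rfl⟩]
      exact_mod_cast h12
    · have hw' : (D'.setFirst u v x (max (D'.first u v x)
        (D'.first u v w + ⨆ a, if 0 ≤ M a x ∧ M a x - D.last w a x ≤ D'.first u v w - M u v ∧
        D.last w a x ≤ eabs (D'.first u v w) then D.last w a x else ⊥))).first u v w
          = D'.first u v w := by
        dsimp only [Tables.setFirst]
        rw [if_neg fun h => hwx h.2.2]
      rw [hw'] at hz
      have hlt : D.last w a x < eabs (D'.first u v w) := by
        by_contra hcon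
        refine hz ⟨a, by rw [hm']; exact_mod_cast h0, not_lt.1 hcon, ?_⟩
        rw [hm', hm, eabs_coe, abs_of_neg hm0]
        exact_mod_cast hmm
      dsimp only [Tables.setFirst]
      rw [if_pos ⟨rfl, rfl, rfl⟩, EReal.coe_add]
      refine le_trans (add_le_add h' ?_) (le_max_right _ _)
      refine le_trans h₂ (le_trans ?_ (le_iSup (fun a => if 0 ≤ M a x ∧
        M a x - D.last w a x ≤ D'.first u v w - M u v ∧
        D.last w a x ≤ eabs (D'.first u v w) then D.last w a x else ⊥) a))
      rw [if_pos]
      refine ⟨by rw [hm']; exact_mod_cast h0, ?_, hlt.le⟩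
      rw [hm, hm']
      calc (m' : EReal) - D.last w a x ≤ (m' : EReal) - d₂ := EReal.sub_le_sub le_rfl h₂
        _ ≤ (d₁ : EReal) - m := by exact_mod_cast hwin
        _ ≤ _ := EReal.sub_le_sub h' le_rfl

lemma Walk.reverse {p : ℕ → V} {r : ℕ → ℝ} {s m : ℕ} (hW : Walk M p r s m) :
    Walk (tr M) (fun i => p (m - i)) (fun i => -r (m - i)) 0 (m - s) := by
  intro i _ hi
  have := hW (m - (i + 1)) (by omega) (by omega)
  rw [show m - (i + 1) + 1 = m - i by omega] at this
  simp only [tr]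
  rw [this]
  congr 1
  ring

/-- Read backwards, an alternating walk with growing gains is a funnel of the reversed graph. -/
lemma FunnelsComplete.le_last {D : Tables V} (hF : FunnelsComplete M D) {p : ℕ → V} {r : ℕ → ℝ}
    {s m : ℕ} (hsm : s < m) (hW : Walk M p r s m)
    (hR : ∀ i, s ≤ i → i + 1 < m → (r (i + 1) - r i) * (r (i + 2) - r (i + 1)) < 0 ∧
      |r (i + 1) - r i| ≤ |r (i + 2) - r (i + 1)|) :
    ((r m - r s : ℝ) : EReal) ≤ D.last (p s) (p (m - 1)) (p m) := by
  have := hF.2 _ _ 0 (m - s) (by omega) hW.reverse (by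
    intro i _ hi
    have h := hR (m - (i + 2)) (by omega) (by omega)
    rw [show m - (i + 2) + 1 = m - (i + 1) by omega, show m - (i + 2) + 2 = m - i by omega] at h
    dsimp only
    constructor
    · linarith [h.1]
    · rw [show -r (m - (i + 2)) - -r (m - (i + 1)) = r (m - (i + 1)) - r (m - (i + 2)) by ring,
        show -r (m - (i + 1)) - -r (m - i) = r (m - i) - r (m - (i + 1)) by ring]
      exact h.2)
  simp only [Nat.sub_zero, Nat.zero_add, Nat.sub_sub_self hsm.le] at this
  refine le_trans (le_of_eq ?_) this
  congr 1
  ring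

/-- Without defects the gains alternate and their sizes have no inner local minimum, so the sizes
first grow and then shrink. The growing part ends upwards and the shrinking part starts downwards,
the forms that Concatenate-Opposite and Concatenate can append. -/
lemma exists_peak {r : ℕ → ℝ} {s e : ℕ} (hse : s < e) (h : ∀ i, s ≤ i → ¬ Defect r e i) :
    ∃ k, s ≤ k ∧ k ≤ e ∧ (k < e → r (k + 1) - r k ≤ 0) ∧ (s < k → 0 ≤ r k - r (k - 1)) ∧
      (∀ i, s ≤ i → i + 1 < k → (r (i + 1) - r i) * (r (i + 2) - r (i + 1)) < 0 ∧
        |r (i + 1) - r i| ≤ |r (i + 2) - r (i + 1)|) ∧ Funnel r k e := by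
  have halt : ∀ i, s ≤ i → i + 2 ≤ e → (r (i + 1) - r i) * (r (i + 2) - r (i + 1)) < 0 := by
    intro i h1 h2
    by_contra hcon
    exact h i h1 (Or.inl ⟨h2, not_lt.1 hcon⟩)
  obtain ⟨k, hk, hmax⟩ := Finset.exists_max_image (Finset.Ico s e) (fun i => |r (i + 1) - r i|)
    ⟨s, Finset.mem_Ico.2 ⟨le_rfl, hse⟩⟩
  rw [Finset.mem_Ico] at hk
  have hup : ∀ i, k ≤ i → i + 2 ≤ e → |r (i + 2) - r (i + 1)| ≤ |r (i + 1) - r i| := by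
    intro i hi
    induction i, hi using Nat.le_induction with
    | base => exact fun h2 => hmax (k + 1) (Finset.mem_Ico.2 ⟨by omega, by omega⟩)
    | succ i hi ih =>
      intro h2
      by_contra hcon
      exact h i (by omega) (Or.inr ⟨by omega, halt i (by omega) (by omega),
        halt (i + 1) (by omega) (by omega), ih (by omega), (not_le.1 hcon).le⟩)
  have hdown : ∀ n i, i + n + 1 = k → s ≤ i → |r (i + 1) - r i| ≤ |r (i + 2) - r (i + 1)| := by
    intro n
    induction n with
    | zero =>
      intro i hi hs
      have := hmax i (Finset.mem_Ico.2 ⟨by omega, by omega⟩)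
      rwa [← hi] at this
    | succ n ih =>
      intro i hi hs
      by_contra hcon
      exact h i (by omega) (Or.inr ⟨by omega, halt i (by omega) (by omega),
        halt (i + 1) (by omega) (by omega), (not_le.1 hcon).le,
        ih (i + 1) (by omega) (by omega)⟩)
  have hk0 : k + 2 ≤ e ∨ s < k ∨ (k = s ∧ k + 1 = e) := by omega
  -- The longest arc is assigned by its sign: a negative one starts the funnel, a positive one ends
  -- the growing part.
  rcases lt_or_ge (r (k + 1) - r k) 0 with hneg | hpos
  · refine ⟨k, hk.1, hk.2.le, fun _ => hneg.le, fun hs => ?_, fun i h1 h2 => ?_, fun i h1 h2 => ?_⟩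
    · have := halt (k - 1) (by omega) (by omega)
      rw [show k - 1 + 2 = k + 1 by omega, show k - 1 + 1 = k by omega] at this
      nlinarith
    · exact ⟨halt i h1 (by omega), hdown (k - i - 1) i (by omega) h1⟩
    · exact ⟨halt i (by omega) (by omega), hup i h1 (by omega)⟩
  · by_cases h0 : r (k + 1) - r k = 0
    · rcases hk0 with h1 | h1 | h1
      · have := halt k hk.1 h1
        rw [h0] at this; simp at this
      · have := halt (k - 1) (by omega) (by omega)
        rw [show k - 1 + 2 = k + 1 by omega, show k - 1 + 1 = k by omega, h0] at this
        simp at this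
      · exact ⟨k, hk.1, hk.2.le, fun _ => h0.le, by omega, by omega, fun i h1 h2 => by omega⟩
    have hpos : 0 < r (k + 1) - r k := lt_of_le_of_ne hpos (Ne.symm h0)
    refine ⟨k + 1, by omega, hk.2, fun hs => ?_, fun _ => by simpa using hpos.le,
      fun i h1 h2 => ?_, fun i h1 h2 => ?_⟩
    · have := halt k hk.1 hs
      nlinarith
    · exact ⟨halt i h1 (by omega), hdown (k - i - 1) i (by omega) h1⟩
    · exact ⟨halt i (by omega) (by omega), hup i (by omega) (by omega)⟩

/-- From `j` on, the levels stay between those of the positions `j` and `j + 1` until they leave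
this range with the arc that ends in `t`, or until the end `l`. -/
structure Excursion (r : ℕ → ℝ) (l j t : ℕ) : Prop where
  neg : r (j + 1) < r j
  lt : j + 2 ≤ t
  le : t ≤ l
  low : ∀ i, j + 1 ≤ i → i < t → r (j + 1) ≤ r i
  high : ∀ i, j + 1 ≤ i → i < t → r i < r j
  exit : r j ≤ r t ∨ r t ≤ r (j + 1) ∨ t = l

/-- The positions of defects. -/
def defects (r : ℕ → ℝ) (l : ℕ) : Finset ℕ := (Finset.range l).filter (Defect r l)

lemma mem_defects {r : ℕ → ℝ} {l i : ℕ} : i ∈ defects r l ↔ Defect r l i := by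
  unfold defects
  rw [Finset.mem_filter, Finset.mem_range, and_iff_right_iff_imp]
  rintro (h | h) <;> omega

lemma Defect.mono {r : ℕ → ℝ} {l l' i : ℕ} (h : Defect r l i) (hl : l ≤ l') : Defect r l' i := by
  rcases h with h | h
  · exact Or.inl ⟨h.1.trans hl, h.2⟩
  · exact Or.inr ⟨h.1.trans hl, h.2⟩

/-- One round crosses a defect-free stretch of an excursion: Concatenate-Opposite goes from `s` to
the peak `k`, and Concatenate from `k` to `e`. All side conditions say that levels stay between `r
(j + 1)` and `r j`, which holds before the exit `t`. -/
lemma longRound_advance (hB : 0 ≤ B) (hM : SoundTable ρ M) {D : Tables V}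
    (h : SoundTables ρ M D) (hF : FunnelsComplete M D) {T : Finset V} {p : ℕ → V} {r : ℕ → ℝ}
    {l j t s e : ℕ} (hW : Walk M p r 0 l) (hinj : ∀ i j, i < j → j ≤ l → p i ≠ p j)
    (hE : Excursion r l j t) (hT : p j ∈ T) (hs : j + 1 ≤ s) (hse : s ≤ e) (he : e < t)
    (hdef : ∀ i, s ≤ i → ¬ Defect r e i)
    (h₁ : ((r s - r j : ℝ) : EReal) ≤ D.first (p j) (p (j + 1)) (p s)) :
    ((r e - r j : ℝ) : EReal) ≤ (longRound M T D).first (p j) (p (j + 1)) (p e) := by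
  have htl := hE.le
  rcases Nat.eq_or_lt_of_le hse with rfl | hse
  · exact h₁.trans (first_le_longRound hB hM h T _ _ _)
  obtain ⟨k, hsk, hke, hneg, hpos, hup, hdown⟩ := exists_peak hse hdef
  have hm := hW j (Nat.zero_le _) (by have := hE.lt; omega)
  have hmono := first_le_concatenateOpposite hB hM h T Finset.univ Finset.univ
  have hmid : ((r k - r j : ℝ) : EReal) ≤
      (concatenateOpposite M T Finset.univ Finset.univ D).first (p j) (p (j + 1)) (p k) := by
    rcases Nat.eq_or_lt_of_le hsk with rfl | hsk
    · exact h₁.trans (hmono _ _ _)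
    · have hl := hF.le_last hsk (hW.mono (Nat.zero_le _) (by omega)) hup
      have hm' := hW (k - 1) (Nat.zero_le _) (by omega)
      rw [Nat.sub_add_cancel (by omega)] at hm'
      have e1 := hE.low (k - 1) (by omega) (by omega)
      have e2 := hE.high k (by omega) (by omega)
      have e3 := hE.high s (by omega) (by omega)
      have := le_concatenateOpposite hB hM h hT (Finset.mem_univ _) (Finset.mem_univ _)
        (hinj s k hsk (by omega)) hm (by linarith [hE.neg]) hm' (hpos hsk) (by linarith)
        (by linarith) (by linarith) h₁ hl
      refine le_trans (le_of_eq ?_) this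
      congr 1
      ring
  rcases Nat.eq_or_lt_of_le hke with rfl | hke
  · exact hmid.trans (first_le_concatenate _ _ _ _ _ _ _)
  · have hf := (hF.1 p r k e hke (hW.mono (Nat.zero_le _) (by omega)) hdown).trans
      (hmono _ _ _)
    have e1 := hE.low (k + 1) (by omega) (by omega)
    have := le_concatenate (U := T) (W := Finset.univ) (X := Finset.univ) hT (Finset.mem_univ _)
      (Finset.mem_univ _) hm (by linarith [hE.neg]) (hW k (Nat.zero_le _) (by omega)) (hneg hke)
      (by linarith) hmid hf
    refine le_trans (le_of_eq ?_) this
    congr 1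
    ring

/-- `f` is one less than the first end position at which a defect is complete. Such a defect starts
before `f`, so it is not counted again from `f` on. -/
lemma exists_defect_free {r : ℕ → ℝ} {s e : ℕ} (hse : s ≤ e) :
    ∃ f, s ≤ f ∧ f ≤ e ∧ (∀ i, s ≤ i → ¬ Defect r f i) ∧
      (f < e → ∃ i, s ≤ i ∧ i < f ∧ Defect r e i) := by
  by_cases h : ∃ i, s ≤ i ∧ Defect r e i
  · have hex : ∃ f, ∃ i, s ≤ i ∧ Defect r f i := ⟨e, h⟩
    obtain ⟨i, hi, hd⟩ := Nat.find_spec hex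
    have hle : Nat.find hex ≤ e := Nat.find_min' hex h
    have : i + 2 ≤ Nat.find hex := by rcases hd with h | h <;> omega
    exact ⟨Nat.find hex - 1, by omega, by omega, fun i' hi' hd' =>
      Nat.find_min hex (m := Nat.find hex - 1) (by omega) ⟨i', hi', hd'⟩,
      fun _ => ⟨i, hi, by omega, hd.mono hle⟩⟩
  · push Not at h
    exact ⟨e, hse, le_rfl, h, fun h => absurd h (lt_irrefl _)⟩

/-- Each round that falls short of `e` leaves at least one defect behind, so one round more than the
number of defects suffices. -/
lemma longRound_iterate_advance (hB : 0 ≤ B) (hM : SoundTable ρ M) {T : Finset V}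
    {p : ℕ → V} {r : ℕ → ℝ} {l j t e : ℕ} (hW : Walk M p r 0 l)
    (hinj : ∀ i j, i < j → j ≤ l → p i ≠ p j)
    (hE : Excursion r l j t) (hT : p j ∈ T) (he : e < t) (k : ℕ) : ∀ {D : Tables V} {s : ℕ},
    SoundTables ρ M D → FunnelsComplete M D → j + 1 ≤ s → s ≤ e →
    ((defects r e).filter (s ≤ ·)).card + 1 ≤ k →
    ((r s - r j : ℝ) : EReal) ≤ D.first (p j) (p (j + 1)) (p s) →
    ((r e - r j : ℝ) : EReal) ≤ ((longRound M T)^[k] D).first (p j) (p (j + 1)) (p e) := by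
  induction k with
  | zero => intro D s _ _ _ _ h; omega
  | succ k ih =>
    intro D s h hF hs hse hk h₁
    rw [Function.iterate_succ_apply]
    obtain ⟨f, hsf, hfe, hfree, hd⟩ := exists_defect_free (r := r) hse
    have hadv := longRound_advance hB hM h hF hW hinj hE hT hs hsf (by omega) hfree h₁
    rcases Nat.eq_or_lt_of_le hfe with rfl | hfe
    · exact hadv.trans ((iterate_invariant (f := longRound M T)
        (I := fun D' => SoundTables ρ M D' ∧ (longRound M T D).first ≤ D'.first)
        (fun D' h' => ⟨h'.1.longRound hB hM T, h'.2.trans (first_le_longRound hB hM h'.1 T)⟩) k _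
        ⟨h.longRound hB hM T, le_rfl⟩).2 _ _ _)
    · obtain ⟨i, hi, hif, hdi⟩ := hd hfe
      refine ih (h.longRound hB hM T) (hF.longRound hB hM h T) (by omega) hfe.le ?_ hadv
      have : (defects r e).filter (f ≤ ·) ⊂ (defects r e).filter (s ≤ ·) := by
        rw [Finset.ssubset_iff_of_subset]
        · refine ⟨i, Finset.mem_filter.2 ⟨mem_defects.2 hdi, hi⟩, ?_⟩
          rw [Finset.mem_filter]
          omega
        · intro i' hi'
          rw [Finset.mem_filter] at hi' ⊢
          exact ⟨hi'.1, by omega⟩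
      have := Finset.card_lt_card this
      omega

lemma le_arcForward_first {T : Finset V} {F : V → V → V → EReal} {u v x y : V} {m σ : ℝ}
    (hu : u ∈ T) (hm : M u v = m) (hm0 : m ≤ 0) (hσ : F u v x + M x y = σ) (h1 : -B ≤ σ)
    (h2 : σ ≤ m) : (σ : EReal) ≤ arcForward B M T F u y := by
  refine le_trans ?_ (le_max_left _ _)
  refine le_trans ?_ (le_iSup_of_le v (le_iSup_of_le x le_rfl))
  rw [hm, hσ, if_pos]
  refine ⟨hu, ?_, ?_, ?_⟩
  · exact_mod_cast hm0
  · rw [← EReal.coe_neg]; exact_mod_cast h1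
  · exact_mod_cast h2

lemma le_arcForward_second {T : Finset V} {F : V → V → V → EReal} {u v x y : V} {m σ : ℝ}
    (hu : u ∈ T) (hm : M u v = m) (hm0 : m ≤ 0) (hσ : F u v x + M x y = σ)
    (h2 : m ≤ σ) : (m : EReal) ≤ arcForward B M T F u y := by
  refine le_trans ?_ ((le_max_left _ _).trans (le_max_right _ _))
  refine le_trans ?_ (le_iSup_of_le v (le_iSup_of_le x le_rfl))
  rw [hm, hσ, if_pos]
  refine ⟨hu, ?_, ?_⟩
  · exact_mod_cast hm0
  · exact_mod_cast h2

lemma le_arcForward_third {T : Finset V} {F : V → V → V → EReal} {u v x y : V} {m σ : ℝ}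
    (hu : u ∈ T) (hm : M u v = m) (hm0 : m ≤ 0) (hσ : F u v x + M x y = σ)
    (h2 : 0 ≤ σ) : ((σ - m : ℝ) : EReal) ≤ arcForward B M T F v y := by
  refine le_trans ?_ ((le_max_right _ _).trans (le_max_right _ _))
  refine le_trans ?_ (le_iSup_of_le u (le_iSup_of_le x le_rfl))
  rw [hm, hσ, if_pos]
  · rw [show σ - m = -m + σ by ring, EReal.coe_add, EReal.coe_neg]
  · refine ⟨hu, ?_, ?_⟩
    · exact_mod_cast hm0
    · exact_mod_cast h2

/-- The levels `q` only underestimate the entries; exact levels `r` are partial sums of the entries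
themselves. -/
lemma LevelPath.exists_walk {p : ℕ → V} {q : ℕ → ℝ} {a b : ℝ} {l : ℕ}
    (h : LevelPath M p q a b l) (hM : SoundTable ρ M) :
    ∃ r : ℕ → ℝ, Walk M p r 0 l ∧ ∀ i < l, q (i + 1) - q i ≤ r (i + 1) - r i := by
  refine ⟨fun n => ∑ i ∈ Finset.range n, (M (p i) (p (i + 1))).toReal, ?_, ?_⟩
  · intro i _ hi
    obtain ⟨m, hm, -⟩ := exists_real_of_le (hM _ _).1 (h.arc i hi)
    simp [Finset.sum_range_succ, hm]
  · intro i hi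
    obtain ⟨m, hm, hle⟩ := exists_real_of_le (hM _ _).1 (h.arc i hi)
    simpa [Finset.sum_range_succ, hm] using hle

lemma diff_le_of_succ {q r : ℕ → ℝ} {l : ℕ} (h : ∀ i < l, q (i + 1) - q i ≤ r (i + 1) - r i)
    {i j : ℕ} (hij : i ≤ j) (hj : j ≤ l) : q j - q i ≤ r j - r i := by
  induction j, hij using Nat.le_induction with
  | base => simp
  | succ j hij ih =>
    have := h j (by omega)
    have := ih (by omega)
    linarith

/-- The shortcut of an excursion. -/
lemma excursion_shortcut {p : ℕ → V} {q r : ℕ → ℝ} {a b : ℝ} {l j t : ℕ}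
    (hq : LevelPath M p q a b l) (hab : |a - b| ≤ B) (hW : Walk M p r 0 l)
    (hqr : ∀ i < l, q (i + 1) - q i ≤ r (i + 1) - r i) (hE : Excursion r l j t) {T : Finset V}
    {F : V → V → V → EReal} (hF : ∀ u v x, F u v x ≠ ⊤) (hT : p j ∈ T)
    (h : ((r (t - 1) - r j : ℝ) : EReal) ≤ F (p j) (p (j + 1)) (p (t - 1))) :
    ((q t - q j : ℝ) : EReal) ≤ arcForward B M T F (p j) (p t) ∨
      ((q t - q (j + 1) : ℝ) : EReal) ≤ arcForward B M T F (p (j + 1)) (p t) := by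
  have h1 := hE.lt
  have h2 := hE.le
  have h3 := hE.neg
  obtain ⟨d, hd, hle⟩ := exists_real_of_le (hF _ _ _) h
  have hm := hW j (Nat.zero_le _) (by omega)
  have hlast := hW (t - 1) (Nat.zero_le _) (by omega)
  rw [Nat.sub_add_cancel (by omega)] at hlast
  have hσ : F (p j) (p (j + 1)) (p (t - 1)) + M (p (t - 1)) (p t)
      = ((d + (r t - r (t - 1)) : ℝ) : EReal) := by rw [hd, hlast, EReal.coe_add]
  have q1 := diff_le_of_succ hqr (i := j) (j := t) (by omega) h2
  have q2 := diff_le_of_succ hqr (i := j + 1) (j := t) (by omega) h2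
  have q3 := hqr j (by omega)
  rcases le_or_gt 0 (d + (r t - r (t - 1))) with hpos | hneg
  · refine Or.inr (le_trans ?_ (le_arcForward_third hT hm (by linarith) hσ hpos))
    exact_mod_cast (by linarith)
  rcases le_total (d + (r t - r (t - 1))) (r (j + 1) - r j) with hle' | hle'
  · have := hq.diff_le hab (i := j) (j := t) (by omega) h2
    refine Or.inl (le_trans ?_ (le_arcForward_first hT hm (by linarith) hσ (by linarith) hle'))
    exact_mod_cast (by linarith)
  · refine Or.inl (le_trans ?_ (le_arcForward_second hT hm (by linarith) hσ hle'))
    norm_cast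
    rcases hE.exit with h | h | rfl
    · linarith
    · linarith
    -- The excursion runs to the end of the path, whose level is extreme. A highest end contradicts
    -- the negative sum, and a lowest end gives `q l ≤ q (j + 1)`.
    · have l1 := hq.low (j + 1) (by omega)
      have l2 := hq.high j (by omega)
      rw [hq.final] at q1 q2 ⊢
      rcases le_total a b with h | h
      · rw [max_eq_right h] at l2
        linarith
      · rw [min_eq_right h] at l1
        linarith

end Rounds

/-! ### Counting long excursions -/

section Counting

variable {r : ℕ → ℝ} {l j t e : ℕ}

lemma exists_excursion (hneg : r (j + 1) < r j) (hj : j + 2 ≤ l) : ∃ t, Excursion r l j t := by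
  have hex : ∃ t, j + 2 ≤ t ∧ (r j ≤ r t ∨ r t ≤ r (j + 1) ∨ t = l) :=
    ⟨l, hj, Or.inr (Or.inr rfl)⟩
  have hs := Nat.find_spec hex
  have hmin : ∀ i, i < Nat.find hex → j + 2 ≤ i → r (j + 1) < r i ∧ r i < r j := by
    intro i hi hji
    have := Nat.find_min hex hi
    push Not at this
    exact ⟨(this hji).2.1, (this hji).1⟩
  refine ⟨Nat.find hex, hneg, hs.1, Nat.find_min' hex ⟨hj, Or.inr (Or.inr rfl)⟩, ?_, ?_, hs.2⟩
  · intro i h1 h2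
    rcases Nat.eq_or_lt_of_le h1 with rfl | h1
    · exact le_rfl
    · exact (hmin i h2 h1).1.le
  · intro i h1 h2
    rcases Nat.eq_or_lt_of_le h1 with rfl | h1
    · exact hneg
    · exact (hmin i h2 h1).2

/-- Once the second arc is strictly shorter than the first, freedom from defects makes all sizes
strictly decrease. The walk is then a funnel strictly inside the range of its first arc and cannot
leave it before `e`. -/
lemma Excursion.long (hE : Excursion r l j t) (hd : |r (j + 2) - r (j + 1)| < |r (j + 1) - r j|)
    (hfree : ∀ i, j ≤ i → ¬ Defect r e i) (he : e ≤ l) : e ≤ t := by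
  by_contra hcon
  push Not at hcon
  have h1 := hE.lt
  have halt : ∀ i, j ≤ i → i + 2 ≤ e → (r (i + 1) - r i) * (r (i + 2) - r (i + 1)) < 0 := by
    intro i h1 h2
    by_contra h
    exact hfree i h1 (Or.inl ⟨h2, not_lt.1 h⟩)
  have hlt : ∀ i, j ≤ i → i + 2 ≤ e → |r (i + 2) - r (i + 1)| < |r (i + 1) - r i| := by
    intro i hi
    induction i, hi using Nat.le_induction with
    | base => exact fun _ => hd
    | succ i hi ih =>
      intro h2
      by_contra h
      exact hfree i (by omega) (Or.inr ⟨by omega, halt i hi (by omega),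
        halt (i + 1) (by omega) (by omega), (ih (by omega)).le, not_lt.1 h⟩)
  have hF : Funnel r (j + 1) e := fun i h1 h2 => ⟨halt i (by omega) (by omega),
    (hlt i (by omega) (by omega)).le⟩
  have hneg := hE.neg
  have a0 := halt j le_rfl (by omega)
  have p1 : 0 < r (j + 2) - r (j + 1) := by nlinarith
  have a1 := halt (j + 1) (by omega) (by omega)
  have p2 : r (j + 3) - r (j + 2) < 0 := by
    simp only [Nat.add_assoc] at a1
    norm_num at a1
    nlinarith
  have b1 := hlt (j + 1) (by omega) (by omega)
  simp only [Nat.add_assoc] at b1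
  norm_num at b1
  rw [abs_of_neg p2, abs_of_pos p1] at b1
  rw [abs_of_pos p1, abs_of_neg (by linarith)] at hd
  have hr := (Funnel.range (e - (j + 1) - 1) (by omega) hF t (by omega) (by omega)).2 (by linarith)
  have hr2 : r (j + 1) < r t := by
    have := (hF.mono (Nat.le_succ _) le_rfl).range_neg (by omega) (by linarith) (i := t) h1 (by omega)
    linarith [this.1]
  rcases hE.exit with h | h | h
  · linarith [hr.2]
  · linarith
  · omega

/-- The levels of the reversed path. -/
def revLevel (r : ℕ → ℝ) (l : ℕ) : ℕ → ℝ := fun i => -r (l - i)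

lemma Defect.of_rev {i : ℕ} (h : Defect (revLevel r l) e i) (he : e ≤ l) :
    ∃ k, Defect r l k ∧ l - e ≤ k ∧ (i + k + 2 = l ∨ i + k + 3 = l) := by
  unfold Defect revLevel at h
  rcases h with ⟨h1, h2⟩ | ⟨h1, h2, h3, h4, h5⟩
  · refine ⟨l - 2 - i, Or.inl ⟨by omega, ?_⟩, by omega, by omega⟩
    rw [show l - 2 - i + 1 = l - (i + 1) by omega, show l - 2 - i + 2 = l - i by omega,
      show l - 2 - i = l - (i + 2) by omega]
    linarith
  · refine ⟨l - 3 - i, Or.inr ⟨by omega, ?_⟩, by omega, by omega⟩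
    rw [show l - 3 - i + 1 = l - (i + 2) by omega, show l - 3 - i + 2 = l - (i + 1) by omega,
      show l - 3 - i + 3 = l - i by omega, show l - 3 - i = l - (i + 3) by omega]
    rw [show -r (l - (i + 1)) - -r (l - i) = r (l - i) - r (l - (i + 1)) by ring,
      show -r (l - (i + 2)) - -r (l - (i + 1)) = r (l - (i + 1)) - r (l - (i + 2)) by ring] at *
    rw [show -r (l - (i + 3)) - -r (l - (i + 2)) = r (l - (i + 2)) - r (l - (i + 3)) by ring] at *
    exact ⟨by linarith, by linarith, h5, h4⟩

/-- A defect spans two or three arcs, so its mirror image starts at `l - 2 - i` or at `l - 3 - i`;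
this shift costs the factor `2`. -/
lemma card_defects_rev : (defects (revLevel r l) l).card ≤ 2 * (defects r l).card := by
  have : defects (revLevel r l) l ⊆
      (defects r l).image (l - 2 - ·) ∪ (defects r l).image (l - 3 - ·) := by
    intro i hi
    obtain ⟨k, hk, -, h⟩ := (mem_defects.1 hi).of_rev le_rfl
    rw [Finset.mem_union, Finset.mem_image, Finset.mem_image]
    rcases h with h | h
    · exact Or.inl ⟨k, mem_defects.2 hk, by omega⟩
    · exact Or.inr ⟨k, mem_defects.2 hk, by omega⟩
  refine (Finset.card_le_card this).trans ((Finset.card_union_le _ _).trans ?_)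
  have h1 := Finset.card_image_le (s := defects r l) (f := (l - 2 - ·))
  have h2 := Finset.card_image_le (s := defects r l) (f := (l - 3 - ·))
  omega

/-- The positions of negative gains. -/
def negatives (r : ℕ → ℝ) (l : ℕ) : Finset ℕ := (Finset.range l).filter fun j => r (j + 1) < r j

/-- Two consecutive nonnegative gains form a defect, so every position except the last is a defect,
is negative, or precedes a negative one. -/
lemma le_card_negatives : l ≤ 2 * (negatives r l).card + (defects r l).card + 1 := by
  have : Finset.range (l - 1) ⊆
      defects r l ∪ (negatives r l ∪ (negatives r l).image (· - 1)) := by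
    intro i hi
    rw [Finset.mem_range] at hi
    simp only [Finset.mem_union, Finset.mem_image, negatives, Finset.mem_filter, Finset.mem_range,
      mem_defects]
    by_contra hcon
    push Not at hcon
    obtain ⟨h1, h2, h3⟩ := hcon
    have n1 := h2 (by omega)
    have n2 : r (i + 1) ≤ r (i + 1 + 1) := by
      by_contra h
      exact h3 (i + 1) ⟨by omega, not_le.1 h⟩ (by omega)
    exact h1 (Or.inl ⟨by omega, mul_nonneg (by linarith) (by linarith)⟩)
  have h1 := (Finset.card_le_card this).trans (Finset.card_union_le _ _)
  have h2 := Finset.card_union_le (negatives r l) ((negatives r l).image (· - 1))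
  have h3 := Finset.card_image_le (s := negatives r l) (f := (· - 1))
  rw [Finset.card_range] at h1
  omega

/-- The negative gains with excursions of at least `m` arcs. -/
def longArcs (r : ℕ → ℝ) (l m : ℕ) : Finset ℕ :=
  (Finset.range l).filter fun j => ∃ t, Excursion r l j t ∧ j + m ≤ t

/-- The negative gains without defects close by. -/
def clearArcs (r : ℕ → ℝ) (l m : ℕ) : Finset ℕ := (negatives r l).filter fun j =>
  m ≤ j ∧ j + m ≤ l ∧ ∀ i ∈ defects r l, ¬ (j ≤ i + m ∧ i < j + m)

/-- Each defect spoils at most `2 m` positions, and each end of the path at most `m`. -/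
lemma card_negatives_le (m : ℕ) :
    (negatives r l).card ≤ (clearArcs r l m).card + 2 * m * ((defects r l).card + 1) := by
  have : negatives r l ⊆ clearArcs r l m ∪ (Finset.range m ∪ (Finset.Ico (l + 1 - m) l ∪
      (defects r l).biUnion fun i => Finset.Ico (i + 1 - m) (i + m + 1))) := by
    intro j hj
    have hj' := (Finset.mem_filter.1 hj).1
    rw [Finset.mem_range] at hj'
    simp only [Finset.mem_union, clearArcs, Finset.mem_filter, Finset.mem_range, Finset.mem_Ico,
      Finset.mem_biUnion]
    by_contra hcon
    push Not at hcon
    obtain ⟨h1, h2, h3, h4⟩ := hcon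
    obtain ⟨i, hi, h5, h6⟩ := h1 hj h2 (by by_contra h; exact absurd (h3 (by omega)) (by omega))
    have := h4 i hi (by omega)
    omega
  have h1 := (Finset.card_le_card this).trans (Finset.card_union_le _ _)
  have h2 := Finset.card_union_le (Finset.range m) (Finset.Ico (l + 1 - m) l ∪
      (defects r l).biUnion fun i => Finset.Ico (i + 1 - m) (i + m + 1))
  have h3 := Finset.card_union_le (Finset.Ico (l + 1 - m) l)
      ((defects r l).biUnion fun i => Finset.Ico (i + 1 - m) (i + m + 1))
  have h4 : ((defects r l).biUnion fun i => Finset.Ico (i + 1 - m) (i + m + 1)).card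
      ≤ (defects r l).card * (2 * m) := Finset.card_biUnion_le_card_mul _ _ _ fun i _ => by
    rw [Nat.card_Ico]; omega
  rw [Finset.card_range] at h2
  rw [Nat.card_Ico] at h3
  nlinarith [show l - (l + 1 - m) ≤ m by omega]

/-- A clear arc is not the middle of a defect, so one of its neighbours is strictly shorter. In that
direction `Excursion.long` applies; reversal sends arc `j` to arc `l - 1 - j`. -/
lemma clear_dichotomy {m : ℕ} (hm : 2 ≤ m) (hj : j ∈ clearArcs r l m) :
    j ∈ longArcs r l m ∨ l - 1 - j ∈ longArcs (revLevel r l) l m := by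
  obtain ⟨hneg, h1, h2, h3⟩ := Finset.mem_filter.1 hj
  obtain ⟨hjl, hneg⟩ := Finset.mem_filter.1 hneg
  rw [Finset.mem_range] at hjl
  have hfree : ∀ i, j ≤ i + m → i < j + m → ¬ Defect r l i := fun i hi hi' hd =>
    h3 i (mem_defects.2 hd) ⟨hi, hi'⟩
  have hdich : |r (j + 2) - r (j + 1)| < |r (j + 1) - r j| ∨
      |r j - r (j - 1)| < |r (j + 1) - r j| := by
    by_contra hcon
    push Not at hcon
    have f1 := hfree (j - 1) (by omega) (by omega)
    have f2 := hfree j (by omega) (by omega)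
    refine f1 (Or.inr ⟨by omega, ?_, ?_, ?_, ?_⟩)
    · by_contra h; exact f1 (Or.inl ⟨by omega, not_lt.1 h⟩)
    all_goals rw [show j - 1 + 1 = j by omega, show j - 1 + 2 = j + 1 by omega]
    · rw [show j - 1 + 3 = j + 2 by omega]
      by_contra h; exact f2 (Or.inl ⟨by omega, not_lt.1 h⟩)
    · exact hcon.2
    · rw [show j - 1 + 3 = j + 2 by omega]
      exact hcon.1
  rcases hdich with hd | hd
  · left
    obtain ⟨t, ht⟩ := exists_excursion (l := l) hneg (by omega)
    refine Finset.mem_filter.2 ⟨Finset.mem_range.2 hjl, t, ht, ht.long hd (fun i hi hdi => ?_) h2⟩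
    refine hfree i (by omega) ?_ (hdi.mono h2)
    rcases hdi with h | h <;> omega
  · right
    have e1 : l - (l - 1 - j) = j + 1 := by omega
    have e2 : l - (l - 1 - j + 1) = j := by omega
    have e3 : l - (l - 1 - j + 2) = j - 1 := by omega
    obtain ⟨t, ht⟩ := exists_excursion (r := revLevel r l) (l := l) (j := l - 1 - j)
      (by simp only [revLevel, e1, e2]; linarith) (by omega)
    refine Finset.mem_filter.2 ⟨Finset.mem_range.2 (by omega), t, ht, ht.long ?_ ?_ (by omega)⟩
    · simp only [revLevel, e1, e2, e3]
      rw [show -r (j - 1) - -r j = r j - r (j - 1) by ring,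
        show -r j - -r (j + 1) = r (j + 1) - r j by ring]
      exact hd
    · intro i hi hdi
      obtain ⟨k, hk, hk1, hk2⟩ := hdi.of_rev (by omega)
      exact hfree k (by omega) (by omega) hk

lemma card_clear_le {m : ℕ} (hm : 2 ≤ m) : (clearArcs r l m).card ≤
    (longArcs r l m).card + (longArcs (revLevel r l) l m).card := by
  have : clearArcs r l m ⊆
      longArcs r l m ∪ (longArcs (revLevel r l) l m).image (l - 1 - ·) := by
    intro j hj
    have hjl := Finset.mem_range.1 (Finset.mem_filter.1 (Finset.mem_filter.1 hj).1).1
    rw [Finset.mem_union, Finset.mem_image]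
    rcases clear_dichotomy hm hj with h | h
    · exact Or.inl h
    · exact Or.inr ⟨_, h, by omega⟩
  refine (Finset.card_le_card this).trans ((Finset.card_union_le _ _).trans ?_)
  have := Finset.card_image_le (s := longArcs (revLevel r l) l m) (f := (l - 1 - ·))
  omega

/-- The negative gains with long excursions that contain few defects. -/
def goodArcs (r : ℕ → ℝ) (l : ℕ) (s : ℝ) : Finset ℕ :=
  (Finset.range l).filter fun j => ∃ t, Excursion r l j t ∧ 2 * s ≤ t - j ∧
    4 * s * ((defects r l).filter fun i => j ≤ i ∧ i < t).card ≤ t - j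

/-- Sweep from left to right. The leftmost `a ∈ J` absorbs all members of `J` before `τ a`, at most
`τ a - a` of them, which the members of `X` in the same interval pay for. Continue at `τ a`, so that
no member of `X` pays twice. -/
lemma card_dense_le {J X : Finset ℕ} {c : ℝ} (hc : 0 ≤ c) {τ : ℕ → ℕ} (hτ : ∀ j ∈ J, j < τ j)
    (h : ∀ j ∈ J, (τ j - j : ℝ) ≤ c * (X.filter fun i => j ≤ i ∧ i < τ j).card) (hJ : ∀ j ∈ J, j < l)
    (n : ℕ) : ∀ a, l ≤ a + n → ((J.filter (a ≤ ·)).card : ℝ) ≤ c * (X.filter (a ≤ ·)).card := by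
  induction n using Nat.strong_induction_on with
  | _ n ih =>
    intro a ha
    have hsplit : ∀ (Y : Finset ℕ) (b : ℕ), a ≤ b → (Y.filter (a ≤ ·)).card
        = (Y.filter fun i => a ≤ i ∧ i < b).card + (Y.filter (b ≤ ·)).card := by
      intro Y b hb
      rw [← Finset.card_union_of_disjoint]
      · congr 1
        ext i
        simp only [Finset.mem_union, Finset.mem_filter]
        constructor
        · rintro ⟨h1, h2⟩
          rcases Nat.lt_or_ge i b with h | h
          · exact Or.inl ⟨h1, h2, h⟩
          · exact Or.inr ⟨h1, h⟩
        · rintro (⟨h1, h2, h3⟩ | ⟨h1, h2⟩)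
          · exact ⟨h1, h2⟩
          · exact ⟨h1, by omega⟩
      · rw [Finset.disjoint_left]
        intro i hi hi'
        simp only [Finset.mem_filter] at hi hi'
        omega
    by_cases haJ : a ∈ J
    · have hal := hJ a haJ
      have hta := hτ a haJ
      have h1 := ih (n - (τ a - a)) (by omega) (τ a) (by omega)
      rw [hsplit J (τ a) hta.le, hsplit X (τ a) hta.le]
      have h2 : ((J.filter fun i => a ≤ i ∧ i < τ a).card : ℝ) ≤ τ a - a := by
        have : J.filter (fun i => a ≤ i ∧ i < τ a) ⊆ Finset.Ico a (τ a) := by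
          intro i hi
          rw [Finset.mem_Ico]
          exact (Finset.mem_filter.1 hi).2
        have := Finset.card_le_card this
        rw [Nat.card_Ico] at this
        rw [← Nat.cast_sub hta.le]
        exact_mod_cast this
      have h3 := h a haJ
      push_cast
      linarith
    · by_cases hn : n = 0
      · have : J.filter (a ≤ ·) = ∅ := by
          ext j
          simp only [Finset.mem_filter, Finset.notMem_empty, iff_false]
          intro hj
          have := hJ j hj.1
          omega
        rw [this]
        simp only [Finset.card_empty, Nat.cast_zero]
        positivity
      · have h1 := ih (n - 1) (by omega) (a + 1) (by omega)
        have : J.filter (a ≤ ·) = J.filter (a + 1 ≤ ·) := by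
          refine Finset.filter_congr fun j hj => ?_
          have : j ≠ a := fun h => haJ (h ▸ hj)
          omega
        rw [this]
        refine h1.trans (mul_le_mul_of_nonneg_left ?_ hc)
        refine Nat.cast_le.2 (Finset.card_le_card fun i hi => ?_)
        rw [Finset.mem_filter] at hi ⊢
        exact ⟨hi.1, by omega⟩

/-- A long arc that is not good has an excursion with more than one defect per `4 s` arcs;
`card_dense_le` bounds the number of these. -/
lemma card_longArcs_le {m : ℕ} {s : ℝ} (hs : 0 ≤ s) (hm : 2 * s ≤ m) : ((longArcs r l m).card : ℝ) ≤
    (goodArcs r l s).card + 4 * s * (defects r l).card := by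
  have hτ : ∀ j, ∃ t, j ∈ longArcs r l m → Excursion r l j t ∧ j + m ≤ t := by
    intro j
    by_cases h : j ∈ longArcs r l m
    · obtain ⟨t, ht⟩ := (Finset.mem_filter.1 h).2
      exact ⟨t, fun _ => ht⟩
    · exact ⟨0, fun h' => absurd h' h⟩
  choose τ hτ using hτ
  have h1 := card_dense_le (l := l) (J := longArcs r l m \ goodArcs r l s) (X := defects r l)
    (c := 4 * s) (by positivity) (τ := τ)
    (fun j hj => by have := (hτ j (Finset.mem_sdiff.1 hj).1).1.lt; omega)
    (fun j hj => by
      obtain ⟨hj, hg⟩ := Finset.mem_sdiff.1 hj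
      by_contra hcon
      refine hg (Finset.mem_filter.2 ⟨(Finset.mem_filter.1 hj).1, τ j, (hτ j hj).1, ?_,
        (not_le.1 hcon).le⟩)
      have : (j : ℝ) + m ≤ τ j := by exact_mod_cast (hτ j hj).2
      linarith)
    (fun j hj => Finset.mem_range.1 (Finset.mem_filter.1 (Finset.mem_sdiff.1 hj).1).1) l 0
    (Nat.le_add_left _ _)
  simp only [Nat.zero_le, Finset.filter_true] at h1
  have h2 : (longArcs r l m).card ≤ (goodArcs r l s).card +
      (longArcs r l m \ goodArcs r l s).card := by
    rw [add_comm]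
    exact Finset.card_le_card_sdiff_add_card
  have : ((longArcs r l m).card : ℝ) ≤ (goodArcs r l s).card +
      (longArcs r l m \ goodArcs r l s).card := by exact_mod_cast h2
  linarith

/-- If there are few defects, then a constant fraction of all arcs is good in one direction. -/
lemma card_goodArcs {s : ℝ} (hs : 1 ≤ s) (h : 100 * s * ((defects r l).card + 2) ≤ l) :
    (l : ℝ) ≤ 10 * (goodArcs r l s).card ∨
      (l : ℝ) ≤ 10 * (goodArcs (revLevel r l) l s).card := by
  by_contra hcon
  push Not at hcon
  have hm : 2 * s ≤ ⌈2 * s⌉₊ := Nat.le_ceil _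
  have hm' : (⌈2 * s⌉₊ : ℝ) ≤ 3 * s := by
    have := (Nat.ceil_lt_add_one (show 0 ≤ 2 * s by positivity)).le
    linarith
  have hm2 : 2 ≤ ⌈2 * s⌉₊ := by
    have : (2 : ℝ) ≤ ⌈2 * s⌉₊ := by linarith
    exact_mod_cast this
  generalize ⌈2 * s⌉₊ = m at *
  have a1 : (l : ℝ) ≤ 2 * (negatives r l).card + (defects r l).card + 1 := by
    exact_mod_cast le_card_negatives
  have a2 : ((negatives r l).card : ℝ) ≤ (clearArcs r l m).card
      + 2 * m * ((defects r l).card + 1) := by exact_mod_cast card_negatives_le m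
  have a3 : ((clearArcs r l m).card : ℝ) ≤ (longArcs r l m).card
    + (longArcs (revLevel r l) l m).card := by exact_mod_cast card_clear_le hm2
  have a4 := card_longArcs_le (r := r) (l := l) (by linarith) hm
  have a5 := card_longArcs_le (r := revLevel r l) (l := l) (by linarith) hm
  have a6 : ((defects (revLevel r l) l).card : ℝ) ≤ 2 * (defects r l).card := by
    exact_mod_cast card_defects_rev
  generalize ((defects r l).card : ℝ) = x at *
  have hx : 0 ≤ x := by
    rcases le_or_gt 0 x with h | h
    · exact h
    · nlinarith [(Nat.cast_nonneg (defects (revLevel r l) l).card : (0 : ℝ) ≤ _)]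
  have b1 : 4 * s * (defects (revLevel r l) l).card ≤ 4 * s * (2 * x) :=
    mul_le_mul_of_nonneg_left a6 (by linarith)
  have b2 : 2 * (m : ℝ) * (x + 1) ≤ 2 * (3 * s) * (x + 1) := by
    refine mul_le_mul_of_nonneg_right ?_ (by linarith)
    linarith
  have b3 : x ≤ s * x := by nlinarith
  -- With `2 s ≤ m ≤ 3 s` the estimates add up to `l ≤ 2 l / 5 + 37 s x + 13 s`, against `100 s (x +
  -- 2) ≤ l`.
  nlinarith

/-- The good arcs whose excursions have about `2 ^ i * s` arcs. -/
def classArcs (r : ℕ → ℝ) (l : ℕ) (s : ℝ) (i : ℕ) : Finset ℕ :=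
  (Finset.range l).filter fun j => ∃ t, Excursion r l j t ∧ 2 ^ i * s ≤ t - j ∧
    ((defects r l).filter fun i => j ≤ i ∧ i < t).card + 1 ≤ 2 ^ i

/-- Choose `2 ^ i ≤ (t - j) / s < 2 ^ (i + 1)`. Goodness gives a quotient of at least `2`, so `1 ≤
i`, and fewer than `2 ^ i / 2` defects; `t ≤ l ≤ s * s` gives `2 ^ i ≤ s`. -/
lemma exists_class {s : ℝ} (hs : 1 ≤ s) (hl : (l : ℝ) ≤ s * s) (hj : j ∈ goodArcs r l s) :
    ∃ i, 1 ≤ i ∧ (2 : ℝ) ^ i ≤ s ∧ j ∈ classArcs r l s i := by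
  obtain ⟨hjl, t, hE, h1, h2⟩ := Finset.mem_filter.1 hj
  have h2s : 2 ≤ ((t : ℝ) - j) / s := by
    rw [le_div_iff₀ (by linarith)]
    exact h1
  obtain ⟨i, hi, hi'⟩ := exists_nat_pow_near (show 1 ≤ ((t : ℝ) - j) / s by linarith)
    (show (1 : ℝ) < 2 by norm_num)
  have htl : (t : ℝ) ≤ l := by exact_mod_cast hE.le
  refine ⟨i, ?_, ?_, Finset.mem_filter.2 ⟨hjl, t, hE, ?_, ?_⟩⟩
  · by_contra h
    have : i = 0 := by omega
    subst this
    norm_num at hi'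
    linarith
  · refine hi.trans ?_
    rw [div_le_iff₀ (by linarith)]
    linarith [(Nat.cast_nonneg j : (0 : ℝ) ≤ j)]
  · rwa [le_div_iff₀ (by linarith)] at hi
  · rw [div_lt_iff₀ (by linarith), pow_succ] at hi'
    generalize ((defects r l).filter fun i => j ≤ i ∧ i < t).card = x at *
    have : (2 * x : ℝ) < 2 ^ i := by
      by_contra hcon
      push Not at hcon
      nlinarith
    have : 2 * x < 2 ^ i := by exact_mod_cast this
    rcases Nat.eq_zero_or_pos x with rfl | h
    · simpa using Nat.one_le_two_pow (n := i)
    · omega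

/-- Pigeonhole principle: at most `c` classes cover the good arcs. -/
lemma exists_large_class {s c : ℝ} (hs : 1 ≤ s) (hl : (l : ℝ) ≤ s * s)
    (hc : ∀ i : ℕ, (2 : ℝ) ^ i ≤ s → (i : ℝ) ≤ c) (hl0 : 0 < l)
    (hg : (l : ℝ) ≤ 10 * (goodArcs r l s).card) :
    ∃ i, 1 ≤ i ∧ (2 : ℝ) ^ i ≤ s ∧ (l : ℝ) ≤ 10 * c * (classArcs r l s i).card := by
  by_contra hcon
  push Not at hcon
  have hc0 : 0 ≤ c := by simpa using hc 0 (by simpa using hs)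
  set I := (Finset.Icc 1 ⌊c⌋₊).filter fun i : ℕ => (2 : ℝ) ^ i ≤ s with hI
  have hsub : goodArcs r l s ⊆ I.biUnion (classArcs r l s) := by
    intro j hj
    obtain ⟨i, h1, h2, h3⟩ := exists_class hs hl hj
    rw [Finset.mem_biUnion]
    refine ⟨i, Finset.mem_filter.2 ⟨Finset.mem_Icc.2 ⟨h1, Nat.le_floor (hc i h2)⟩, h2⟩, h3⟩
  have h1 : ((goodArcs r l s).card : ℝ) ≤ ∑ i ∈ I, ((classArcs r l s i).card : ℝ) := by
    exact_mod_cast (Finset.card_le_card hsub).trans Finset.card_biUnion_le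
  have hpos : (0 : ℝ) < l := by exact_mod_cast hl0
  have hne : I.Nonempty := by
    by_contra h
    rw [Finset.not_nonempty_iff_eq_empty] at h
    rw [h, Finset.sum_empty] at h1
    linarith
  have hcard : (I.card : ℝ) ≤ c := by
    have : I.card ≤ ⌊c⌋₊ := by
      refine (Finset.card_filter_le _ _).trans ?_
      rw [Nat.card_Icc]; omega
    exact (Nat.cast_le.2 this).trans (Nat.floor_le hc0)
  have hIpos : (0 : ℝ) < I.card := by exact_mod_cast Finset.card_pos.2 hne
  have h2 : ∑ i ∈ I, 10 * c * ((classArcs r l s i).card : ℝ) < ∑ i ∈ I, (l : ℝ) := by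
    refine Finset.sum_lt_sum_of_nonempty hne fun i hi => ?_
    obtain ⟨h3, h4⟩ := Finset.mem_filter.1 hi
    exact hcon i (Finset.mem_Icc.1 h3).1 h4
  rw [← Finset.mul_sum, Finset.sum_const, nsmul_eq_mul] at h2
  have h3 : 10 * c * (goodArcs r l s).card ≤ 10 * c * ∑ i ∈ I, ((classArcs r l s i).card : ℝ) :=
    mul_le_mul_of_nonneg_left h1 (by linarith)
  nlinarith

/-- Every `g` consecutive members of `A` contain a member whose vertex belongs to `S`. -/
def Hits {V : Type u} (S : Finset V) (p : ℕ → V) (A : Finset ℕ) (l g : ℕ) : Prop :=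
  ∀ a b, b ≤ l → g ≤ (A.filter fun j => a ≤ j ∧ j < b).card →
    ∃ j ∈ A, a ≤ j ∧ j < b ∧ p j ∈ S

lemma Hops.trans {R : ℕ → ℕ → Prop} {k k' a b c : ℕ} (h : Hops R k a b) (h' : Hops R k' b c) :
    Hops R (k + k') a c := by
  induction h with
  | refl i => simpa using h'
  | cons hij hR _ ih =>
    rw [Nat.add_right_comm]
    exact Hops.cons hij hR (ih h')

lemma Hops.steps {R : ℕ → ℕ → Prop} (h : ∀ i < l, R i (i + 1)) (n : ℕ) :
    ∀ a, a + n ≤ l → Hops R n a (a + n) := by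
  induction n with
  | zero => exact fun a _ => Hops.refl a
  | succ n ih =>
    intro a ha
    have := Hops.cons (Nat.lt_succ_self a) (h a (by omega)) (ih (a + 1) (by omega))
    rwa [show a + 1 + n = a + (n + 1) by omega] at this

/-- Shortcuts of the sampled excursions are combined greedily. -/
lemma exists_shortcut_hops {V : Type u} {S : Finset V} {p : ℕ → V} {A : Finset ℕ} {g : ℕ}
    {R : ℕ → ℕ → Prop} (hA : ∀ j ∈ A, j < l) (hH : Hits S p A l g)
    (hstep : ∀ i < l, R i (i + 1))
    (hjump : ∀ j ∈ A, p j ∈ S → ∃ t, t ≤ l ∧ j + 3 ≤ t ∧ j + g ≤ t ∧ (R j t ∨ R (j + 1) t))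
    (n : ℕ) : ∀ a, a + n = l → ∃ k, Hops R k a l ∧ 6 * k + (A.filter (a ≤ ·)).card ≤ 6 * n + g := by
  induction n using Nat.strong_induction_on with
  | _ n ih =>
    intro a ha
    by_cases hlt : (A.filter (a ≤ ·)).card < g
    · refine ⟨n, ?_, by omega⟩
      have := Hops.steps hstep n a (by omega)
      rwa [ha] at this
    have hAl : (A.filter fun j => a ≤ j ∧ j < l) = A.filter (a ≤ ·) :=
      Finset.filter_congr fun j hj => ⟨fun h => h.1, fun h => ⟨h, hA j hj⟩⟩
    have hex : ∃ b, g ≤ (A.filter fun j => a ≤ j ∧ j < b).card := ⟨l, by rw [hAl]; omega⟩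
    have hbl : Nat.find hex ≤ l := Nat.find_min' hex (by rw [hAl]; omega)
    obtain ⟨j, hj, haj, hjb, hjS⟩ := hH a _ hbl (Nat.find_spec hex)
    have hfew := Nat.find_min hex hjb
    obtain ⟨t, htl, ht3, htg, hR⟩ := hjump j hj hjS
    obtain ⟨k, hk, hc⟩ := ih (l - t) (by omega) t (by omega)
    have h1 := Hops.steps hstep (j - a) a (by omega)
    rw [show a + (j - a) = j by omega] at h1
    obtain ⟨k', hk', hle⟩ : ∃ k', Hops R k' j l ∧ k' ≤ k + 2 := by
      rcases hR with h | h
      · exact ⟨k + 1, Hops.cons (by omega) h hk, by omega⟩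
      · exact ⟨k + 2, Hops.cons (Nat.lt_succ_self j) (hstep j (by omega))
          (Hops.cons (by omega) h hk), by omega⟩
    refine ⟨j - a + k', h1.trans hk', ?_⟩
    have hsub : A.filter (a ≤ ·) ⊆ (A.filter fun i => a ≤ i ∧ i < j) ∪
        (Finset.Ico j t ∪ A.filter (t ≤ ·)) := by
      intro i hi
      rw [Finset.mem_filter] at hi
      simp only [Finset.mem_union, Finset.mem_filter, Finset.mem_Ico]
      have := hi.1
      by_cases h1 : i < j
      · exact Or.inl ⟨hi.1, hi.2, h1⟩
      · by_cases h2 : i < t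
        · exact Or.inr (Or.inl ⟨by omega, h2⟩)
        · exact Or.inr (Or.inr ⟨hi.1, by omega⟩)
    -- The minimal window end leaves fewer than `g` members before `j`. The jump skips at least `max
    -- g 3` arcs, and `12 + g ≤ 5 (t - j)` pays for its two hops and for those members.
    have c1 := (Finset.card_le_card hsub).trans (Finset.card_union_le _ _)
    have c2 := Finset.card_union_le (Finset.Ico j t) (A.filter (t ≤ ·))
    rw [Nat.card_Ico] at c2
    omega

end Counting

/-! ### The probability of useful long shortcuts -/

section LongShortcuts

variable {V : Type u} [Fintype V] {B : ℝ} {ρ : ChargeRel V B} {M N : V → V → EReal}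

/-- A sampled arc of class `i` has fewer than `2 ^ i` defects in its excursion, so the rounds of
iteration `i` cover it up to the last arc. Arc-Bounded-To-Monotone appends that arc and yields a
jump over at least `2 ^ i * s` arcs, or over one arc less when it starts at `j + 1`. -/
lemma long_savings_forward (hB : 0 ≤ B) (hM : SoundTable ρ M) {p : ℕ → V} {q r : ℕ → ℝ}
    {a b : ℝ} {l i g : ℕ} {s : ℝ} (hq : LevelPath M p q a b l) (hab : |a - b| ≤ B)
    (hW : Walk M p r 0 l) (hqr : ∀ i < l, q (i + 1) - q i ≤ r (i + 1) - r i) {D : Tables V}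
    {T T' : Finset V} (hD : SoundTables ρ M D) (hF : FunnelsComplete M D) (hTT : T ⊆ T')
    {F : V → V → V → EReal} (hFt : ∀ u v x, F u v x ≠ ⊤)
    (hle : ((longRound M T)^[2 ^ i] D).first ≤ F) (hMN : M ≤ N)
    (hN : arcForward B M T' F ≤ N) (hL : 2 < 2 ^ i * s) (hg : g ≤ ⌈2 ^ i * s⌉₊)
    (hH : Hits T p (classArcs r l s i) l g) :
    ∃ k, PathIn N a b (p 0) (p l) k ∧ 6 * k + (classArcs r l s i).card ≤ 6 * l + g := by
  have hjump : ∀ j ∈ classArcs r l s i, p j ∈ T → ∃ t, t ≤ l ∧ j + 3 ≤ t ∧ j + g ≤ t ∧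
      (((q t - q j : ℝ) : EReal) ≤ N (p j) (p t) ∨
        ((q t - q (j + 1) : ℝ) : EReal) ≤ N (p (j + 1)) (p t)) := by
    intro j hj hjT
    obtain ⟨t, hE, h1, h2⟩ := (Finset.mem_filter.1 hj).2
    have h3 := hE.lt
    have h4 : ⌈2 ^ i * s⌉₊ ≤ t - j := by
      rw [Nat.ceil_le, Nat.cast_sub (by omega)]
      exact h1
    have h5 : 2 < t - j := by
      have : (2 : ℝ) < ((t - j : ℕ) : ℝ) := by
        rw [Nat.cast_sub (by omega)]
        exact hL.trans_le h1
      exact_mod_cast this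
    refine ⟨t, hE.le, by omega, by omega, ?_⟩
    have hbase := hF.1 p r j (j + 1) (Nat.lt_succ_self j)
      (hW.mono (Nat.zero_le _) (by have := hE.le; omega)) (fun i h h' => by omega)
    have hcard : ((defects r (t - 1)).filter (j + 1 ≤ ·)).card + 1 ≤ 2 ^ i := by
      refine le_trans (Nat.add_le_add_right (Finset.card_le_card fun i hi => ?_) 1) h2
      rw [Finset.mem_filter] at hi ⊢
      refine ⟨mem_defects.2 ((mem_defects.1 hi.1).mono (by have := hE.le; omega)), by omega, ?_⟩
      have := Finset.mem_range.1 (Finset.mem_filter.1 hi.1).1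
      omega
    have hadv := longRound_iterate_advance hB hM hW hq.inj hE hjT (e := t - 1) (by omega) (2 ^ i)
      hD hF le_rfl (by omega) hcard hbase
    rcases excursion_shortcut hq hab hW hqr hE hFt (hTT hjT) (hadv.trans (hle _ _ _)) with h | h
    · exact Or.inl (h.trans (hN _ _))
    · exact Or.inr (h.trans (hN _ _))
  obtain ⟨k, hk, hc⟩ := exists_shortcut_hops
    (R := fun i j => ((q j - q i : ℝ) : EReal) ≤ N (p i) (p j)) (A := classArcs r l s i)
    (fun j hj => Finset.mem_range.1 (Finset.mem_filter.1 hj).1) hH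
    (fun i hi => (hq.mono hMN).arc i hi) hjump l 0 (Nat.zero_add l)
  exact ⟨k, hq.of_hops hk, by simpa using hc⟩

lemma LevelPath.reverse {p : ℕ → V} {q : ℕ → ℝ} {a b : ℝ} {l : ℕ} (h : LevelPath M p q a b l) :
    LevelPath (tr M) (fun i => p (l - i)) (revLevel q l) (-b) (-a) l where
  start := by simp [revLevel, h.final]
  final := by simp [revLevel, h.start]
  inj i j hij hj := (h.inj (l - j) (l - i) (by omega) (by omega)).symm
  arc i hi := by
    have := h.arc (l - (i + 1)) (by omega)
    rw [show l - (i + 1) + 1 = l - i by omega] at this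
    simp only [revLevel, tr]
    rwa [show -q (l - (i + 1)) - -q (l - i) = q (l - i) - q (l - (i + 1)) by ring]
  low i hi := by
    have := h.high (l - i) (by omega)
    rw [min_neg_neg, max_comm]
    exact neg_le_neg this
  high i hi := by
    have := h.low (l - i) (by omega)
    rw [max_neg_neg, min_comm]
    exact neg_le_neg this

lemma PathIn.reverse {a b : ℝ} {x z : V} {k : ℕ} (h : PathIn M a b x z k) :
    PathIn (tr M) (-b) (-a) z x k := by
  obtain ⟨p, q, h, rfl, rfl⟩ := h
  exact ⟨_, _, h.reverse, by simp, by simp⟩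

/-- Some sample with the property `Q` was used in the iteration `i` of the loop. -/
def Sampled (ρ : ChargeRel V B) (M : V → V → EReal) (i : ℕ) (Q : Finset V → Prop)
    (st : Tables V × Finset V) : Prop :=
  ∃ D T, SoundTables ρ M D ∧ FunnelsComplete M D ∧ Q T ∧ T ⊆ st.2 ∧ SoundTables ρ M st.1 ∧
    ((longRound M T)^[2 ^ i] D).first ≤ st.1.first ∧ ((longRound M T)^[2 ^ i] D).last ≤ st.1.last

lemma le_longRound_iterate (hB : 0 ≤ B) (hM : SoundTable ρ M) {D : Tables V}
    (h : SoundTables ρ M D) (T : Finset V) (k : ℕ) :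
    SoundTables ρ M ((longRound M T)^[k] D) ∧ D.first ≤ ((longRound M T)^[k] D).first ∧
      D.last ≤ ((longRound M T)^[k] D).last := by
  refine iterate_invariant (f := longRound M T) (I := fun D' =>
    SoundTables ρ M D' ∧ D.first ≤ D'.first ∧ D.last ≤ D'.last) (fun D' h' => ?_) k D
    ⟨h, le_rfl, le_rfl⟩
  refine ⟨h'.1.longRound hB hM T, h'.2.1.trans (first_le_longRound hB hM h'.1 T),
    h'.2.2.trans fun x v u => ?_⟩
  have := first_le_longRound hB (hM.transpose hB) h'.1.swap T u v x
  rw [longRound_swap] at this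
  exact this

lemma FunnelsComplete.mono {D D' : Tables V} (h : FunnelsComplete M D) (h1 : D.first ≤ D'.first)
    (h2 : D.last ≤ D'.last) : FunnelsComplete M D' :=
  ⟨h.1.mono h1, h.2.mono fun u v x => h2 x v u⟩

lemma le_longLoop (hB : 0 ≤ B) (hM : SoundTable ρ M) (κ : HiddenConstants)
    (k i : ℕ) {st st' : Tables V × Finset V} (h : SoundTables ρ M st.1)
    (h' : st' ∈ (longLoop κ M k i st).support) :
    st.1.first ≤ st'.1.first ∧ st.1.last ≤ st'.1.last ∧ st.2 ⊆ st'.2 := by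
  induction k generalizing i st with
  | zero =>
    rw [longLoop, PMF.mem_support_pure_iff] at h'
    subst h'
    exact ⟨le_rfl, le_rfl, subset_rfl⟩
  | succ k ih =>
    rw [longLoop, PMF.mem_support_bind_iff] at h'
    obtain ⟨T, -, hT⟩ := h'
    have h1 := le_longRound_iterate hB hM h T (2 ^ i)
    have h2 := ih (i + 1) h1.1 hT
    exact ⟨h1.2.1.trans h2.1, h1.2.2.trans h2.2.1, Finset.subset_union_left.trans h2.2.2⟩

lemma failProb_eq_zero {α : Type*} (p : PMF α) {P : α → Prop} (h : ∀ a ∈ p.support, P a) :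
    failProb p P = 0 := by
  refine le_antisymm ?_ zero_le
  calc failProb p P ≤ failProb p (fun _ => True) := failProb_mono p fun a ha _ => h a ha
    _ = 0 := by unfold failProb; simp [failInd, expect_const]

/-- The sampling rate of the iteration `i`. -/
def longRate (κ : HiddenConstants) (V : Type u) [Fintype V] (i : ℕ) : ℝ :=
  κ.cLong * logn V ^ 2 / (2 ^ i * (Fintype.card V : ℝ) ^ (1 / 2 : ℝ))

/-- Other iterations are harmless: earlier ones only pass on larger sound tables, later ones never
decrease what iteration `i` has found. Only its own fresh sample matters. -/
lemma longLoop_prob (hB : 0 ≤ B) (hM : SoundTable ρ M) (κ : HiddenConstants) {i : ℕ}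
    {Q : Finset V → Prop} (k : ℕ) : ∀ {i₀ : ℕ} {st : Tables V × Finset V}, i₀ ≤ i → i < i₀ + k →
    SoundTables ρ M st.1 → FunnelsComplete M st.1 →
    failProb (longLoop κ M k i₀ st) (Sampled ρ M i Q) ≤ failProb (sample V (longRate κ V i)) Q := by
  induction k with
  | zero => intro i₀ st h1 h2; omega
  | succ k ih =>
    intro i₀ st h1 h2 hD hF
    rw [longLoop]
    have hstep := fun T => le_longRound_iterate hB hM hD T (2 ^ i₀)
    rcases Nat.eq_or_lt_of_le h1 with rfl | h1
    · refine (failProb_bind_le _ _ Q _ 0 fun T _ hT => ?_).trans (add_zero _).le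
      refine (failProb_eq_zero _ fun st' hst' => ?_).le
      have hmono := le_longLoop hB hM κ k (i₀ + 1) (hstep T).1 hst'
      exact ⟨st.1, T, hD, hF, hT, Finset.subset_union_right.trans hmono.2.2,
        soundTables_of_mem_longLoop hB hM κ k (i₀ + 1) (hstep T).1 hst', hmono.1, hmono.2.1⟩
    · refine (failProb_bind_le _ _ (fun _ => True) _ _ fun T _ _ =>
        ih (st := (_, _)) (by omega) (by omega) (hstep T).1
          (hF.mono (hstep T).2.1 (hstep T).2.2)).trans ?_
      rw [failProb_eq_zero _ fun _ _ => trivial, zero_add]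

lemma longShortcuts_prob_of_sampled (hB : 0 ≤ B) (hM : SoundTable ρ M) (κ : HiddenConstants)
    {i : ℕ} (hi : 1 ≤ i)
    (hi' : i < 1 + ⌈Real.logb 2 ((Fintype.card V : ℝ) ^ (1 / 2 : ℝ) * logn V ^ 2)⌉₊)
    {Q : Finset V → Prop} {P : (V → V → EReal) → Prop}
    (hP : ∀ st, Sampled ρ M i Q st → P (arcBoundedToMonotone B M st.2 st.1)) :
    failProb (longShortcuts κ B M) P ≤ failProb (computeFunnels κ M) (FunnelsComplete M) +
      failProb (sample V (longRate κ V i)) Q := by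
  unfold longShortcuts
  refine failProb_bind_le _ _ _ _ _ fun D hD hF => ?_
  refine (failProb_bind_le _ _ (Sampled ρ M i Q) _ 0 fun st _ hst => ?_).trans
    ((add_zero _).le.trans (longLoop_prob hB hM κ _ hi hi'
      (soundTables_of_mem_computeFunnels hB hM κ hD) hF))
  rw [failProb_pure, failInd_of (hP st hst)]

/-- There are at most `n ^ 2` intervals, and each relevant one offers `g` distinct vertices because
the path is simple. -/
lemma hits_prob {p : ℕ → V} {A : Finset ℕ} {l g : ℕ} {ps : ℝ} (hps : 0 ≤ ps) (hg : 0 < g)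
    (hinj : ∀ i j, i < j → j ≤ l → p i ≠ p j) (hl : l < Fintype.card V) :
    failProb (sample V ps) (fun S => Hits S p A l g) ≤
      ENNReal.ofReal ((Fintype.card V : ℝ) ^ 2 * Real.exp (-(ps * g))) := by
  set n := Fintype.card V
  set I := (Finset.range n ×ˢ Finset.range n).filter fun ab : ℕ × ℕ =>
    ab.2 ≤ l ∧ g ≤ (A.filter fun j => ab.1 ≤ j ∧ j < ab.2).card with hI
  have hmono : failProb (sample V ps) (fun S => Hits S p A l g) ≤ failProb (sample V ps)
      (fun S => ∀ ab ∈ I, ∃ v ∈ (A.filter fun j => ab.1 ≤ j ∧ j < ab.2).image p, v ∈ S) := by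
    refine failProb_mono _ fun S _ hS a b hb hab => ?_
    have hne : (A.filter fun j => a ≤ j ∧ j < b).Nonempty := Finset.card_pos.1 (by omega)
    obtain ⟨j, hj⟩ := hne
    have hj' := (Finset.mem_filter.1 hj).2
    obtain ⟨v, hv, hvS⟩ := hS (a, b) (Finset.mem_filter.2 ⟨Finset.mem_product.2
      ⟨Finset.mem_range.2 (by omega), Finset.mem_range.2 (by omega)⟩, hb, hab⟩)
    obtain ⟨j, hj, rfl⟩ := Finset.mem_image.1 hv
    obtain ⟨h1, h2, h3⟩ := Finset.mem_filter.1 hj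
    exact ⟨j, h1, h2, h3, hvS⟩
  refine hmono.trans ((failProb_forall_le I _ _).trans ?_)
  refine (Finset.sum_le_card_nsmul I _ (ENNReal.ofReal (Real.exp (-(ps * g)))) ?_).trans ?_
  · rintro ⟨a, b⟩ hab
    obtain ⟨-, hb, hg'⟩ := Finset.mem_filter.1 hab
    refine (sample_miss _ _).trans (ENNReal.ofReal_le_ofReal (Real.exp_le_exp.2 ?_))
    rw [Finset.card_image_of_injOn]
    · have : (g : ℝ) ≤ ((A.filter fun j => a ≤ j ∧ j < b).card : ℝ) := by exact_mod_cast hg'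
      have := mul_le_mul_of_nonneg_left this hps
      linarith
    · intro i hi j hj hij
      have hi' := (Finset.mem_filter.1 hi).2
      have hj' := (Finset.mem_filter.1 hj).2
      dsimp only at hb hi' hj'
      by_contra hne
      rcases Nat.lt_or_gt_of_ne hne with h | h
      · exact hinj i j h (by omega) hij
      · exact hinj j i h (by omega) hij.symm
  · rw [nsmul_eq_mul, ENNReal.ofReal_mul (by positivity)]
    refine mul_le_mul' ?_ le_rfl
    rw [← ENNReal.ofReal_natCast]
    refine ENNReal.ofReal_le_ofReal ?_
    have : I.card ≤ n ^ 2 := by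
      refine (Finset.card_filter_le _ _).trans ?_
      rw [Finset.card_product, Finset.card_range, sq]
    exact_mod_cast this

/-- One choice of class and direction. -/
lemma longShortcuts_prob_class (hB : 0 ≤ B) (hM : SoundTable ρ M) (κ : HiddenConstants)
    {p : ℕ → V} {q : ℕ → ℝ} {a b : ℝ} {l : ℕ} (hq : LevelPath M p q a b l) (hab : |a - b| ≤ B)
    {r : ℕ → ℝ} (hW : Walk M p r 0 l) (hqr : ∀ i < l, q (i + 1) - q i ≤ r (i + 1) - r i)
    (hl : l < Fintype.card V) {i g : ℕ} {s : ℝ} {r' : ℕ → ℝ} (hr' : r' = r ∨ r' = revLevel r l)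
    (hi : 1 ≤ i)
    (hi' : i < 1 + ⌈Real.logb 2 ((Fintype.card V : ℝ) ^ (1 / 2 : ℝ) * logn V ^ 2)⌉₊)
    (hL : 2 < 2 ^ i * s) (hg0 : 0 < g) (hg : g ≤ ⌈2 ^ i * s⌉₊) (hrate : 0 ≤ longRate κ V i) :
    failProb (longShortcuts κ B M) (fun L => ∃ k, PathIn L a b (p 0) (p l) k ∧
      6 * k + (classArcs r' l s i).card ≤ 6 * l + g) ≤
      failProb (computeFunnels κ M) (FunnelsComplete M) +
      ENNReal.ofReal ((Fintype.card V : ℝ) ^ 2 * Real.exp (-(longRate κ V i * g))) := by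
  have hbase : ∀ {st : Tables V × Finset V}, SoundTables ρ M st.1 →
      M ≤ arcBoundedToMonotone B M st.2 st.1 := by
    intro st hst x y
    rw [arcBoundedToMonotone_eq, hst.mono]
    exact le_max_left _ _
  rcases hr' with rfl | rfl
  · refine (longShortcuts_prob_of_sampled hB hM κ hi hi'
      (Q := fun S => Hits S p (classArcs r' l s i) l g) ?_).trans
      (add_le_add_right (hits_prob hrate hg0 hq.inj hl) _)
    rintro st ⟨D, T, hD, hF, hH, hT, hst, h1, -⟩
    refine long_savings_forward hB hM hq hab hW hqr hD hF hT (fun u v x => (hst.first u v x).1) h1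
      (hbase hst) (fun x y => ?_) hL hg hH
    rw [arcBoundedToMonotone_eq]
    exact (le_max_left _ _).trans (le_max_right _ _)
  · refine (longShortcuts_prob_of_sampled hB hM κ hi hi'
      (Q := fun S => Hits S (fun i => p (l - i)) (classArcs (revLevel r l) l s i) l g) ?_).trans
      (add_le_add_right (hits_prob hrate hg0 hq.reverse.inj hl) _)
    rintro st ⟨D, T, hD, hF, hH, hT, hst, -, h1⟩
    have hqr' : ∀ i < l, revLevel q l (i + 1) - revLevel q l i
        ≤ revLevel r l (i + 1) - revLevel r l i := by
      intro i hi
      have := hqr (l - (i + 1)) (by omega)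
      rw [show l - (i + 1) + 1 = l - i by omega] at this
      simp only [revLevel]
      linarith
    have h1' : ((longRound (tr M) T)^[2 ^ i] D.swap).first ≤ st.1.swap.first := by
      rw [iterate_swap (longRound_swap M T)]
      exact fun u v x => h1 x v u
    have hN : arcForward B (tr M) st.2 st.1.swap.first
        ≤ tr (arcBoundedToMonotone B M st.2 st.1) := by
      intro x y
      simp only [tr]
      rw [arcBoundedToMonotone_eq]
      exact (le_max_right _ _).trans (le_max_right _ _)
    obtain ⟨k, hk, hc⟩ := long_savings_forward (N := tr (arcBoundedToMonotone B M st.2 st.1)) hB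
      (hM.transpose hB) hq.reverse
      (by rwa [show -b - -a = a - b by ring]) hW.reverse hqr' hD.swap hF.swap hT
      (F := st.1.swap.first) (fun u v x => (hst.swap.first u v x).1) h1'
      (fun x y => hbase hst y x) hN hL hg hH
    refine ⟨k, ?_, hc⟩
    have := hk.reverse
    simpa using this

end LongShortcuts

/-! ### Long shortcuts succeed with probability at least one half -/

section LongProbability

variable {V : Type u} [Fintype V] {B : ℝ} {ρ : ChargeRel V B} {M N : V → V → EReal}

/-- The square root of the number of vertices. -/
def sqrtn (V : Type u) [Fintype V] : ℝ := (Fintype.card V : ℝ) ^ (1 / 2 : ℝ)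

lemma sqrtn_mul_self : sqrtn V * sqrtn V = Fintype.card V := by
  unfold sqrtn
  rw [← Real.rpow_add' (by positivity) (by norm_num)]
  norm_num

lemma one_lt_sqrtn (h : 2 ≤ Fintype.card V) : 1 < sqrtn V :=
  Real.one_lt_rpow (by exact_mod_cast h) (by norm_num)

lemma logn_eq (h : 2 ≤ Fintype.card V) : logn V = 2 * Real.logb 2 (sqrtn V) := by
  have := one_lt_sqrtn h
  unfold logn
  rw [← sqrtn_mul_self, Real.logb_mul (by linarith) (by linarith)]
  ring

lemma logb_two_le {s : ℝ} (hs : 1 ≤ s) : Real.logb 2 s ≤ s := by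
  rw [Real.logb_le_iff_le_rpow (by norm_num) (by linarith)]
  have := one_add_mul_self_le_rpow_one_add (show (-1 : ℝ) ≤ 1 by norm_num) hs
  norm_num at this
  linarith

lemma natCast_le_logb {s : ℝ} {i : ℕ} (hs : 1 ≤ s) (h : (2 : ℝ) ^ i ≤ s) : (i : ℝ) ≤ Real.logb 2 s := by
  rw [Real.le_logb_iff_rpow_le (by norm_num) (by linarith), Real.rpow_natCast]
  exact h

lemma rpow_le_eighth {n : ℝ} (hn : 2 ≤ n) {e : ℝ} (he : e ≤ -3) : n ^ e ≤ 1 / 8 := by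
  calc n ^ e ≤ n ^ (-3 : ℝ) := Real.rpow_le_rpow_of_exponent_le (by linarith) he
    _ ≤ 2 ^ (-3 : ℝ) := Real.rpow_le_rpow_of_nonpos (by norm_num) hn (by norm_num)
    _ = 1 / 8 := by
      rw [Real.rpow_neg (by norm_num), show (3 : ℝ) = ((3 : ℕ) : ℝ) by norm_num, Real.rpow_natCast]
      norm_num

/-- Long shortcuts shorten a level path with few defects. -/
lemma longShortcuts_prob (hB : 0 ≤ B) (hM : SoundTable ρ M) (κ : HiddenConstants)
    (hκ : κ.cFunnel = 1) (hκl : 100 ≤ κ.cLong) (hκs : 30 ≤ κ.cSample) (hn : 2 ≤ Fintype.card V)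
    {p : ℕ → V} {q : ℕ → ℝ} {a b : ℝ} {l : ℕ} (hq : LevelPath M p q a b l) (hab : |a - b| ≤ B)
    {r : ℕ → ℝ} (hW : Walk M p r 0 l) (hqr : ∀ i < l, q (i + 1) - q i ≤ r (i + 1) - r i)
    (hl : l < Fintype.card V) (hX : 100 * sqrtn V * ((defects r l).card + 2) ≤ l) :
    failProb (longShortcuts κ B M) (fun L => ∃ k : ℕ, PathIn L a b (p 0) (p l) k ∧
      (k : ℝ) ≤ l - l / (180 * logn V)) ≤ 1 / 2 := by
  have hs := one_lt_sqrtn hn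
  have hlog := one_le_logn hn
  have hlog2 : logn V ≤ 2 * sqrtn V := by
    rw [logn_eq hn]
    have := logb_two_le hs.le
    linarith
  have hn2 : (2 : ℝ) ≤ Fintype.card V := by exact_mod_cast hn
  have hls : (l : ℝ) ≤ sqrtn V * sqrtn V := by
    rw [sqrtn_mul_self]; exact_mod_cast hl.le
  have hlb : 200 * sqrtn V ≤ l := by
    refine le_trans ?_ hX
    have : (0 : ℝ) ≤ (defects r l).card := Nat.cast_nonneg _
    nlinarith
  have hl0 : 0 < l := by
    have : (0 : ℝ) < l := by linarith
    exact_mod_cast this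
  have hci : ∀ i : ℕ, (2 : ℝ) ^ i ≤ sqrtn V → (i : ℝ) ≤ logn V := fun i hi => by
    have h1 := natCast_le_logb hs.le hi
    have h2 : 0 ≤ Real.logb 2 (sqrtn V) := Real.logb_nonneg (by norm_num) hs.le
    rw [logn_eq hn]
    linarith
  obtain ⟨r', hr', hg⟩ : ∃ r', (r' = r ∨ r' = revLevel r l) ∧
      (l : ℝ) ≤ 10 * (goodArcs r' l (sqrtn V)).card := by
    rcases card_goodArcs hs.le hX with h | h
    · exact ⟨r, Or.inl rfl, h⟩
    · exact ⟨_, Or.inr rfl, h⟩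
  obtain ⟨i, hi1, hi2, hA⟩ := exists_large_class hs.le hls hci hl0 hg
  have hAne : (classArcs r' l (sqrtn V) i).Nonempty := by
    by_contra h
    rw [Finset.not_nonempty_iff_eq_empty] at h
    rw [h] at hA
    simp at hA
    omega
  have hLl : 2 ^ i * sqrtn V ≤ l := by
    obtain ⟨j, hj⟩ := hAne
    obtain ⟨t, hE, h1, -⟩ := (Finset.mem_filter.1 hj).2
    have : (t : ℝ) ≤ l := by exact_mod_cast hE.le
    linarith [(Nat.cast_nonneg j : (0 : ℝ) ≤ j)]
  have hL2 : 2 < 2 ^ i * sqrtn V := by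
    have : (2 : ℝ) ≤ 2 ^ i := by
      calc (2 : ℝ) = 2 ^ 1 := by norm_num
        _ ≤ 2 ^ i := pow_le_pow_right₀ (by norm_num) hi1
    nlinarith
  set A := (classArcs r' l (sqrtn V) i).card with hAdef
  have hA10 : (10 : ℝ) ≤ A := by
    by_contra h
    push Not at h
    have : 10 * logn V * A < 10 * (2 * sqrtn V) * 10 := by
      have h1 : 10 * logn V * A ≤ 10 * (2 * sqrtn V) * A :=
        mul_le_mul_of_nonneg_right (by linarith) (Nat.cast_nonneg _)
      have h2 : 10 * (2 * sqrtn V) * A < 10 * (2 * sqrtn V) * 10 :=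
        mul_lt_mul_of_pos_left h (by linarith)
      linarith
    linarith
  have hA10' : 10 ≤ A := by exact_mod_cast hA10
  -- The second bound makes each jump skip at least `g` arcs. The first gives `3 g ≤ 2 A`, so at
  -- least `A / 18 ≥ l / (180 log n)` arcs are saved.
  set g := min ((A + 1) / 2) ⌈2 ^ i * sqrtn V⌉₊ with hgdef
  have hg0 : 0 < g := lt_min (by omega) (Nat.ceil_pos.2 (by linarith))
  have hrate : longRate κ V i = κ.cLong * logn V ^ 2 / (2 ^ i * sqrtn V) := rfl
  have hrate0 : 0 ≤ longRate κ V i := by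
    rw [hrate]
    have := κ.cLong_pos
    positivity
  have hi' : i < 1 + ⌈Real.logb 2 ((Fintype.card V : ℝ) ^ (1 / 2 : ℝ) * logn V ^ 2)⌉₊ := by
    have h1 : (2 : ℝ) ^ i ≤ (Fintype.card V : ℝ) ^ (1 / 2 : ℝ) * logn V ^ 2 := by
      refine hi2.trans ?_
      change sqrtn V ≤ sqrtn V * logn V ^ 2
      nlinarith [one_le_pow₀ hlog (n := 2)]
    have h2 := (natCast_le_logb ((one_le_pow₀ (by norm_num)).trans h1) h1).trans (Nat.le_ceil _)
    have h3 : i ≤ _ := Nat.cast_le.1 h2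
    omega
  -- Since `A ≥ l / (10 log n)` and `l ≥ 2 ^ i √n`, the value `cLong ≥ 100` makes the rate times `A
  -- / 2` at least `5 log n`.
  have hexp : 5 * logn V ≤ longRate κ V i * g := by
    rw [hrate, div_mul_eq_mul_div, le_div_iff₀ (by linarith)]
    rcases min_choice ((A + 1) / 2) ⌈2 ^ i * sqrtn V⌉₊ with h | h
    · rw [hgdef, h]
      have h1 : (A : ℝ) / 2 ≤ ((A + 1) / 2 : ℕ) := by
        have : A ≤ 2 * ((A + 1) / 2) := by omega
        have : (A : ℝ) ≤ 2 * ((A + 1) / 2 : ℕ) := by exact_mod_cast this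
        linarith
      calc 5 * logn V * (2 ^ i * sqrtn V) ≤ 5 * logn V * (10 * logn V * A) := by
            refine mul_le_mul_of_nonneg_left (hLl.trans hA) (by linarith)
        _ = 100 * logn V ^ 2 * (A / 2) := by ring
        _ ≤ κ.cLong * logn V ^ 2 * ((A + 1) / 2 : ℕ) := by
            refine mul_le_mul ?_ h1 (div_nonneg (Nat.cast_nonneg _) (by norm_num)) (by have := κ.cLong_pos; positivity)
            exact mul_le_mul_of_nonneg_right hκl (by positivity)
    · rw [hgdef, h]
      have h1 := Nat.le_ceil (2 ^ i * sqrtn V)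
      calc 5 * logn V * (2 ^ i * sqrtn V) ≤ κ.cLong * logn V ^ 2 * (2 ^ i * sqrtn V) := by
            refine mul_le_mul_of_nonneg_right ?_ (by linarith)
            nlinarith
        _ ≤ _ := mul_le_mul_of_nonneg_left h1 (by have := κ.cLong_pos; positivity)
  have hmain := longShortcuts_prob_class hB hM κ hq hab hW hqr hl hr' hi1 hi' hL2 hg0
    (min_le_right _ _) hrate0
  have hmono : failProb (longShortcuts κ B M) (fun L => ∃ k : ℕ, PathIn L a b (p 0) (p l) k ∧
      (k : ℝ) ≤ l - l / (180 * logn V)) ≤ failProb (longShortcuts κ B M)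
      (fun L => ∃ k, PathIn L a b (p 0) (p l) k ∧ 6 * k + A ≤ 6 * l + g) := by
    refine failProb_mono _ fun L _ => ?_
    rintro ⟨k, hk, hc⟩
    refine ⟨k, hk, ?_⟩
    have h1 : g ≤ (A + 1) / 2 := min_le_left _ _
    have h2 : 18 * k + A ≤ 18 * l := by omega
    have h3 : 18 * (k : ℝ) + A ≤ 18 * l := by exact_mod_cast h2
    have h4 : (l : ℝ) / (180 * logn V) ≤ A / 18 := by
      rw [div_le_div_iff₀ (by linarith) (by norm_num)]
      linarith
    linarith
  refine hmono.trans (hmain.trans ((add_le_add (computeFunnels_prob κ hκ M hn) le_rfl).trans ?_))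
  rw [← ENNReal.ofReal_add (by positivity) (by positivity)]
  -- Incomplete funnels and missed intervals each have probability at most `n ^ (-3) ≤ 1 / 8`.
  have e1 : (Fintype.card V : ℝ) ^ (7 - κ.cSample / 3) ≤ 1 / 8 :=
    rpow_le_eighth hn2 (by linarith)
  have e2 : (Fintype.card V : ℝ) ^ 2 * Real.exp (-(longRate κ V i * g)) ≤ 1 / 8 := by
    calc _ ≤ (Fintype.card V : ℝ) ^ 2 * (Fintype.card V : ℝ) ^ (-5 : ℝ) := by
          refine mul_le_mul_of_nonneg_left ?_ (by positivity)
          exact (Real.exp_le_exp.2 (by linarith)).trans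
            (exp_neg_mul_logn_le (by omega) (a := 5) (by norm_num))
      _ = (Fintype.card V : ℝ) ^ (-3 : ℝ) := by
          rw [← Real.rpow_natCast, ← Real.rpow_add (by linarith)]
          norm_num
      _ ≤ _ := rpow_le_eighth hn2 le_rfl
  calc ENNReal.ofReal _ ≤ ENNReal.ofReal (1 / 2) := ENNReal.ofReal_le_ofReal (by linarith)
    _ = 1 / 2 := by rw [ENNReal.ofReal_div_of_pos (by norm_num)]; simp

end LongProbability

/-! ### The probability of useful updates -/

section Update

variable {V : Type u} [Fintype V] {B : ℝ} {ρ : ChargeRel V B} {M N : V → V → EReal}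

lemma mem_repeatRandom_inner (κ : HiddenConstants) (k : ℕ) :
    ∀ {A A' : V → V → EReal} {st : (V → V → EReal) × (V → V → EReal)},
    st ∈ (repeatRandom (innerIteration κ B) k (A, A')).support →
    st.1 = (shortShortcuts B)^[k] A ∧ A' ≤ st.2 := by
  induction k with
  | zero =>
    intro A A' st h
    rw [repeatRandom, PMF.mem_support_pure_iff] at h
    subst h
    exact ⟨rfl, le_rfl⟩
  | succ k ih =>
    intro A A' st h
    rw [repeatRandom, PMF.mem_support_bind_iff] at h
    obtain ⟨st', h', h⟩ := h
    rw [innerIteration, PMF.mem_support_bind_iff] at h'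
    obtain ⟨c, -, h'⟩ := h'
    rw [Function.iterate_succ_apply]
    split_ifs at h' with hc
    · rw [PMF.mem_support_bind_iff] at h'
      obtain ⟨L, -, h'⟩ := h'
      rw [PMF.mem_support_pure_iff] at h'
      subst h'
      have := ih h
      exact ⟨this.1, le_sup_left.trans this.2⟩
    · rw [PMF.mem_support_pure_iff] at h'
      subst h'
      exact ih h

lemma le_of_mem_updateShortcuts (κ : HiddenConstants)
    (h : N ∈ (updateShortcuts κ B M).support) :
    (shortShortcuts B)^[innerRounds κ V] M ≤ N ∧ M ≤ N := by
  rw [updateShortcuts, PMF.mem_support_bind_iff] at h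
  obtain ⟨st, hst, h⟩ := h
  rw [PMF.mem_support_pure_iff] at h
  have := mem_repeatRandom_inner κ _ hst
  rw [h]
  exact ⟨this.1 ▸ le_sup_left, this.2.trans le_sup_right⟩

/-- Indicates that long shortcuts are likely to have the property `P`. -/
def useful (κ : HiddenConstants) (B : ℝ) (P : (V → V → EReal) → Prop) (M : V → V → EReal) : ℕ :=
  if failProb (longShortcuts κ B M) P ≤ 1 / 2 then 1 else 0

/-- The first component evolves deterministically, so it is fixed in advance which iterations are
useful. In each of them the coin and the long shortcuts succeed together with probability at least
`η`, given any past; a success persists because `P` is upward closed and the second component only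
grows. -/
lemma repeatRandom_inner_prob (κ : HiddenConstants) {P : (V → V → EReal) → Prop}
    (hP : ∀ {L L'}, L ≤ L' → P L → P L') {η : ℝ} (hη1 : η ≤ 1)
    (hcoin : 2 * η ≤ max 0 (min (logn V / innerRounds κ V) 1)) (k : ℕ) :
    ∀ A A' : V → V → EReal,
    failProb (repeatRandom (innerIteration κ B) k (A, A')) (fun st => P st.2) ≤
      ENNReal.ofReal ((1 - η) ^ (∑ j ∈ Finset.range k,
        useful κ B P ((shortShortcuts B)^[j] A))) := by
  induction k with
  | zero => intro A A'; simpa using failProb_le_one _ _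
  | succ k ih =>
    intro A A'
    rw [Finset.sum_range_succ', repeatRandom, failProb_bind, innerIteration, expect_bind,
      expect_coin, if_pos rfl, if_neg (by simp), expect_bind, expect_pure]
    simp only [expect_pure, Function.iterate_succ_apply, Function.iterate_zero, id]
    set c := ∑ j ∈ Finset.range k, useful κ B P ((shortShortcuts B)^[j] (shortShortcuts B A))
      with hc
    set pc := max 0 (min (logn V / innerRounds κ V) 1) with hpc
    have hpc0 : 0 ≤ pc := le_max_left _ _
    have hpc1 : pc ≤ 1 := max_le zero_le_one (min_le_right _ _)
    have hε0 : 0 ≤ (1 - η) ^ c := pow_nonneg (by linarith) _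
    have h2 := ih (shortShortcuts B A) A'
    have h1 : expect (longShortcuts κ B A) (fun L => failProb (repeatRandom (innerIteration κ B) k
        (shortShortcuts B A, A' ⊔ L)) fun st => P st.2) ≤
        ENNReal.ofReal ((1 - η) ^ c) * failProb (longShortcuts κ B A) P := by
      unfold failProb
      rw [← expect_mul_left]
      refine expect_mono _ fun L => ?_
      by_cases hL : P L
      · refine (failProb_eq_zero (P := fun st : (V → V → EReal) × (V → V → EReal) => P st.2) _ fun st hst => ?_).le.trans zero_le
        exact hP (le_sup_right.trans (mem_repeatRandom_inner κ k hst).2) hL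
      · rw [failInd_of_not hL, mul_one]
        exact ih (shortShortcuts B A) (A' ⊔ L)
    unfold useful
    split_ifs with hg
    · calc _ ≤ ENNReal.ofReal pc * (ENNReal.ofReal ((1 - η) ^ c) * (1 / 2)) +
            ENNReal.ofReal (1 - pc) * ENNReal.ofReal ((1 - η) ^ c) :=
          add_le_add (mul_le_mul' le_rfl (h1.trans (mul_le_mul' le_rfl hg))) (mul_le_mul' le_rfl h2)
        _ = ENNReal.ofReal (pc * ((1 - η) ^ c * (1 / 2)) + (1 - pc) * (1 - η) ^ c) := by
          rw [ENNReal.ofReal_add (by positivity) (mul_nonneg (by linarith) hε0),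
            ENNReal.ofReal_mul hpc0, ENNReal.ofReal_mul hε0, ENNReal.ofReal_mul (by linarith),
            ENNReal.ofReal_div_of_pos (by norm_num)]
          simp
        _ ≤ _ := by
          refine ENNReal.ofReal_le_ofReal ?_
          rw [pow_succ]
          nlinarith
    · calc _ ≤ ENNReal.ofReal pc * ENNReal.ofReal ((1 - η) ^ c) +
            ENNReal.ofReal (1 - pc) * ENNReal.ofReal ((1 - η) ^ c) :=
          add_le_add (mul_le_mul' le_rfl (h1.trans ((mul_le_mul' le_rfl
            (failProb_le_one _ _)).trans (mul_one _).le))) (mul_le_mul' le_rfl h2)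
        _ = _ := by
          rw [← add_mul, ← ENNReal.ofReal_add hpc0 (by linarith)]
          simp

/-- The least number of arcs of a level path. -/
def pathLen (M : V → V → EReal) (a b : ℝ) (x z : V) : ℕ := sInf {k | PathIn M a b x z k}

lemma pathIn_pathLen {a b : ℝ} {x z : V} {k : ℕ} (h : PathIn M a b x z k) :
    PathIn M a b x z (pathLen M a b x z) := Nat.sInf_mem (s := {k | PathIn M a b x z k}) ⟨k, h⟩

lemma pathLen_le {a b : ℝ} {x z : V} {k : ℕ} (h : PathIn M a b x z k) :
    pathLen M a b x z ≤ k := Nat.sInf_le h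

lemma LevelPath.lt_card {p : ℕ → V} {q : ℕ → ℝ} {a b : ℝ} {l : ℕ} (h : LevelPath M p q a b l) :
    l < Fintype.card V := by
  have : (Finset.range (l + 1)).card ≤ (Finset.univ : Finset V).card :=
    Finset.card_le_card_of_injOn p (fun _ _ => Finset.mem_univ _) fun i hi j hj hij => by
      rw [Finset.mem_coe, Finset.mem_range] at hi hj
      by_contra hne
      rcases Nat.lt_or_gt_of_ne hne with h' | h'
      · exact h.inj i j h' (by omega) hij
      · exact h.inj j i h' (by omega) hij.symm
  rw [Finset.card_range, Finset.card_univ] at this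
  omega

lemma soundTable_iterate_short (hB : 0 ≤ B) (hM : SoundTable ρ M) (k : ℕ) :
    SoundTable ρ ((ElectricCar.shortShortcuts B)^[k] M) :=
  iterate_invariant (f := shortShortcuts B) (I := SoundTable ρ) (fun _ h => h.shortShortcuts hB) k M hM

lemma le_iterate_short (k : ℕ) : M ≤ (shortShortcuts B)^[k] M :=
  iterate_invariant (f := shortShortcuts B) (I := fun N => M ≤ N)
    (fun _ h => h.trans le_shortShortcuts) k M le_rfl

/-- If long shortcuts are not useful, then short shortcuts are. -/
lemma short_progress (hB : 0 ≤ B) (hM : SoundTable ρ M) (κ : HiddenConstants)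
    (hκ : κ.cFunnel = 1) (hκl : 100 ≤ κ.cLong) (hκs : 30 ≤ κ.cSample) (hn : 2 ≤ Fintype.card V)
    {a b : ℝ} {x z : V} {m l : ℕ} (h : PathIn M a b x z m) (hab : |a - b| ≤ B) (hm : 2 ≤ m)
    (hml : m ≤ l)
    (hbad : ¬ failProb (longShortcuts κ B M) (fun L => ∃ k : ℕ, PathIn L a b x z k ∧
      (k : ℝ) ≤ l - l / (180 * logn V)) ≤ 1 / 2) :
    (m : ℝ) + 100 * sqrtn V * (3 * (3 * pathLen (shortShortcuts B M) a b x z))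
      ≤ 100 * sqrtn V * (3 * (3 * m)) := by
  obtain ⟨p, q, hq, rfl, rfl⟩ := h
  have hs := one_lt_sqrtn hn
  have hlog := one_le_logn hn
  obtain ⟨r, hW, hqr⟩ := hq.exists_walk hM
  obtain ⟨k, hk, hc⟩ := hq.short (B := B)
  have hpos := hq.contractions_pos hm hab
  have hsub : (defects r m).card ≤ (contractions (shortShortcuts B M) p q m).card := by
    refine Finset.card_le_card fun i hi => Finset.mem_filter.2 ⟨(Finset.mem_filter.1 hi).1, ?_⟩
    refine contractible_of_defect hB (fun i hi => (hW i (Nat.zero_le _) hi).ge) hqr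
      (fun i j hi hj => hq.diff_le hab hi hj) (mem_defects.1 hi)
  -- Few defects would make long shortcuts useful. The saving on `m` arcs gives the required bound
  -- for `l ≥ m`, since `x - x / (180 log n)` increases with `x`.
  have hX : ¬ 100 * sqrtn V * ((defects r m).card + 2) ≤ m := by
    intro hX
    refine hbad ((failProb_mono _ fun L _ => ?_).trans
      (longShortcuts_prob hB hM κ hκ hκl hκs hn hq hab hW hqr hq.lt_card hX))
    rintro ⟨k, hk, hc⟩
    refine ⟨k, hk, hc.trans ?_⟩
    have h1 : (m : ℝ) ≤ l := by exact_mod_cast hml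
    have h2 : ((l : ℝ) - m) / (180 * logn V) ≤ l - m :=
      div_le_self (by linarith) (by linarith)
    rw [sub_div] at h2
    linarith
  push Not at hX
  -- A round satisfies `3 k + contractions ≤ 3 m`. There is at least one contraction and there are
  -- at least as many as defects, so three times their number is at least `defects + 2`; hence the
  -- factor `9`.
  have h1 : 3 * (3 * pathLen (shortShortcuts B M) a b (p 0) (p m)) + ((defects r m).card + 2)
      ≤ 3 * (3 * m) := by
    have := pathLen_le hk
    omega
  have h2 : 3 * (3 * (pathLen (shortShortcuts B M) a b (p 0) (p m) : ℝ)) +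
      (((defects r m).card : ℝ) + 2) ≤ 3 * (3 * m) := by exact_mod_cast h1
  have := mul_le_mul_of_nonneg_left h2 (show 0 ≤ 100 * sqrtn V by linarith)
  linarith

/-- If short shortcuts alone do not achieve the saving, the length stays at least `l / 2`
throughout. Every useless iteration then removes at least `l / (1800 √n)` arcs, so among the `R ≥
3600 √n` iterations at least half are useful. All of them fail with probability at most `(1 - 1 / (2
R)) ^ (R / 2) ≤ exp (-1 / 4) ≤ 4 / 5`. -/
lemma updateShortcuts_prob (hB : 0 ≤ B) (hM : SoundTable ρ M) (κ : HiddenConstants)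
    (hκ : κ.cFunnel = 1) (hκl : 100 ≤ κ.cLong) (hκs : 30 ≤ κ.cSample) (hκi : 3600 ≤ κ.cInner)
    (hn : 2 ≤ Fintype.card V) {a b : ℝ} {x z : V} {l : ℕ} (h : PathIn M a b x z l)
    (hab : |a - b| ≤ B) :
    failProb (updateShortcuts κ B M) (fun N => ∃ k : ℕ, PathIn N a b x z k ∧
      (k ≤ 1 ∨ (k : ℝ) ≤ l - l / (180 * logn V))) ≤ ENNReal.ofReal (4 / 5) := by
  have hs := one_lt_sqrtn hn
  have hlog := one_le_logn hn
  set R := innerRounds κ V with hR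
  set m : ℕ → ℕ := fun τ => pathLen ((shortShortcuts B)^[τ] M) a b x z with hmdef
  have hpath : ∀ τ, PathIn ((shortShortcuts B)^[τ] M) a b x z (m τ) := fun τ =>
    pathIn_pathLen (h.mono (le_iterate_short τ))
  by_cases hA : m R ≤ 1 ∨ (m R : ℝ) ≤ l - l / (180 * logn V)
  · refine (failProb_eq_zero _ fun N hN => ?_).le.trans zero_le
    exact ⟨m R, (hpath R).mono (le_of_mem_updateShortcuts κ hN).1, hA⟩
  push Not at hA
  have hanti : ∀ τ, m (τ + 1) ≤ m τ := fun τ => pathLen_le ((hpath τ).mono (by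
    rw [Function.iterate_succ_apply']
    exact le_shortShortcuts))
  have hanti' : Antitone m := antitone_nat_of_succ_le hanti
  have hm0 : m 0 ≤ l := pathLen_le h
  have hl2 : (l : ℝ) / 2 ≤ m R := by
    have : (l : ℝ) / (180 * logn V) ≤ l / 2 :=
      div_le_div_of_nonneg_left (Nat.cast_nonneg _) (by norm_num) (by linarith)
    linarith
  have hR1 : 3600 * sqrtn V ≤ R := by
    refine le_trans ?_ (Nat.le_ceil _)
    exact mul_le_mul_of_nonneg_right hκi (by linarith)
  have hR0 : (0 : ℝ) < R := by linarith
  set P : (V → V → EReal) → Prop := fun L => ∃ k : ℕ, PathIn L a b x z k ∧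
      (k : ℝ) ≤ l - l / (180 * logn V) with hP
  set χ : ℕ → ℕ := fun j => useful κ B P ((shortShortcuts B)^[j] M) with hχ
  have hprog : ∀ τ ∈ Finset.range R, (1 - χ τ : ℝ) * (l / 2) ≤
      900 * sqrtn V * ((m τ : ℝ) - m (τ + 1)) := by
    intro τ hτ
    rw [Finset.mem_range] at hτ
    simp only [hχ, useful]
    split_ifs with hg
    · have : (m (τ + 1) : ℝ) ≤ m τ := by exact_mod_cast hanti τ
      have : 0 ≤ 900 * sqrtn V * ((m τ : ℝ) - m (τ + 1)) :=
        mul_nonneg (by linarith) (by linarith)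
      simpa using this
    · have h1 : m R ≤ m τ := hanti' hτ.le
      have h1' : (m R : ℝ) ≤ m τ := by exact_mod_cast h1
      have := short_progress hB (soundTable_iterate_short hB hM τ) κ hκ hκl hκs hn (hpath τ) hab (by omega)
        ((hanti' (Nat.zero_le τ)).trans hm0) hg
      rw [← Function.iterate_succ_apply' (shortShortcuts B)] at this
      change (m τ : ℝ) + 100 * sqrtn V * (3 * (3 * (m (τ + 1) : ℝ))) ≤ _ at this
      simp only [Nat.cast_zero, sub_zero, one_mul]
      linarith
  have hsum := Finset.sum_le_sum hprog
  rw [← Finset.sum_mul, ← Finset.mul_sum, Finset.sum_range_sub', Finset.sum_sub_distrib,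
    Finset.sum_const, Finset.card_range, nsmul_eq_mul, mul_one] at hsum
  have hm0' : (m 0 : ℝ) ≤ l := by exact_mod_cast hm0
  have hl0 : (0 : ℝ) < l := by
    have h1 := hanti' (Nat.zero_le R)
    have : 0 < l := by omega
    exact_mod_cast this
  have hcount : (R : ℝ) / 2 ≤ ((∑ j ∈ Finset.range R, χ j : ℕ) : ℝ) := by
    push_cast
    have h1 : 900 * sqrtn V * ((m 0 : ℝ) - m R) ≤ 900 * sqrtn V * (l / 2) :=
      mul_le_mul_of_nonneg_left (by linarith) (by linarith)
    have h2 := le_of_mul_le_mul_right (hsum.trans h1) (by positivity)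
    linarith
  have hη1 : 1 / (2 * (R : ℝ)) ≤ 1 := by
    rw [div_le_one (by linarith)]; linarith
  have hmain := repeatRandom_inner_prob (B := B) κ (P := P)
    (fun {L L'} hLL => fun ⟨k, hk, hc⟩ => ⟨k, hk.mono hLL, hc⟩)
    (η := 1 / (2 * (R : ℝ))) hη1 (by
      refine le_trans (le_min ?_ ?_) (le_max_right _ _)
      · rw [show 2 * (1 / (2 * (R : ℝ))) = 1 / R by field_simp]
        exact div_le_div_of_nonneg_right hlog hR0.le
      · rw [show 2 * (1 / (2 * (R : ℝ))) = 1 / R by field_simp, div_le_one hR0]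
        linarith) R M M
  unfold updateShortcuts
  rw [failProb_bind]
  simp only [failProb_pure]
  change failProb _ _ ≤ _
  refine (failProb_mono _ fun st _ hst => ?_).trans (hmain.trans (ENNReal.ofReal_le_ofReal ?_))
  · obtain ⟨k, hk, hc⟩ := hst
    exact ⟨k, hk.mono le_sup_right, Or.inr hc⟩
  · change (1 - 1 / (2 * (R : ℝ))) ^ (∑ j ∈ Finset.range R, χ j) ≤ 4 / 5
    calc (1 - 1 / (2 * (R : ℝ))) ^ (∑ j ∈ Finset.range R, χ j)
        ≤ Real.exp (-(1 / (2 * (R : ℝ)))) ^ (∑ j ∈ Finset.range R, χ j) := by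
          refine pow_le_pow_left₀ (by linarith) ?_ _
          have := Real.add_one_le_exp (-(1 / (2 * (R : ℝ))))
          linarith
      _ = Real.exp (((∑ j ∈ Finset.range R, χ j : ℕ) : ℝ) * -(1 / (2 * (R : ℝ)))) := by
          rw [Real.exp_nat_mul]
      _ ≤ Real.exp (-(1 / 4)) := by
          refine Real.exp_le_exp.2 ?_
          have h1 := mul_le_mul_of_nonneg_right hcount (show 0 ≤ 1 / (2 * (R : ℝ)) by positivity)
          rw [show (R : ℝ) / 2 * (1 / (2 * (R : ℝ))) = 1 / 4 by field_simp; norm_num] at h1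
          linarith
      _ ≤ 4 / 5 := by
          have := Real.add_one_le_exp (1 / 4 : ℝ)
          rw [Real.exp_neg, inv_le_comm₀ (Real.exp_pos _) (by norm_num)]
          norm_num at this ⊢
          exact this

end Update

/-! ### The shortcut table captures all monotone level paths -/

section Compute

variable {V : Type u} [Fintype V] {B : ℝ} {ρ : ChargeRel V B} {M N : V → V → EReal}

/-- The length of the shortest level path, or `0` if there is one with at most one arc. -/
def potential (a b : ℝ) (x z : V) (M : V → V → EReal) : ℝ≥0∞ :=
  if pathLen M a b x z ≤ 1 then 0 else (pathLen M a b x z : ℝ≥0∞)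

lemma potential_le {a b : ℝ} {x z : V} {k : ℕ} (h : PathIn M a b x z k) :
    potential a b x z M ≤ k := by
  unfold potential
  split_ifs
  · exact zero_le
  · exact_mod_cast pathLen_le h

/-- With probability at least `1 / 5` the length drops by `l / (180 log n)`, or to at most one arc,
where the potential vanishes; it never grows. A path must exist, because `pathLen` is `0` when there
is none. -/
lemma expect_potential_update (hB : 0 ≤ B) (hM : SoundTable ρ M) (κ : HiddenConstants)
    (hκ : κ.cFunnel = 1) (hκl : 100 ≤ κ.cLong) (hκs : 30 ≤ κ.cSample) (hκi : 3600 ≤ κ.cInner)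
    (hn : 2 ≤ Fintype.card V) {a b : ℝ} {x z : V} (h : ∃ l, PathIn M a b x z l)
    (hab : |a - b| ≤ B) :
    expect (updateShortcuts κ B M) (potential a b x z) ≤
      ENNReal.ofReal (1 - 1 / (900 * logn V)) * potential a b x z M := by
  obtain ⟨l', h⟩ := h
  have hl := pathIn_pathLen h
  have hlog := one_le_logn hn
  set l := pathLen M a b x z with hldef
  by_cases hl1 : l ≤ 1
  · refine le_trans ?_ zero_le
    rw [← expect_const (updateShortcuts κ B M) 0]
    refine expect_mono_support _ fun N hN => ?_
    unfold potential
    rw [if_pos ((pathLen_le (hl.mono (le_of_mem_updateShortcuts κ hN).2)).trans hl1)]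
  · have hx : (l : ℝ) / (180 * logn V) ≤ l :=
      div_le_self (Nat.cast_nonneg _) (by linarith)
    have hx0 : 0 ≤ (l : ℝ) / (180 * logn V) := by positivity
    have hprob := updateShortcuts_prob hB hM κ hκ hκl hκs hκi hn hl hab
    have hstep : expect (updateShortcuts κ B M) (potential a b x z) ≤
        ENNReal.ofReal (l - l / (180 * logn V)) + ENNReal.ofReal (l / (180 * logn V)) *
          ENNReal.ofReal (4 / 5) := by
      refine le_trans ?_ (add_le_add le_rfl (mul_le_mul' le_rfl hprob))
      unfold failProb
      rw [← expect_mul_left, ← expect_const (updateShortcuts κ B M)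
        (ENNReal.ofReal (l - l / (180 * logn V))), ← expect_add]
      refine expect_mono_support _ fun N hN => ?_
      by_cases hP : ∃ k : ℕ, PathIn N a b x z k ∧ (k ≤ 1 ∨ (k : ℝ) ≤ l - l / (180 * logn V))
      · refine le_trans ?_ le_self_add
        obtain ⟨k, hk, hc | hc⟩ := hP
        · unfold potential
          rw [if_pos ((pathLen_le hk).trans hc)]
          exact zero_le
        · refine (potential_le hk).trans ?_
          rw [← ENNReal.ofReal_natCast]
          exact ENNReal.ofReal_le_ofReal hc
      · rw [failInd_of_not hP, mul_one, ← ENNReal.ofReal_add (by linarith) hx0]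
        refine (potential_le (hl.mono (le_of_mem_updateShortcuts κ hN).2)).trans ?_
        simp
    refine hstep.trans (le_of_eq ?_)
    have hpot : potential a b x z M = ENNReal.ofReal l := by
      unfold potential
      rw [if_neg hl1, ENNReal.ofReal_natCast]
    have h9 : 1 / (900 * logn V) ≤ 1 := by
      rw [div_le_one (by linarith)]; linarith
    rw [hpot, ← ENNReal.ofReal_mul hx0, ← ENNReal.ofReal_add (by linarith) (by positivity),
      ← ENNReal.ofReal_mul (by linarith)]
    congr 1
    field_simp
    ring

lemma expect_repeatRandom {α : Type u} {f : α → PMF α} {I : α → Prop} {φ : α → ℝ≥0∞} {c : ℝ≥0∞}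
    (hI : ∀ a, I a → ∀ b ∈ (f a).support, I b) (hφ : ∀ a, I a → expect (f a) φ ≤ c * φ a)
    (k : ℕ) : ∀ a, I a → expect (repeatRandom f k a) φ ≤ c ^ k * φ a := by
  induction k with
  | zero => intro a _; rw [repeatRandom, expect_pure]; simp
  | succ k ih =>
    intro a ha
    rw [repeatRandom, expect_bind]
    calc _ ≤ expect (f a) (fun b => c ^ k * φ b) :=
          expect_mono_support _ fun b hb => ih b (hI a ha b hb)
      _ = c ^ k * expect (f a) φ := expect_mul_left _ _ _
      _ ≤ c ^ k * (c * φ a) := mul_le_mul' le_rfl (hφ a ha)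
      _ = _ := by rw [pow_succ, mul_assoc]

lemma le_of_mem_computeShortcuts (κ : HiddenConstants) {G : Digraph V} {g : V → V → ℝ}
    (h : M ∈ (computeShortcuts κ G g B).support) : initialShortcuts G g ≤ M :=
  repeatRandom_support (I := fun M => initialShortcuts G g ≤ M)
    (fun _ hM _ hL => hM.trans (le_of_mem_updateShortcuts κ hL).2) _ le_rfl h

lemma PathIn.le_entry {a b : ℝ} {x z : V} {k : ℕ} (h : PathIn M a b x z k) (hk : k ≤ 1)
    (h0 : 0 ≤ M x x) : ((b - a : ℝ) : EReal) ≤ M x z := by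
  obtain ⟨p, q, h, rfl, rfl⟩ := h
  rcases (show k = 0 ∨ k = 1 by omega) with rfl | rfl
  · rw [← h.start, ← h.final, sub_self]
    exact h0
  · have := h.arc 0 (by omega)
    rwa [h.start, show q (0 + 1) = b from h.final] at this

/-- Markov's inequality: a missing shortcut forces a potential of at least `1`. The potential starts
below `n`, and its expectation contracts by `1 - 1 / (900 log n)` in each of at least `cOuter * log²
n` updates. -/
lemma computeShortcuts_prob (hB : 0 ≤ B) {G : Digraph V} {g : V → V → ℝ}
    (h0 : SoundTable ρ (initialShortcuts G g)) (κ : HiddenConstants)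
    (hκ : κ.cFunnel = 1) (hκl : 100 ≤ κ.cLong) (hκs : 30 ≤ κ.cSample) (hκi : 3600 ≤ κ.cInner)
    (hn : 2 ≤ Fintype.card V) {a b : ℝ} {x z : V} {l : ℕ}
    (h : PathIn (initialShortcuts G g) a b x z l) (hab : |a - b| ≤ B) :
    failProb (computeShortcuts κ G g B) (fun M => ((b - a : ℝ) : EReal) ≤ M x z) ≤
      ENNReal.ofReal ((Fintype.card V : ℝ) ^ (1 - κ.cOuter / 900)) := by
  have hlog := one_le_logn hn
  have hn0 : (0 : ℝ) < Fintype.card V := by exact_mod_cast (by omega : 0 < Fintype.card V)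
  have hc := κ.cOuter_pos
  have h9 : 1 / (900 * logn V) ≤ 1 := by
    rw [div_le_one (by linarith)]; linarith
  have hrep := expect_repeatRandom (f := updateShortcuts κ B)
    (I := fun M => SoundTable ρ M ∧ ∃ l, PathIn M a b x z l) (φ := potential a b x z)
    (c := ENNReal.ofReal (1 - 1 / (900 * logn V)))
    (fun M hM N hN => ⟨soundTable_of_mem_updateShortcuts hB hM.1 κ hN, by
      obtain ⟨l, hl⟩ := hM.2
      exact ⟨l, hl.mono (le_of_mem_updateShortcuts κ hN).2⟩⟩)
    (fun M hM => expect_potential_update hB hM.1 κ hκ hκl hκs hκi hn hM.2 hab)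
    ⌈κ.cOuter * logn V ^ 2⌉₊ (initialShortcuts G g) ⟨h0, l, h⟩
  have hle : failProb (computeShortcuts κ G g B) (fun M => ((b - a : ℝ) : EReal) ≤ M x z) ≤
      expect (computeShortcuts κ G g B) (potential a b x z) := by
    refine expect_mono_support _ fun M hM => ?_
    have hMi := le_of_mem_computeShortcuts κ hM
    by_cases hp : pathLen M a b x z ≤ 1
    · rw [failInd_of]
      · exact zero_le
      · refine (pathIn_pathLen (h.mono hMi)).le_entry hp (le_trans ?_ (hMi x x))
        simp [initialShortcuts]
    · refine (failInd_le_one _).trans ?_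
      unfold potential
      rw [if_neg hp]
      exact_mod_cast (by omega : 1 ≤ pathLen M a b x z)
  refine hle.trans (hrep.trans ?_)
  have hpot : potential a b x z (initialShortcuts G g) ≤ ENNReal.ofReal (Fintype.card V) := by
    refine (potential_le h).trans ?_
    obtain ⟨p, q, hq, -⟩ := h
    rw [ENNReal.ofReal_natCast]
    exact_mod_cast hq.lt_card.le
  refine (mul_le_mul' le_rfl hpot).trans ?_
  rw [← ENNReal.ofReal_pow (by linarith), ← ENNReal.ofReal_mul (pow_nonneg (by linarith) _)]
  refine ENNReal.ofReal_le_ofReal ?_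
  rw [show 1 - κ.cOuter / 900 = -(κ.cOuter / 900) + 1 by ring, Real.rpow_add hn0, Real.rpow_one]
  refine mul_le_mul_of_nonneg_right ?_ hn0.le
  refine le_trans ?_ (exp_neg_mul_logn_le (by omega) (by positivity))
  calc (1 - 1 / (900 * logn V)) ^ ⌈κ.cOuter * logn V ^ 2⌉₊
      ≤ Real.exp (-(1 / (900 * logn V))) ^ ⌈κ.cOuter * logn V ^ 2⌉₊ := by
        refine pow_le_pow_left₀ (by linarith) ?_ _
        have := Real.add_one_le_exp (-(1 / (900 * logn V)))
        linarith
    _ = Real.exp ((⌈κ.cOuter * logn V ^ 2⌉₊ : ℝ) * -(1 / (900 * logn V))) := by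
        rw [Real.exp_nat_mul]
    _ ≤ _ := by
        refine Real.exp_le_exp.2 ?_
        have h1 := mul_le_mul_of_nonneg_right (Nat.le_ceil (κ.cOuter * logn V ^ 2))
          (show 0 ≤ 1 / (900 * logn V) by positivity)
        rw [show κ.cOuter * logn V ^ 2 * (1 / (900 * logn V)) = κ.cOuter / 900 * logn V by
          field_simp] at h1
        linarith

/-- The events `v ≤ f a` are nested in `v`. On a finite set of outcomes, one `v ∈ S` therefore
detects all failures, and no union bound over `S` is needed. -/
lemma failProb_forall_real {α : Type*} (p : PMF α) (f : α → EReal) (S : Set ℝ) {ε : ℝ≥0∞}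
    (h : ∀ v ∈ S, failProb p (fun a => (v : EReal) ≤ f a) ≤ ε) :
    failProb p (fun a => ∀ v ∈ S, (v : EReal) ≤ f a) ≤ ε := by
  unfold failProb expect
  rw [ENNReal.tsum_eq_iSup_sum]
  refine iSup_le fun s => ?_
  have hw : ∀ s : Finset α, (∀ a ∈ s, ∀ v ∈ S, (v : EReal) ≤ f a) ∨ ∃ v ∈ S, ∀ a ∈ s,
      (v : EReal) ≤ f a → ∀ v ∈ S, (v : EReal) ≤ f a := by
    intro s
    induction s using Finset.induction_on with
    | empty => left; simp
    | insert a s _ ih =>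
      by_cases ha : ∀ v ∈ S, (v : EReal) ≤ f a
      · rcases ih with ih | ⟨v, hv, ih⟩
        · left
          intro a' ha'
          rcases Finset.mem_insert.1 ha' with rfl | ha'
          · exact ha
          · exact ih a' ha'
        · right
          refine ⟨v, hv, fun a' ha' => ?_⟩
          rcases Finset.mem_insert.1 ha' with rfl | ha'
          · exact fun _ => ha
          · exact ih a' ha'
      · push Not at ha
        obtain ⟨v₀, hv₀, hlt⟩ := ha
        right
        rcases ih with ih | ⟨v, hv, ih⟩
        · refine ⟨v₀, hv₀, fun a' ha' hle => ?_⟩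
          rcases Finset.mem_insert.1 ha' with rfl | ha'
          · exact absurd hle (not_le.2 hlt)
          · exact ih a' ha'
        · refine ⟨max v v₀, by rcases max_choice v v₀ with h | h <;> rw [h] <;> assumption,
            fun a' ha' hle => ?_⟩
          rcases Finset.mem_insert.1 ha' with rfl | ha'
          · exact absurd (le_trans (by exact_mod_cast le_max_right v v₀) hle) (not_le.2 hlt)
          · exact ih a' ha' (le_trans (by exact_mod_cast le_max_left v v₀) hle)
  rcases hw s with hw | ⟨v, hv, hw⟩
  · refine le_trans (le_of_eq (Finset.sum_eq_zero fun a ha => ?_)) zero_le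
    simp only [failInd_of (hw a ha), mul_zero]
  · refine le_trans ?_ (h v hv)
    unfold failProb expect
    refine le_trans (Finset.sum_le_sum fun a ha => ?_) (ENNReal.sum_le_tsum s)
    refine mul_le_mul' le_rfl ?_
    by_cases hva : (v : EReal) ≤ f a
    · simp only [failInd_of (hw a ha hva)]; exact zero_le
    · simp only [failInd_of_not hva]; exact failInd_le_one _

/-- The table `M` dominates all monotone level paths of the table `N`. -/
def Captures (B : ℝ) (N M : V → V → EReal) : Prop :=
  ∀ x z a b l, |a - b| ≤ B → PathIn N a b x z l → ((b - a : ℝ) : EReal) ≤ M x z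

/-- The levels `a` and `b` range over a continuum, but the nested thresholds of
`failProb_forall_real` leave only the `n ^ 2` pairs of vertices for the union bound. -/
lemma captures_prob (hB : 0 ≤ B) {G : Digraph V} {g : V → V → ℝ}
    (h0 : SoundTable ρ (initialShortcuts G g)) (κ : HiddenConstants)
    (hκ : κ.cFunnel = 1) (hκl : 100 ≤ κ.cLong) (hκs : 30 ≤ κ.cSample) (hκi : 3600 ≤ κ.cInner)
    (hn : 2 ≤ Fintype.card V) :
    failProb (computeShortcuts κ G g B) (Captures B (initialShortcuts G g)) ≤
      ENNReal.ofReal ((Fintype.card V : ℝ) ^ (3 - κ.cOuter / 900)) := by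
  have hn0 : (0 : ℝ) < Fintype.card V := by exact_mod_cast (by omega : 0 < Fintype.card V)
  set S : V × V → Set ℝ := fun xz => {v | ∃ a b l, |a - b| ≤ B ∧
    PathIn (initialShortcuts G g) a b xz.1 xz.2 l ∧ v = b - a} with hS
  have hone : ∀ xz : V × V, failProb (computeShortcuts κ G g B)
      (fun M => ∀ v ∈ S xz, (v : EReal) ≤ M xz.1 xz.2) ≤
        ENNReal.ofReal ((Fintype.card V : ℝ) ^ (1 - κ.cOuter / 900)) := by
    intro xz
    refine failProb_forall_real _ (fun M : V → V → EReal => M xz.1 xz.2) _ ?_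
    rintro v ⟨a, b, l, hab, hp, rfl⟩
    exact computeShortcuts_prob hB h0 κ hκ hκl hκs hκi hn hp hab
  refine (failProb_mono (P := fun M : V → V → EReal => ∀ xz ∈ (Finset.univ : Finset (V × V)),
    ∀ v ∈ S xz, (v : EReal) ≤ M xz.1 xz.2) _ fun M _ h x z a b l hab hp =>
      h (x, z) (Finset.mem_univ _) _ ⟨a, b, l, hab, hp, rfl⟩).trans ?_
  refine (failProb_forall_le _ _ (fun xz (M : V → V → EReal) => ∀ v ∈ S xz, (v : EReal) ≤ M xz.1 xz.2)).trans ?_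
  refine (Finset.sum_le_card_nsmul _ _ _ fun xz _ => hone xz).trans (le_of_eq ?_)
  rw [nsmul_eq_mul, ← ENNReal.ofReal_natCast, ← ENNReal.ofReal_mul (Nat.cast_nonneg _),
    Finset.card_univ, Fintype.card_prod, show 3 - κ.cOuter / 900 = 2 + (1 - κ.cOuter / 900) by ring,
    Real.rpow_add hn0, show (2 : ℝ) = ((2 : ℕ) : ℝ) by norm_num, Real.rpow_natCast]
  push_cast
  rw [sq]

end Compute

/-! ### The reachability relation of the graph -/

section Reach

variable {V : Type u} {G : Digraph V} {g : V → V → ℝ} {B : ℝ}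

/-- With charge `b` at `x` one can reach `y` with charge at least `c`. -/
inductive Reach (G : Digraph V) (g : V → V → ℝ) (B : ℝ) : V → ℝ → V → ℝ → Prop
  | refl {x : V} {b c : ℝ} : 0 ≤ c → c ≤ b → b ≤ B → Reach G g B x b x c
  | step {x y z : V} {b c d : ℝ} : 0 ≤ b → b ≤ B → G.Adj x y → 0 ≤ c → c ≤ B → c ≤ b + g x y →
      Reach G g B y c z d → Reach G g B x b z d

lemma Reach.raise {x y : V} {b b' c : ℝ} (h : Reach G g B x b y c) (h0 : b ≤ b') (h1 : b' ≤ B) :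
    Reach G g B x b' y c := by
  cases h with
  | refl h2 h3 h4 => exact .refl h2 (h3.trans h0) h1
  | step h2 h3 h4 h5 h6 h7 h8 => exact .step (h2.trans h0) h1 h4 h5 h6 (by linarith) h8

/-- The relation of the graph. -/
def reachRel (G : Digraph V) (g : V → V → ℝ) (B : ℝ) : ChargeRel V B where
  rel := Reach G g B
  refl := .refl
  trans h h' := by
    induction h with
    | refl h1 h2 h3 => exact h'.raise h2 h3
    | step h1 h2 h3 h4 h5 h6 _ ih => exact .step h1 h2 h3 h4 h5 h6 (ih h')
  bounds h := by
    induction h with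
    | refl h1 h2 h3 => exact ⟨h1.trans h2, h3, h1, h2.trans h3⟩
    | step h1 h2 h3 h4 h5 h6 _ ih => exact ⟨h1, h2, ih.2.2⟩

lemma arcCharge_mono {b b' : EReal} (h : b ≤ b') (a : ℝ) : arcCharge B b a ≤ arcCharge B b' a := by
  unfold arcCharge
  have h' : b + (a : EReal) ≤ b' + a := add_le_add h le_rfl
  split_ifs with h1 h2
  · exact min_le_min h' le_rfl
  · exact absurd (h1.trans h') h2
  · exact bot_le
  · exact le_rfl

lemma finalCharge_mono (P : List V) : ∀ {b b' : EReal}, b ≤ b' →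
    finalCharge g B b P ≤ finalCharge g B b' P := by
  induction P with
  | nil => intro b b' h; simpa [finalCharge] using h
  | cons x P ih =>
    intro b b' h
    cases P with
    | nil => simpa [finalCharge] using h
    | cons y P => exact ih (arcCharge_mono h _)

lemma Reach.exists_path {x y : V} {b c : ℝ} (h : Reach G g B x b y c) :
    ∃ P, IsPath G x y P ∧ (c : EReal) ≤ finalCharge g B b P := by
  induction h with
  | @refl x b c h1 h2 h3 =>
    exact ⟨[x], ⟨rfl, rfl, by simp⟩, by simpa [finalCharge] using h2⟩
  | @step x y z b c d h1 h2 h3 h4 h5 h6 _ ih =>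
    obtain ⟨P, ⟨hP1, hP2, hP3⟩, hP4⟩ := ih
    cases P with
    | nil => simp at hP1
    | cons y' P =>
      obtain rfl : y' = y := by simpa using hP1
      refine ⟨x :: y' :: P, ⟨rfl, by simpa using hP2, List.isChain_cons_cons.2 ⟨h3, hP3⟩⟩, ?_⟩
      refine hP4.trans (finalCharge_mono _ ?_)
      unfold arcCharge
      rw [← EReal.coe_add, if_pos (by exact_mod_cast h4.trans h6)]
      exact le_min (by exact_mod_cast h6) (by exact_mod_cast h5)

lemma Reach.le_maxFinalCharge {x y : V} {c : ℝ} (h : Reach G g B x B y c) :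
    (c : EReal) ≤ maxFinalCharge G g B B x y := by
  obtain ⟨P, hP, hc⟩ := h.exists_path
  exact hc.trans (le_iSup (fun P : {P : List V // IsPath G x y P} =>
    finalCharge g B (B : EReal) P.1) ⟨P, hP⟩)

lemma finalCharge_bot (P : List V) : finalCharge g B ⊥ P = ⊥ := by
  induction P with
  | nil => rfl
  | cons x P ih =>
    cases P with
    | nil => rfl
    | cons y P =>
      rw [finalCharge]
      have : arcCharge B ⊥ (g x y) = ⊥ := by simp [arcCharge]
      rw [this]
      exact ih

lemma finalCharge_cases (hB : 0 ≤ B) (P : List V) : ∀ {x y : V} {b : ℝ}, 0 ≤ b → b ≤ B →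
    IsPath G x y P → finalCharge g B b P = ⊥ ∨
      ∃ c : ℝ, finalCharge g B b P = c ∧ Reach G g B x b y c := by
  induction P with
  | nil => rintro x y b _ _ ⟨h, -⟩; simp at h
  | cons v P ih =>
    rintro x y b h0 h1 ⟨hP1, hP2, hP3⟩
    obtain rfl : v = x := by simpa using hP1
    cases P with
    | nil =>
      obtain rfl : v = y := by simpa using hP2
      exact Or.inr ⟨b, rfl, .refl h0 le_rfl h1⟩
    | cons v' P =>
      rw [List.isChain_cons_cons] at hP3
      rw [finalCharge]
      unfold arcCharge
      rw [← EReal.coe_add]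
      split_ifs with hpos
      · rw [← EReal.coe_strictMono.monotone.map_min]
        have hpos' : 0 ≤ b + g v v' := by exact_mod_cast hpos
        have h2 : 0 ≤ min (b + g v v') B := le_min hpos' hB
        rcases ih h2 (min_le_right _ _) ⟨rfl, by simpa using hP2, hP3.2⟩ with h | ⟨c, h, hr⟩
        · exact Or.inl h
        · exact Or.inr ⟨c, h, .step h0 h1 hP3.1 h2 (min_le_right _ _) (min_le_left _ _) hr⟩
      · exact Or.inl (finalCharge_bot _)

lemma soundTable_initialShortcuts (hB : 0 ≤ B)
    (hg : ∀ x y : V, G.Adj x y → -B ≤ g x y ∧ g x y ≤ B) :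
    SoundTable (reachRel G g B) (initialShortcuts G g) := by
  intro x y
  refine OnReal.max (OnReal.ite ?_) (OnReal.ite fun h => ?_)
  · rintro rfl
    rw [← EReal.coe_zero]
    exact soundEntry_coe hB (by linarith) fun b c h0 h1 h2 h3 h4 => .refl h2 (by linarith) h1
  · exact soundEntry_coe hB (hg x y h).1 fun b c h0 h1 h2 h3 h4 =>
      .step h0 h1 h h2 h3 h4 (.refl h2 le_rfl h3)

end Reach

/-! ### Soundness of the second stage -/

section SoundStage

variable {V : Type u} [Fintype V] {B : ℝ} {ρ : ChargeRel V B} {M : V → V → EReal}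

/-- The charge that the second component of a vertex of `H` stands for. -/
def level (B : ℝ) (α : Bool) : ℝ := if α = true then B else 0

/-- The first arc can be driven with an empty battery because `m > 0`. Each further lap `y x y`
gains `m + m' > 0` until the capacity is reached. -/
lemma rel_pump (hB : 0 ≤ B) (hM : SoundTable ρ M) {x y : V} {m m' : ℝ} (h : M x y = m)
    (h' : M y x = m') (hm : 0 < m) (hmm : 0 < m + m') : ρ.rel x 0 y B := by
  have key : ∀ n : ℕ, ρ.rel x 0 y (min (n * (m + m') + m) B) := by
    intro n
    induction n with
    | zero =>
      exact hM.step h le_rfl hB (le_min (by simpa using hm.le) hB) (min_le_right _ _)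
        (by simp)
    | succ n ih =>
      have hge := hM.ge h'
      have hn : 0 ≤ (n : ℝ) * (m + m') := by positivity
      rcases min_choice ((n : ℝ) * (m + m') + m) B with he | he
      · have hle : (n : ℝ) * (m + m') + m ≤ B := by rw [← he]; exact min_le_right _ _
        rw [he] at ih
        have hc : 0 ≤ min ((n : ℝ) * (m + m') + m + m') B := le_min (by linarith) hB
        refine ρ.trans ih (ρ.trans (hM.step h' (by linarith) hle hc (min_le_right _ _)
          (min_le_left _ _)) (hM.step h hc (min_le_right _ _) (le_min ?_ hB)
            (min_le_right _ _) ?_))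
        · push_cast; nlinarith
        · push_cast
          rcases min_choice ((n : ℝ) * (m + m') + m + m') B with h3 | h3 <;> rw [h3]
          · exact (min_le_left _ _).trans (by linarith)
          · exact (min_le_right _ _).trans (by linarith)
      · rw [he] at ih
        have hc : 0 ≤ min (B + m') B := le_min (by linarith) hB
        refine ρ.trans ih (ρ.trans (hM.step h' hB le_rfl hc (min_le_right _ _)
          (min_le_left _ _)) (hM.step h hc (min_le_right _ _) (le_min ?_ hB)
            (min_le_right _ _) ((min_le_right _ _).trans ?_)))
        · push_cast; nlinarith
        · rcases min_choice (B + m') B with h3 | h3 <;> rw [h3] <;> linarith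
  obtain ⟨n, hn⟩ := exists_nat_ge (B / (m + m'))
  have := key n
  rwa [min_eq_right] at this
  rw [div_le_iff₀ hmm] at hn
  linarith

lemma rel_of_H (hB : 0 ≤ B) (hM : SoundTable ρ M) {x z : V} {α β : Bool}
    (h : H B M (x, α) (z, β)) : ρ.rel x (level B α) z (level B β) := by
  cases α <;> cases β <;> simp only [level, if_true, if_false, Bool.false_eq_true]
  · obtain ⟨y, h1, h2⟩ := h
    rcases (hM x y).cases with hm | ⟨m, hm, -⟩
    · rw [hm] at h2; simp at h2
    rcases (hM y z).cases with hn | ⟨n, hn, -⟩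
    · rw [hn, EReal.add_bot] at h1; simp at h1
    rw [hm, hn] at h1
    rw [hm] at h2
    norm_cast at h1 h2
    have hge := hM.ge hn
    refine ρ.trans (hM.step hm le_rfl hB (c := min m B) (le_min h2 hB) (min_le_right _ _)
      (by simp)) (hM.step hn (le_min h2 hB) (min_le_right _ _) le_rfl hB ?_)
    rcases min_choice m B with h3 | h3 <;> rw [h3] <;> linarith
  · rcases h with h | ⟨h1, h2⟩
    · obtain ⟨m, hm, hBm⟩ := exists_real_of_le (hM x z).1 h
      exact hM.step hm le_rfl hB hB le_rfl (by linarith)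
    · rcases (hM x z).cases with hm | ⟨m, hm, -⟩
      · rw [hm] at h2; simp at h2
      rcases (hM z x).cases with hn | ⟨n, hn, -⟩
      · rw [hn, EReal.add_bot] at h1; simp at h1
      rw [hm, hn] at h1
      rw [hm] at h2
      norm_cast at h1 h2
      exact rel_pump hB hM hm hn h2 h1
  · rcases (hM x z).cases with hm | ⟨m, hm, -⟩
    · exact absurd hm h
    · exact hM.step hm hB le_rfl le_rfl hB (by linarith [hM.ge hm])
  · obtain ⟨y, h1, h2⟩ := h
    rcases (hM y z).cases with hn | ⟨n, hn, -⟩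
    · rw [hn] at h2; simp at h2
    rcases (hM x y).cases with hm | ⟨m, hm, -⟩
    · rw [hm, EReal.bot_add] at h1; simp at h1
    rw [hm, hn] at h1
    rw [hn] at h2
    norm_cast at h1 h2
    have hge := hM.ge hm
    have hc : 0 ≤ min (B + m) B := le_min (by linarith) hB
    refine ρ.trans (hM.step hm hB le_rfl hc (min_le_right _ _) (min_le_left _ _))
      (hM.step hn hc (min_le_right _ _) hB le_rfl ?_)
    rcases min_choice (B + m) B with h3 | h3 <;> rw [h3] <;> linarith

lemma rel_of_HStar (hB : 0 ≤ B) (hM : SoundTable ρ M) {s : V × Bool} {t : V × Bool}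
    (h : HStar B M s t) : ρ.rel s.1 (level B s.2) t.1 (level B t.2) := by
  induction h with
  | single h => exact rel_of_H hB hM h
  | tail _ h ih => exact ρ.trans ih (rel_of_H hB hM h)

lemma chargeTable_sound (hB : 0 ≤ B) (hM : SoundTable ρ M) {D : Tables V}
    (hD : SoundTables ρ M D) (s t : V) :
    OnReal (fun c => ρ.rel s B t c) (chargeTable B M D s t) := by
  refine OnReal.max (OnReal.ite fun h => onReal_coe (by simpa [level] using rel_of_HStar hB hM h))
    (OnReal.iSup fun y => OnReal.ite fun h => OnReal.iSup fun x => OnReal.ite fun hx => ?_)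
  rcases (hD.first y x t).cases with hd | ⟨d, hd, m, hm, h1, -⟩
  · rw [hd, EReal.add_bot]; exact onReal_bot _
  · rw [hd, ← EReal.coe_add]
    rw [hm] at hx
    norm_cast at hx
    have hge := hM.ge hm
    have r1 : ρ.rel s B y B := by simpa [level] using rel_of_HStar hB hM h
    have r2 := h1 hx (B + m) (by linarith) le_rfl
    refine onReal_coe (ρ.trans r1 (ρ.trans (hM.step hm hB le_rfl (c := B + m) (by linarith)
      (by linarith) le_rfl) ?_))
    convert r2 using 1
    ring

end SoundStage

/-! ### Runs and the graph `H` -/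

section Runs

variable {V : Type u} {B : ℝ} {N M : V → V → EReal}

/-- A sequence of vertices and charges, each of which is attainable from the previous one. -/
structure Run (N : V → V → EReal) (B : ℝ) (w : ℕ → V) (c : ℕ → ℝ) (n : ℕ) : Prop where
  arc : ∀ i, i < n → ((c (i + 1) - c i : ℝ) : EReal) ≤ N (w i) (w (i + 1))
  low : ∀ i, i ≤ n → 0 ≤ c i
  high : ∀ i, i ≤ n → c i ≤ B

lemma Run.take {w : ℕ → V} {c : ℕ → ℝ} {n a : ℕ} (h : Run N B w c n) (ha : a ≤ n) :
    Run N B w c a :=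
  ⟨fun i hi => h.arc i (by omega), fun i hi => h.low i (by omega),
    fun i hi => h.high i (by omega)⟩

lemma Run.drop {w : ℕ → V} {c : ℕ → ℝ} {n k : ℕ} (h : Run N B w c n) (hk : k ≤ n) :
    Run N B (fun i => w (k + i)) (fun i => c (k + i)) (n - k) :=
  ⟨fun i hi => h.arc (k + i) (by omega), fun i hi => h.low (k + i) (by omega),
    fun i hi => h.high (k + i) (by omega)⟩

/-- The sequence without the lap from position `i` to position `i + L`. -/
def cutLap {α : Type*} (i L : ℕ) (w : ℕ → α) (k : ℕ) : α := if k ≤ i then w k else w (k + L)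

/-- Charges in a run may drop voluntarily. Without a nonincreasing lap the run is at `w i` with at
least the charge that it had after the lap, so it can continue with the old charges. -/
lemma Run.cut {w : ℕ → V} {c : ℕ → ℝ} {n i L : ℕ} (h : Run N B w c n) (hj : i + L ≤ n)
    (hw : w i = w (i + L)) (hc : c (i + L) ≤ c i) :
    Run N B (cutLap i L w) (cutLap i L c) (n - L) := by
  refine ⟨fun k hk => ?_, fun k hk => ?_, fun k hk => ?_⟩
  · unfold cutLap
    rcases lt_trichotomy k i with h1 | rfl | h1
    · rw [if_pos (by omega : k + 1 ≤ i), if_pos h1.le, if_pos (by omega : k + 1 ≤ i),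
        if_pos h1.le]
      exact h.arc k (by omega)
    · have h2 := h.arc (k + L) (by omega)
      simp only [le_refl, if_true, Nat.not_succ_le_self, if_false]
      rw [hw, show k + 1 + L = k + L + 1 by ring]
      refine le_trans ?_ h2
      exact_mod_cast by linarith
    · have h2 := h.arc (k + L) (by omega)
      rw [if_neg (by omega), if_neg (by omega), if_neg (by omega), if_neg (by omega),
        show k + 1 + L = k + L + 1 by ring]
      exact h2
  · unfold cutLap; split_ifs
    · exact h.low k (by omega)
    · exact h.low _ (by omega)
  · unfold cutLap; split_ifs
    · exact h.high k (by omega)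
    · exact h.high _ (by omega)

lemma cutLap_zero {α : Type*} (i L : ℕ) (w : ℕ → α) : cutLap i L w 0 = w 0 := by simp [cutLap]

lemma cutLap_last {w : ℕ → V} {c : ℕ → ℝ} {n i L : ℕ} (hj : i + L ≤ n)
    (hw : w i = w (i + L)) (hc : c (i + L) ≤ c i) :
    cutLap i L w (n - L) = w n ∧ c n ≤ cutLap i L c (n - L) := by
  unfold cutLap
  by_cases h : n - L ≤ i
  · obtain rfl : n = i + L := by omega
    simpa using ⟨hw, hc⟩
  · rw [if_neg h, if_neg h, Nat.sub_add_cancel (by omega)]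
    exact ⟨rfl, le_rfl⟩

/-- A simple stretch is made into a level path by lowering its last level to `e`; the range
condition is then needed only before the end. -/
lemma Captures.le_of_levels (hC : Captures B N M) (hd : ∀ x, 0 ≤ M x x) {W : ℕ → V} {h : ℕ → ℝ}
    {i j : ℕ} {e : ℝ} (hij : i ≤ j)
    (harc : ∀ k, i ≤ k → k < j → ((h (k + 1) - h k : ℝ) : EReal) ≤ N (W k) (W (k + 1)))
    (hinj : ∀ k l, i ≤ k → k < l → l ≤ j → W k ≠ W l) (he : e ≤ h j)
    (hlev : ∀ k, i ≤ k → k < j → min (h i) e ≤ h k ∧ h k ≤ max (h i) e) (hB : |h i - e| ≤ B) :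
    ((e - h i : ℝ) : EReal) ≤ M (W i) (W j) := by
  rcases hij.eq_or_lt with rfl | hij
  · exact le_trans (by exact_mod_cast by linarith) (hd _)
  refine hC (W i) (W j) (h i) e (j - i) hB ⟨fun k => W (i + k),
    fun k => if k = j - i then e else h (i + k), ⟨?_, ?_, ?_, ?_, ?_, ?_⟩, rfl, ?_⟩
  · rw [if_neg (by omega)]; rfl
  · simp
  · intro k l hkl hl
    exact hinj _ _ (by omega) (by omega) (by omega)
  · intro k hk
    rw [if_neg (by omega : ¬ k = j - i)]
    refine le_trans ?_ (harc (i + k) (by omega) (by omega))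
    norm_cast
    split_ifs with h1
    · have : i + k + 1 = j := by omega
      rw [this]; linarith
    · rw [show i + (k + 1) = i + k + 1 by ring]
  · intro k hk
    split_ifs with h1
    · exact min_le_right _ _
    · exact (hlev _ (by omega) (by omega)).1
  · intro k hk
    split_ifs with h1
    · exact le_max_right _ _
    · exact (hlev _ (by omega) (by omega)).2
  · show W (i + (j - i)) = W j
    rw [Nat.add_sub_cancel' hij.le]

/-- A positive lap that starts at its last minimum gives an arc of `H` from empty to full. -/
lemma Captures.pump (hC : Captures B N M) (hd : ∀ x, 0 ≤ M x x) (hNM : N ≤ M) (hB : 0 ≤ B)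
    {W : ℕ → V} {h : ℕ → ℝ} {a L : ℕ} (hL : 0 < L)
    (harc : ∀ k, a ≤ k → k < a + L → ((h (k + 1) - h k : ℝ) : EReal) ≤ N (W k) (W (k + 1)))
    (hW : W (a + L) = W a)
    (hinj : ∀ k l, a ≤ k → k < l → l ≤ a + L → l < k + L → W k ≠ W l)
    (hh : ∀ k, a < k → k ≤ a + L → h a < h k) :
    ∃ k, a < k ∧ (k < a + L ∨ L = 1 ∧ k = a + 1) ∧ H B M (W a, false) (W k, true) := by
  rcases Nat.lt_or_ge L 2 with hL2 | hL2
  · obtain rfl : L = 1 := by omega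
    have h1 := (harc a le_rfl (by omega)).trans (hNM _ _)
    have h2 : (0 : EReal) < M (W a) (W (a + 1)) :=
      lt_of_lt_of_le (by exact_mod_cast sub_pos.2 (hh (a + 1) (by omega) le_rfl)) h1
    refine ⟨a + 1, by omega, Or.inr ⟨rfl, rfl⟩, Or.inr ⟨?_, h2⟩⟩
    rw [hW] at h2 ⊢
    exact EReal.add_pos h2 h2
  by_cases hbig : ∃ k, a < k ∧ k < a + L ∧ h a + B ≤ h k
  -- At the first position that is `B` above the start, the stretch from `a` is a level path of gain
  -- `B`.
  · set k := Nat.find hbig with hk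
    obtain ⟨h1, h2, h3⟩ := Nat.find_spec hbig
    rw [← hk] at h1 h2 h3
    refine ⟨k, h1, Or.inl h2, Or.inl ?_⟩
    have := hC.le_of_levels hd (W := W) (h := h) h1.le (fun l hl hl' => harc l hl (by omega))
      (fun l l' hl hl' hl'' => hinj l l' hl hl' (by omega) (by omega)) h3 ?_ ?_
    · simpa using this
    · intro l hl hlk
      rw [min_eq_left (by linarith), max_eq_right (by linarith)]
      rcases hl.eq_or_lt with rfl | hl
      · exact ⟨le_rfl, by linarith⟩
      · refine ⟨(hh l hl (by omega)).le, ?_⟩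
        by_contra hcon
        exact Nat.find_min hbig hlk ⟨hl, by omega, by linarith⟩
    · simp [abs_of_nonneg hB]
  -- Otherwise split the lap at its highest position `b`. The lowest level `h m` after `a` is a safe
  -- target for the return and exceeds `h a`, so the two entries have a positive sum.
  · push Not at hbig
    obtain ⟨b, hb, hbmax⟩ := Finset.exists_max_image (Finset.Ioo a (a + L)) h
      ⟨a + 1, by simp; omega⟩
    obtain ⟨m, hm, hmmin⟩ := Finset.exists_min_image (Finset.Ioc a (a + L)) h
      ⟨a + 1, by simp; omega⟩
    rw [Finset.mem_Ioo] at hb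
    rw [Finset.mem_Ioc] at hm
    have hab := hh b hb.1 (by omega)
    have hbB := hbig b hb.1 hb.2
    have ham := hh m hm.1 hm.2
    have hmb := hmmin b (Finset.mem_Ioc.2 ⟨hb.1, hb.2.le⟩)
    have key1 := hC.le_of_levels hd (W := W) (h := h) (e := h b) hb.1.le
      (fun l hl hl' => harc l hl (by omega))
      (fun l l' hl hl' hl'' => hinj l l' hl hl' (by omega) (by omega)) le_rfl (by
        intro l hl hlk
        rw [min_eq_left hab.le, max_eq_right hab.le]
        rcases hl.eq_or_lt with rfl | hl
        · exact ⟨le_rfl, hab.le⟩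
        · exact ⟨(hh l hl (by omega)).le, hbmax l (Finset.mem_Ioo.2 ⟨hl, by omega⟩)⟩)
      (by rw [abs_le]; constructor <;> linarith)
    have key2 := hC.le_of_levels hd (W := W) (h := h) (i := b) (j := a + L) (e := h m) hb.2.le
      (fun l hl hl' => harc l (by omega) (by omega))
      (fun l l' hl hl' hl'' => hinj l l' (by omega) hl' (by omega) (by omega))
      (hmmin _ (Finset.mem_Ioc.2 ⟨by omega, le_rfl⟩)) (by
        intro l hl hlk
        rw [min_eq_right hmb, max_eq_left hmb]
        exact ⟨hmmin l (Finset.mem_Ioc.2 ⟨by omega, by omega⟩),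
          hbmax l (Finset.mem_Ioo.2 ⟨by omega, by omega⟩)⟩)
      (by rw [abs_le]; constructor <;> linarith)
    rw [hW] at key2
    refine ⟨b, hb.1, Or.inl hb.2, Or.inr ⟨lt_of_lt_of_le ?_ (add_le_add key1 key2),
      lt_of_lt_of_le ?_ key1⟩⟩
    · exact_mod_cast (by linarith : (0 : ℝ) < h b - h a + (h m - h b))
    · exact_mod_cast (by linarith : (0 : ℝ) < h b - h a)

lemma exists_first_repeat {w : ℕ → V} {n : ℕ} (h : ∃ i j, i < j ∧ j ≤ n ∧ w i = w j) :
    ∃ i j, i < j ∧ j ≤ n ∧ w i = w j ∧ ∀ k l, k < l → l < j → w k ≠ w l := by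
  have hex : ∃ j, ∃ i, i < j ∧ w i = w j := by
    obtain ⟨i, j, h1, -, h2⟩ := h; exact ⟨j, i, h1, h2⟩
  obtain ⟨i, hi, hw⟩ := Nat.find_spec hex
  refine ⟨i, Nat.find hex, hi, ?_, hw, fun k l hkl hl hkl' => Nat.find_min hex hl ⟨k, hkl, hkl'⟩⟩
  obtain ⟨i, j, h1, h3, h2⟩ := h
  exact (Nat.find_le ⟨i, h1, h2⟩).trans h3

lemma exists_last_min (c : ℕ → ℝ) {i : ℕ} : ∀ {j : ℕ}, i < j → ∃ a, i ≤ a ∧ a < j ∧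
    (∀ k, i ≤ k → k < j → c a ≤ c k) ∧ ∀ k, a < k → k < j → c a < c k := by
  intro j
  induction j with
  | zero => intro h; omega
  | succ j ih =>
    intro hij
    rcases Nat.eq_or_lt_of_le (Nat.lt_succ_iff.1 hij) with rfl | hij
    · exact ⟨i, le_rfl, by omega, fun k h1 h2 => by rw [show k = i by omega],
        fun k h1 h2 => by omega⟩
    · obtain ⟨a, h1, h2, h3, h4⟩ := ih hij
      rcases lt_or_ge (c a) (c j) with h | h
      · refine ⟨a, h1, by omega, fun k hk hk' => ?_, fun k hk hk' => ?_⟩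
        · rcases Nat.eq_or_lt_of_le (Nat.lt_succ_iff.1 hk') with rfl | hk'
          · exact h.le
          · exact h3 k hk hk'
        · rcases Nat.eq_or_lt_of_le (Nat.lt_succ_iff.1 hk') with rfl | hk'
          · exact h
          · exact h4 k hk hk'
      · refine ⟨j, hij.le, by omega, fun k hk hk' => ?_, fun k hk hk' => by omega⟩
        rcases Nat.eq_or_lt_of_le (Nat.lt_succ_iff.1 hk') with rfl | hk'
        · exact le_rfl
        · exact h.trans (h3 k hk hk')

/-- The first repeated vertex closes a simple lap. A lap that does not gain can be cut. A gaining
lap, started at its last minimum, stays strictly above its initial level, so it can be pumped from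
an empty battery. -/
lemma Run.cut_or_pump (hC : Captures B N M) (hd : ∀ x, 0 ≤ M x x) (hNM : N ≤ M) (hB : 0 ≤ B)
    {w : ℕ → V} {c : ℕ → ℝ} {n : ℕ} (hR : Run N B w c n)
    (hrep : ∃ i j, i < j ∧ j ≤ n ∧ w i = w j) :
    (∃ i L, 0 < L ∧ i + L ≤ n ∧ w i = w (i + L) ∧ c (i + L) ≤ c i) ∨
      ∃ a k, a < n ∧ 0 < k ∧ k ≤ n ∧ H B M (w a, false) (w k, true) := by
  obtain ⟨i, j, hij, hjn, hw, hinj⟩ := exists_first_repeat hrep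
  obtain ⟨L, rfl⟩ : ∃ L, j = i + L := ⟨j - i, by omega⟩
  rcases le_or_gt (c (i + L)) (c i) with hc | hc
  · exact Or.inl ⟨i, L, by omega, hjn, hw, hc⟩
  right
  obtain ⟨a, hia, haj, hmin, hlast⟩ := exists_last_min c hij
  -- The lap is unrolled beyond `i + L`, with levels raised by its gain, so that one full turn from
  -- `a` is an interval of positions.
  set W : ℕ → V := fun k => if k < i + L then w k else w (k - L) with hWdef
  set h : ℕ → ℝ := fun k => if k < i + L then c k else c (k - L) + (c (i + L) - c i) with hhdef
  have hWa : W a = w a := if_pos haj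
  have hha : h a = c a := if_pos haj
  obtain ⟨k, hak, hk, hH⟩ := hC.pump hd hNM hB (W := W) (h := h) (a := a) (L := L) (by omega)
    (by
      intro k hk hk'
      simp only [hWdef, hhdef]
      rcases lt_trichotomy (k + 1) (i + L) with h1 | h1 | h1
      · rw [if_pos h1, if_pos (by omega), if_pos h1, if_pos (by omega)]
        exact hR.arc k (by omega)
      · have := hR.arc k (by omega)
        rw [if_neg (by omega), if_pos (by omega), if_pos (by omega), if_neg (by omega)]
        rw [h1] at this ⊢
        simpa [hw] using this
      · rw [if_neg (by omega), if_neg (by omega), if_neg (by omega), if_neg (by omega),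
          show k + 1 - L = k - L + 1 by omega]
        have := hR.arc (k - L) (by omega)
        refine le_of_eq_of_le ?_ this
        norm_cast
        ring)
    (by
      simp only [hWdef]
      rw [if_neg (by omega), if_pos haj, Nat.add_sub_cancel])
    (by
      intro k l hk hkl hl hlL
      simp only [hWdef]
      split_ifs with h1 h2 h2
      · exact hinj k l hkl h2
      · exact (hinj (l - L) k (by omega) h1).symm
      · omega
      · exact hinj (k - L) (l - L) (by omega) (by omega))
    (by
      intro k hk hk'
      rw [hha]
      simp only [hhdef]
      split_ifs with h1
      · exact hlast k hk h1
      · have := hmin (k - L) (by omega) (by omega)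
        linarith)
  rw [hWa] at hH
  simp only [hWdef] at hH
  rcases lt_trichotomy k (i + L) with h1 | h1 | h1
  · rw [if_pos h1] at hH
    exact ⟨a, k, by omega, by omega, by omega, hH⟩
  · rw [if_neg (by omega), h1, Nat.add_sub_cancel, hw] at hH
    exact ⟨a, i + L, by omega, by omega, hjn, hH⟩
  · rw [if_neg (by omega)] at hH
    exact ⟨a, k - L, by omega, by omega, by omega, hH⟩

/-- Every run between the extreme charges is witnessed in `H*`. -/
lemma Run.hStar (hC : Captures B N M) (hd : ∀ x, 0 ≤ M x x) (hNM : N ≤ M) (hB : 0 ≤ B) (n : ℕ) :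
    ∀ {w : ℕ → V} {c : ℕ → ℝ} {α β : Bool}, Run N B w c n → c 0 ≤ level B α → level B β ≤ c n →
      HStar B M (w 0, α) (w n, β) := by
  induction n using Nat.strong_induction_on with
  | _ n ih =>
    intro w c α β hR hα hβ
    by_cases hrep : ∃ i j, i < j ∧ j ≤ n ∧ w i = w j
    · rcases hR.cut_or_pump hC hd hNM hB hrep with ⟨i, L, hL, hj, hw, hc⟩ | ⟨a, k, ha, hk, hkn, hH⟩
      · obtain ⟨h1, h2⟩ := cutLap_last (c := c) hj hw hc
        have := ih (n - L) (by omega) (hR.cut hj hw hc) (by rwa [cutLap_zero]) (hβ.trans h2)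
        rwa [cutLap_zero, h1] at this
      -- The pump arc joins the run up to `a`, ended empty, to the run from `k` on, started full;
      -- both parts are shorter, even if they overlap.
      · have h1 := ih a ha (hR.take ha.le) (β := false) hα (by simpa [level] using hR.low a ha.le)
        have h2 := ih (n - k) (by omega) (hR.drop hkn) (α := true) (β := β)
          (by simpa [level] using hR.high k hkn) (by simpa [Nat.add_sub_cancel' hkn] using hβ)
        simp only [Nat.add_sub_cancel' hkn, add_zero] at h2
        exact (h1.tail hH).trans h2
    · push Not at hrep
      refine Relation.TransGen.single ?_
      have hlα : 0 ≤ level B α ∧ level B α ≤ B := by cases α <;> simp [level, hB]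
      have hlβ : 0 ≤ level B β ∧ level B β ≤ B := by cases β <;> simp [level, hB]
      rcases Nat.eq_zero_or_pos n with rfl | hn
      · have hdx := hd (w 0)
        cases α <;> cases β
        · exact ⟨w 0, add_nonneg hdx hdx, hdx⟩
        · refine Or.inl (le_trans ?_ hdx)
          have := hβ.trans hα
          simp only [level, if_true, Bool.false_eq_true, if_false] at this
          exact_mod_cast this
        · intro h
          rw [h] at hdx
          simp at hdx
        · exact ⟨w 0, add_nonneg hdx hdx, hdx⟩
      -- Raising the initial charge to the level of `α` keeps all arc conditions and makes the
      -- starting level extreme.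
      set h : ℕ → ℝ := fun k => if k = 0 then level B α else c k with hh
      have h0 : h 0 = level B α := by simp [hh]
      have hpos : ∀ k, 0 < k → h k = c k := fun k hk => if_neg hk.ne'
      have hlow : ∀ k, k ≤ n → 0 ≤ h k ∧ h k ≤ B := by
        intro k hk
        rcases Nat.eq_zero_or_pos k with rfl | hk0
        · rw [h0]; exact hlα
        · rw [hpos k hk0]; exact ⟨hR.low k hk, hR.high k hk⟩
      have harc : ∀ k, k < n → ((h (k + 1) - h k : ℝ) : EReal) ≤ N (w k) (w (k + 1)) := by
        intro k hk
        refine le_trans ?_ (hR.arc k hk)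
        rw [hpos (k + 1) (by omega)]
        rcases Nat.eq_zero_or_pos k with rfl | hk0
        · rw [h0]; exact_mod_cast by linarith
        · rw [hpos k hk0]
      have hend : level B β ≤ h n := by rwa [hpos n hn]
      have key : ∀ i j, i ≤ j → j ≤ n → ∀ e, e ≤ h j → |h i - e| ≤ B →
          (∀ k, i ≤ k → k < j → min (h i) e ≤ h k ∧ h k ≤ max (h i) e) →
          ((e - h i : ℝ) : EReal) ≤ M (w i) (w j) := fun i j hij hj e he hab hlev =>
        hC.le_of_levels hd hij (fun k _ hk => harc k (by omega))
          (fun k l _ hkl hl => hrep k l hkl (by omega)) he hlev hab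
      cases α <;> cases β <;> simp only [level, if_true, if_false, Bool.false_eq_true] at h0 hend
      -- From empty to empty the intermediate vertex of the arc of `H` is a highest one; from full
      -- to full it is a lowest one. The mixed cases are single level paths.
      · obtain ⟨b, hb, hmax⟩ := Finset.exists_max_image (Finset.range n) h ⟨0, by simpa using hn⟩
        rw [Finset.mem_range] at hb
        have hbB := hlow b hb.le
        have h1 := key 0 b (by omega) hb.le (h b) le_rfl
          (by rw [h0, abs_le]; constructor <;> linarith) (fun k _ hk => by
            rw [h0, min_eq_left hbB.1, max_eq_right hbB.1]
            exact ⟨(hlow k (by omega)).1, hmax k (Finset.mem_range.2 (by omega))⟩)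
        have h2 := key b n hb.le le_rfl 0 hend
          (by rw [abs_le]; constructor <;> linarith) (fun k _ hk => by
            rw [min_eq_right hbB.1, max_eq_left hbB.1]
            exact ⟨(hlow k (by omega)).1, hmax k (Finset.mem_range.2 (by omega))⟩)
        rw [h0] at h1
        refine ⟨w b, le_trans ?_ (add_le_add h1 h2), le_trans ?_ h1⟩
        · exact_mod_cast (by linarith : (0 : ℝ) ≤ h b - 0 + (0 - h b))
        · exact_mod_cast (by linarith : (0 : ℝ) ≤ h b - 0)
      · have h1 := key 0 n (by omega) le_rfl B hend (by rw [h0]; simp [abs_of_nonneg hB])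
          (fun k _ hk => by
            rw [h0, min_eq_left hB, max_eq_right hB]
            exact hlow k (by omega))
        rw [h0] at h1
        exact Or.inl (by simpa using h1)
      · have h1 := key 0 n (by omega) le_rfl 0 hend (by rw [h0]; simp [abs_of_nonneg hB])
          (fun k _ hk => by
            rw [h0, min_eq_right hB, max_eq_left hB]
            exact hlow k (by omega))
        exact fun hbot => by rw [hbot] at h1; simp at h1
      · obtain ⟨b, hb, hmin⟩ := Finset.exists_min_image (Finset.range n) h ⟨0, by simpa using hn⟩
        rw [Finset.mem_range] at hb
        have hbB := hlow b hb.le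
        have h1 := key 0 b (by omega) hb.le (h b) le_rfl
          (by rw [h0, abs_le]; constructor <;> linarith) (fun k _ hk => by
            rw [h0, min_eq_right hbB.2, max_eq_left hbB.2]
            exact ⟨hmin k (Finset.mem_range.2 (by omega)), (hlow k (by omega)).2⟩)
        have h2 := key b n hb.le le_rfl B hend
          (by rw [abs_le]; constructor <;> linarith) (fun k _ hk => by
            rw [min_eq_left hbB.2, max_eq_right hbB.2]
            exact ⟨hmin k (Finset.mem_range.2 (by omega)), (hlow k (by omega)).2⟩)
        rw [h0] at h1
        refine ⟨w b, le_trans ?_ (add_le_add h1 h2), le_trans ?_ h2⟩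
        · exact_mod_cast (by linarith : (0 : ℝ) ≤ h b - B + (B - h b))
        · exact_mod_cast (by linarith : (0 : ℝ) ≤ B - h b)

end Runs

/-! ### Decomposition of a sequence of charges into a funnel -/

section Decomposition

variable {V : Type u} {M : V → V → EReal}

/-- From `a`, above all later charges, go to the last minimum `b`. All later charges then lie above
`c b`, so the argument repeats with the opposite sign `σ`. Every stretch lies between its ends,
where `hM` gives exact entries, and its range contains that of the next one. -/
lemma exists_funnel_walk {w : ℕ → V} {c : ℕ → ℝ} {m : ℕ}
    (hM : ∀ i j, i < j → j ≤ m → (∀ k, i ≤ k → k ≤ j → min (c i) (c j) ≤ c k ∧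
      c k ≤ max (c i) (c j)) → M (w i) (w j) = ((c j - c i : ℝ) : EReal)) (d : ℕ) :
    ∀ {a : ℕ} {σ : ℝ}, σ = 1 ∨ σ = -1 → a + d = m →
      (∀ k, a < k → k ≤ m → σ * c k < σ * c a) →
      ∃ (l : ℕ) (u : ℕ → V) (r : ℕ → ℝ), Walk M u r 0 l ∧ Funnel r 0 l ∧ u 0 = w a ∧ r 0 = c a ∧
        u l = w m ∧ r l = c m ∧ (0 < d → 0 < l) ∧
        (0 < l → σ * r 1 < σ * r 0 ∧ ∃ k, a < k ∧ k ≤ m ∧ r 1 = c k) := by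
  induction d using Nat.strong_induction_on with
  | _ d ih =>
    intro a σ hσ had ha
    rcases Nat.eq_zero_or_pos d with rfl | hd
    · obtain rfl : a = m := by omega
      exact ⟨0, fun _ => w a, fun _ => c a, fun i _ hi => by omega, fun i _ hi => by omega, rfl,
        rfl, rfl, rfl, fun h => h, fun h => by omega⟩
    obtain ⟨b, hab, hbm, hmin, hlast⟩ := exists_last_min (fun k => σ * c k)
      (show a < m + 1 by omega)
    have hab' : a < b := by
      rcases hab.eq_or_lt with rfl | h
      · have h1 := hlast m (by omega) (by omega)
        have h2 := ha m (by omega) le_rfl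
        linarith
      · exact h
    obtain ⟨l, u, r, hW, hF, hu0, hr0, hul, hrl, -, hl⟩ := ih (m - b) (by omega) (a := b) (σ := -σ)
      (by rcases hσ with rfl | rfl <;> simp) (by omega)
      (fun k hk hk' => by have := hlast k hk (by omega); linarith)
    have hbal := ha b hab' (by omega)
    have harc : M (w a) (w b) = ((c b - c a : ℝ) : EReal) := by
      refine hM a b hab' (by omega) fun k hk hk' => ?_
      have h1 : σ * c k ≤ σ * c a := by
        rcases hk.eq_or_lt with rfl | hk
        · exact le_rfl
        · exact (ha k hk (by omega)).le
      have h2 := hmin k hk (by omega)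
      rcases hσ with rfl | rfl
      · rw [min_eq_right (by linarith), max_eq_left (by linarith)]; constructor <;> linarith
      · rw [min_eq_left (by linarith), max_eq_right (by linarith)]; constructor <;> linarith
    refine ⟨l + 1, fun i => Nat.casesOn i (w a) u, fun i => Nat.casesOn i (c a) r, ?_, ?_, rfl,
      rfl, hul, hrl, fun _ => by omega, fun _ => ⟨?_, b, hab', by omega, hr0⟩⟩
    · rintro (_ | i) _ hi
      · simpa [hu0, hr0] using harc
      · exact hW i (by omega) (by omega)
    · rintro (_ | i) _ hi
      · obtain ⟨h1, k, hk, hk', h2⟩ := hl (by omega)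
        have h3 := ha k (by omega) hk'
        have h4 := hmin k (by omega) (by omega)
        rw [hr0] at h1
        show (r 0 - c a) * (r 1 - r 0) < 0 ∧ |r 1 - r 0| ≤ |r 0 - c a|
        rw [hr0]
        rw [h2] at h1 ⊢
        rcases hσ with rfl | rfl
        · refine ⟨mul_neg_of_neg_of_pos (by linarith) (by linarith), ?_⟩
          rw [abs_of_pos (by linarith), abs_of_neg (by linarith)]
          linarith
        · refine ⟨mul_neg_of_pos_of_neg (by linarith) (by linarith), ?_⟩
          rw [abs_of_neg (by linarith), abs_of_pos (by linarith)]
          linarith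
      · exact hF i (by omega) (by omega)
    · show σ * r 0 < σ * c a
      rw [hr0]; exact hbal

end Decomposition

/-! ### Completeness of the second stage -/

section FinalStage

variable {V : Type u} [Fintype V] {B : ℝ} {ρ : ChargeRel V B} {N M : V → V → EReal} {s : V}

lemma Run.rel (hN : SoundTable ρ N) {w : ℕ → V} {c : ℕ → ℝ} {n : ℕ} (h : Run N B w c n) :
    ρ.rel (w 0) (c 0) (w n) (c n) := by
  induction n with
  | zero => exact ρ.refl (h.low 0 le_rfl) le_rfl (h.high 0 le_rfl)
  | succ n ih =>
    obtain ⟨e, he, hle⟩ := exists_real_of_le (hN _ _).1 (h.arc n (by omega))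
    exact ρ.trans (ih (h.take (by omega))) (hN.step he (h.low _ (by omega)) (h.high _ (by omega))
      (h.low _ le_rfl) (h.high _ le_rfl) (by linarith))

/-- A simple exact run from a vertex that is reachable with full charge, below the capacity. -/
structure BelowRun (N M : V → V → EReal) (B : ℝ) (s : V) (w : ℕ → V) (c : ℕ → ℝ) (m : ℕ) :
    Prop where
  walk : Walk N w c 0 m
  start : c 0 = B
  low : ∀ k, k ≤ m → 0 ≤ c k
  lt : ∀ k, 0 < k → k ≤ m → c k < B
  inj : ∀ i j, i < j → j ≤ m → w i ≠ w j
  hStar : HStar B M (s, true) (w 0, true)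

lemma BelowRun.run {w : ℕ → V} {c : ℕ → ℝ} {m : ℕ} (h : BelowRun N M B s w c m) :
    Run N B w c m :=
  ⟨fun i hi => (h.walk i (Nat.zero_le _) hi).ge, h.low, fun i hi => by
    rcases Nat.eq_zero_or_pos i with rfl | h0
    · exact h.start.le
    · exact (h.lt i h0 hi).le⟩

lemma BelowRun.lt_card {w : ℕ → V} {c : ℕ → ℝ} {m : ℕ} (h : BelowRun N M B s w c m) :
    m < Fintype.card V := by
  have : (Finset.range (m + 1)).card ≤ (Finset.univ : Finset V).card :=
    Finset.card_le_card_of_injOn w (fun _ _ => Finset.mem_univ _) fun i hi j hj hij => by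
      rw [Finset.mem_coe, Finset.mem_range] at hi hj
      by_contra hne
      rcases Nat.lt_or_gt_of_ne hne with h' | h'
      · exact h.inj i j h' (by omega) hij
      · exact h.inj j i h' (by omega) hij.symm
  rw [Finset.card_range, Finset.card_univ] at this
  omega

/-- The charges along a sequence of arcs, started with charge `B`. -/
def fullCharge (N : V → V → EReal) (B : ℝ) (w : ℕ → V) : ℕ → ℝ
  | 0 => B
  | k + 1 => min (fullCharge N B w k + (N (w k) (w (k + 1))).toReal) B

/-- Every obstacle shortens the run: laps that do not gain are cut, a pumped lap lets the run
restart full at a later vertex, and so does any later return to the capacity. What remains is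
simple, and its recomputed charges are exact because the capacity is never met again. -/
lemma Run.exists_belowRun (hC : Captures B N M) (hd : ∀ x, 0 ≤ M x x) (hNM : N ≤ M)
    (hN : ∀ x y, N x y ≠ ⊤) (hB : 0 ≤ B) (n : ℕ) :
    ∀ {w : ℕ → V} {c : ℕ → ℝ}, Run N B w c n → HStar B M (s, true) (w 0, true) →
      ∃ m w' c', BelowRun N M B s w' c' m ∧ w' m = w n ∧ c n ≤ c' m := by
  induction n using Nat.strong_induction_on with
  | _ n ih =>
    intro w c hR hs
    by_cases hrep : ∃ i j, i < j ∧ j ≤ n ∧ w i = w j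
    · rcases hR.cut_or_pump hC hd hNM hB hrep with ⟨i, L, hL, hj, hw, hc⟩ | ⟨a, k, ha, hk, hkn, hH⟩
      · obtain ⟨h1, h2⟩ := cutLap_last (c := c) hj hw hc
        obtain ⟨m, w', c', h3, h4, h5⟩ := ih (n - L) (by omega) (hR.cut hj hw hc)
          (by rwa [cutLap_zero])
        exact ⟨m, w', c', h3, h4.trans h1, h2.trans h5⟩
      · have h1 := (hR.take ha.le).hStar hC hd hNM hB _ (α := true) (β := false)
          (by simpa [level] using hR.high 0 (by omega)) (by simpa [level] using hR.low a ha.le)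
        obtain ⟨m, w', c', h3, h4, h5⟩ := ih (n - k) (by omega) (hR.drop hkn)
          ((hs.trans h1).tail hH)
        simp only [Nat.add_sub_cancel' hkn] at h4 h5
        exact ⟨m, w', c', h3, h4, h5⟩
    push Not at hrep
    set e := fullCharge N B w with he
    have hreal : ∀ k, k < n → N (w k) (w (k + 1)) = ((N (w k) (w (k + 1))).toReal : EReal) ∧
        c (k + 1) - c k ≤ (N (w k) (w (k + 1))).toReal := by
      intro k hk
      obtain ⟨x, hx, hle⟩ := exists_real_of_le (hN _ _) (hR.arc k hk)
      rw [hx, EReal.toReal_coe]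
      exact ⟨rfl, hle⟩
    have hsucc : ∀ k, e (k + 1) = min (e k + (N (w k) (w (k + 1))).toReal) B := fun k => rfl
    have hle : ∀ k, e k ≤ B := by
      rintro (_ | k)
      · exact le_rfl
      · exact min_le_right _ _
    have hge : ∀ k, k ≤ n → c k ≤ e k := by
      intro k
      induction k with
      | zero => exact fun _ => hR.high 0 (by omega)
      | succ k ihk =>
        intro hk
        have := hreal k (by omega)
        have := ihk (by omega)
        rw [hsucc]
        exact le_min (by linarith) (hR.high _ hk)
    -- A later full position is witnessed in `H*`; the original run is continued from there, now
    -- known to be reachable with charge `B`.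
    by_cases hfull : ∃ k, 0 < k ∧ k ≤ n ∧ e k = B
    · obtain ⟨k, hk, hkn, hek⟩ := hfull
      have hRe : Run N B w e k := ⟨fun i hi => by
          rw [(hreal i (by omega)).1, EReal.coe_le_coe_iff, hsucc]
          linarith [min_le_left (e i + (N (w i) (w (i + 1))).toReal) B],
        fun i hi => (hR.low i (by omega)).trans (hge i (by omega)), fun i _ => hle i⟩
      have h1 := hRe.hStar hC hd hNM hB _ (α := true) (β := true) (by simpa [level] using hle 0)
        (by simpa [level] using hek.ge)
      obtain ⟨m, w', c', h3, h4, h5⟩ := ih (n - k) (by omega) (hR.drop hkn) (hs.trans h1)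
      simp only [Nat.add_sub_cancel' hkn] at h4 h5
      exact ⟨m, w', c', h3, h4, h5⟩
    · push Not at hfull
      refine ⟨n, w, e, ⟨fun k _ hk => ?_, rfl, fun k hk => (hR.low k hk).trans (hge k hk),
        fun k hk hkn => lt_of_le_of_ne (hle k) (hfull k hk hkn), hrep, hs⟩, rfl, hge n le_rfl⟩
      rw [(hreal k hk).1, EReal.coe_eq_coe_iff]
      have h1 := hfull (k + 1) (by omega) (by omega)
      rw [hsucc] at h1 ⊢
      rcases min_choice (e k + (N (w k) (w (k + 1))).toReal) B with h2 | h2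
      · rw [h2]; ring
      · exact absurd h2 h1

/-- A strictly larger charge remains strictly larger until the end of a run below capacity. -/
lemma BelowRun.rel_lt (hN : SoundTable ρ N) {w : ℕ → V} {c : ℕ → ℝ} {m : ℕ}
    (h : BelowRun N M B s w c m) {j : ℕ} {e : ℝ} (he : c j < e) (heB : e ≤ B) {k : ℕ}
    (hjk : j ≤ k) : k ≤ m → ∃ e', c k < e' ∧ e' ≤ B ∧ ρ.rel (w j) e (w k) e' := by
  induction k, hjk using Nat.le_induction with
  | base =>
    exact fun hm => ⟨e, he, heB, ρ.refl ((h.low j hm).trans he.le) le_rfl heB⟩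
  | succ k hjk ih =>
    intro hm
    obtain ⟨e', h1, h2, h3⟩ := ih (by omega)
    have h4 := h.lt (k + 1) (by omega) hm
    have h5 := h.low (k + 1) hm
    have h6 : c (k + 1) < min (e' + (c (k + 1) - c k)) B := lt_min (by linarith) h4
    exact ⟨_, h6, min_le_right _ _, ρ.trans h3 (hN.step (h.walk k (Nat.zero_le _) (by omega))
      (by linarith [h.low k (by omega)]) h2 (by linarith) (min_le_right _ _) (min_le_left _ _))⟩

/-- A larger entry would put strictly more charge at `w j`. Below the capacity this advantage
survives to the end (`BelowRun.rel_lt`), so a better run below the capacity would exist. -/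
lemma BelowRun.tight (hC : Captures B N M) (hd : ∀ x, 0 ≤ M x x) (hNM : N ≤ M)
    (hN : SoundTable ρ N) (hM : SoundTable ρ M) (hB : 0 ≤ B)
    (hrel : ∀ {x y b c}, ρ.rel x b y c →
      ∃ n w c', Run N B w c' n ∧ w 0 = x ∧ c' 0 = b ∧ w n = y ∧ c ≤ c' n)
    {w : ℕ → V} {c : ℕ → ℝ} {m : ℕ} (h : BelowRun N M B s w c m)
    (hmax : ∀ m' w' c', BelowRun N M B s w' c' m' → w' m' = w m → c' m' ≤ c m)
    {i j : ℕ} (hij : i < j) (hj : j ≤ m)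
    (hlev : ∀ k, i ≤ k → k ≤ j → min (c i) (c j) ≤ c k ∧ c k ≤ max (c i) (c j)) :
    M (w i) (w j) = ((c j - c i : ℝ) : EReal) := by
  have hge := hC.le_of_levels hd (W := w) (h := c) (e := c j) hij.le
    (fun k _ hk => h.run.arc k (by omega)) (fun k l _ hkl hl => h.inj k l hkl (by omega)) le_rfl
    (fun k hk hk' => hlev k hk hk'.le) (by
      have := h.run.low i (by omega)
      have := h.run.low j (by omega)
      have := h.run.high i (by omega)
      have := h.run.high j (by omega)
      rw [abs_le]; constructor <;> linarith)
  obtain ⟨x, hx, hxge⟩ := exists_real_of_le (hM _ _).1 hge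
  rw [hx, EReal.coe_eq_coe_iff]
  by_contra hne
  have hlt : c j - c i < x := lt_of_le_of_ne hxge (Ne.symm hne)
  have hej : c j < min (c i + x) B := lt_min (by linarith) (h.lt j (by omega) hj)
  obtain ⟨e', h1, h2, h3⟩ := h.rel_lt hN hej (min_le_right _ _) hj le_rfl
  have h4 : ρ.rel (w 0) (c 0) (w m) e' := ρ.trans ((h.run.take (by omega : i ≤ m)).rel hN)
    (ρ.trans (hM.step hx (h.run.low i (by omega)) (h.run.high i (by omega))
      ((h.low j hj).trans hej.le) (min_le_right _ _) (min_le_left _ _)) h3)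
  obtain ⟨n, w', c', hR, hw0, -, hwn, hc⟩ := hrel h4
  obtain ⟨m', w'', c'', h5, h6, h7⟩ := hR.exists_belowRun hC hd hNM (fun x y => (hN x y).1) hB n
    (by rw [hw0]; exact h.hStar)
  have := hmax m' w'' c'' h5 (h6.trans hwn)
  linarith

/-- Among the simple runs below the capacity that end in `t`, a best one exists by finiteness.
Tightness turns its stretches into exact entries of `M`, and `exists_funnel_walk` into a funnel
whose first arc is negative, as `tableA` requires. -/
lemma le_chargeTable (hC : Captures B N M) (hd : ∀ x, 0 ≤ M x x) (hNM : N ≤ M)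
    (hN : SoundTable ρ N) (hM : SoundTable ρ M) (hB : 0 ≤ B)
    (hrel : ∀ {x y b c}, ρ.rel x b y c →
      ∃ n w c', Run N B w c' n ∧ w 0 = x ∧ c' 0 = b ∧ w n = y ∧ c ≤ c' n)
    {D : Tables V} (hF : FunnelComplete M D.first) {t : V} {c : ℝ} (h : ρ.rel s B t c) :
    (c : EReal) ≤ chargeTable B M D s t := by
  have hss : HStar B M (s, true) (s, true) :=
    Relation.TransGen.single ⟨s, add_nonneg (hd s) (hd s), hd s⟩
  set S : Set ℝ := {v | ∃ m w c', BelowRun N M B s w c' m ∧ w m = t ∧ c' m = v} with hS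
  have hfin : S.Finite := by
    refine ((Set.Finite.biUnion (Set.finite_Iio (Fintype.card V))
      fun k _ => finite_walk_gains (M := N) k).image (fun g => g + B)).subset ?_
    rintro v ⟨m, w, c', h1, -, rfl⟩
    exact ⟨c' m - c' 0, Set.mem_biUnion (Set.mem_Iio.2 h1.lt_card) ⟨w, c', h1.walk, rfl⟩,
      by simp [h1.start]⟩
  have hbelow : ∃ v ∈ S, c ≤ v := by
    obtain ⟨n, w, c', hR, hw0, -, hwn, hc⟩ := hrel h
    obtain ⟨m, w', c'', h5, h6, h7⟩ := hR.exists_belowRun hC hd hNM (fun x y => (hN x y).1) hB n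
      (by rw [hw0]; exact hss)
    exact ⟨_, ⟨m, w', c'', h5, h6.trans hwn, rfl⟩, hc.trans h7⟩
  obtain ⟨v, hv, hcv⟩ := hbelow
  obtain ⟨v', ⟨m, w, c', hW, rfl, rfl⟩, hmax⟩ := Set.exists_max_image S id hfin ⟨v, hv⟩
  have hcm : c ≤ c' m := hcv.trans (hmax v hv)
  -- A best run without arcs means that `t` is reachable with full charge, the first alternative in
  -- `chargeTable`.
  rcases Nat.eq_zero_or_pos m with rfl | hm
  · refine le_trans ?_ (le_max_left _ _)
    rw [if_pos hW.hStar]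
    rw [hW.start] at hcm
    exact_mod_cast hcm
  · obtain ⟨l, u, r, h1, h2, h3, h4, h5, h6, h7, h8⟩ := exists_funnel_walk (w := w) (c := c')
      (m := m) (M := M) (fun i j hij hj hlev => hW.tight hC hd hNM hN hM hB hrel
        (fun m' w' c'' h h' => hmax _ ⟨m', w', c'', h, h', rfl⟩) hij hj hlev) m (a := 0) (σ := 1)
      (Or.inl rfl) (by omega) (fun k hk hk' => by
        rw [hW.start, one_mul, one_mul]; exact hW.lt k hk hk')
    have hl := h7 hm
    obtain ⟨h9, -⟩ := h8 hl
    have hfun := hF u r 0 l hl h1 h2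
    have harc := h1 0 le_rfl hl
    rw [h3] at hfun harc
    rw [h5, h6, h4, hW.start] at hfun
    refine le_trans ?_ (le_max_right _ _)
    refine le_trans ?_ (le_iSup _ (w 0))
    rw [if_pos hW.hStar]
    refine le_trans ?_ (le_iSup _ (u (0 + 1)))
    rw [if_pos (by rw [harc]; exact_mod_cast by simp; linarith)]
    refine le_trans ?_ (add_le_add le_rfl hfun)
    exact_mod_cast by linarith

end FinalStage

/-! ### Exactness of the second stage -/

section Completeness

variable {V : Type u} [Fintype V] {G : Digraph V} {g : V → V → ℝ} {B : ℝ}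

lemma Reach.exists_run {x y : V} {b c : ℝ} (h : Reach G g B x b y c) :
    ∃ n w c', Run (initialShortcuts G g) B w c' n ∧ w 0 = x ∧ c' 0 = b ∧ w n = y ∧ c ≤ c' n := by
  induction h with
  | @refl x b c h1 h2 h3 =>
    exact ⟨0, fun _ => x, fun _ => b, ⟨fun i hi => by omega, fun _ _ => h1.trans h2,
      fun _ _ => h3⟩, rfl, rfl, rfl, h2⟩
  | @step x y z b c d h1 h2 h3 h4 h5 h6 _ ih =>
    obtain ⟨n, w, c', hR, hw0, hc0, hwn, hc⟩ := ih
    refine ⟨n + 1, fun i => Nat.casesOn i x w, fun i => Nat.casesOn i b c', ⟨?_, ?_, ?_⟩, rfl, rfl,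
      hwn, hc⟩
    · rintro (_ | i) hi
      · show ((c' 0 - b : ℝ) : EReal) ≤ initialShortcuts G g x (w 0)
        rw [hw0, hc0]
        refine le_trans ?_ (le_max_right _ _)
        rw [if_pos h3]
        exact_mod_cast by linarith
      · exact hR.arc i (by omega)
    · rintro (_ | i) hi
      · exact h1
      · exact hR.low i (by omega)
    · rintro (_ | i) hi
      · exact h2
      · exact hR.high i (by omega)

/-- The second stage is exact on sound tables that capture the initial one. -/
theorem chargeTable_eq (hB : 0 ≤ B) (hg : ∀ x y : V, G.Adj x y → -B ≤ g x y ∧ g x y ≤ B)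
    {M : V → V → EReal} (hM : SoundTable (reachRel G g B) M) (hNM : initialShortcuts G g ≤ M)
    (hC : Captures B (initialShortcuts G g) M) {D : Tables V}
    (hD : SoundTables (reachRel G g B) M D) (hF : FunnelComplete M D.first) (s t : V) :
    chargeTable B M D s t = maxFinalCharge G g B B s t := by
  have hd : ∀ x, 0 ≤ M x x := fun x =>
    le_trans (by simp [initialShortcuts]) (hNM x x)
  apply le_antisymm
  · rcases (chargeTable_sound hB hM hD s t).cases with h | ⟨c, h, hc⟩
    · rw [h]; exact bot_le
    · rw [h]; exact Reach.le_maxFinalCharge hc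
  · refine iSup_le fun P => ?_
    rcases finalCharge_cases hB P.1 hB le_rfl P.2 with h | ⟨c, h, hc⟩
    · rw [h]; exact bot_le
    · rw [h]
      exact le_chargeTable (ρ := reachRel G g B) hC hd hNM (soundTable_initialShortcuts hB hg) hM
        hB (fun h => Reach.exists_run h) hF hc

end Completeness

/-! ### The failure probability of both stages and the choice of constants -/

section Main

variable {V : Type u} [Fintype V]

theorem allPairsMFC_prob (κ : HiddenConstants) (hκ : κ.cFunnel = 1) (hκl : 100 ≤ κ.cLong)
    (hκs : 30 ≤ κ.cSample) (hκi : 3600 ≤ κ.cInner) {G : Digraph V} {g : V → V → ℝ} {B : ℝ}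
    (hB : 0 ≤ B) (hg : ∀ x y : V, G.Adj x y → -B ≤ g x y ∧ g x y ≤ B)
    (hn : 2 ≤ Fintype.card V) :
    failProb (allPairsMFC κ G g B) (fun T => ∀ s t : V, T s t = maxFinalCharge G g B B s t) ≤
      ENNReal.ofReal ((Fintype.card V : ℝ) ^ (3 - κ.cOuter / 900)) +
        ENNReal.ofReal ((Fintype.card V : ℝ) ^ (7 - κ.cSample / 3)) := by
  have h0 := soundTable_initialShortcuts hB hg
  refine (failProb_bind_le _ _ _ _ _ fun M hM hC => ?_).trans
    (add_le_add (captures_prob hB h0 κ hκ hκl hκs hκi hn) le_rfl)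
  have hMs := soundTable_of_mem_computeShortcuts hB h0 κ hM
  have hle := failProb_bind_le (computeFunnels κ M) (fun D => PMF.pure (chargeTable B M D))
    (FunnelsComplete M) (fun T => ∀ s t : V, T s t = maxFinalCharge G g B B s t) 0
    (fun D hD hF => by
      rw [failProb_pure, failInd_of fun s t => chargeTable_eq hB hg hMs
        (le_of_mem_computeShortcuts κ hM) hC (soundTables_of_mem_computeFunnels hB hMs κ hD)
        hF.1 s t])
  rw [add_zero] at hle
  exact hle.trans (computeFunnels_prob κ hκ M hn)

/-- The constants for the failure exponent `c`. -/
def constantsFor (c : ℝ) (hc : 0 < c) : HiddenConstants where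
  cOuter := 900 * (c + 4)
  cInner := 3600
  cLong := 100
  cFunnel := 1
  cSample := 3 * (c + 10)
  cOuter_pos := by linarith
  cInner_pos := by norm_num
  cLong_pos := by norm_num
  cFunnel_pos := one_pos
  cSample_pos := by linarith

theorem allPairsMFC_constantsFor (c : ℝ) (hc : 0 < c) {G : Digraph V} {g : V → V → ℝ} {B : ℝ}
    (hB : 0 ≤ B) (hg : ∀ x y : V, G.Adj x y → -B ≤ g x y ∧ g x y ≤ B) :
    ENNReal.ofReal (1 - (Fintype.card V : ℝ) ^ (-c)) ≤
      (allPairsMFC (constantsFor c hc) G g B).toOuterMeasure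
        {T | ∀ s t : V, T s t = maxFinalCharge G g B B s t} := by
  refine le_trans ?_ (one_sub_failProb_le _ _)
  rw [ENNReal.ofReal_sub _ (by positivity), ENNReal.ofReal_one]
  -- For one vertex the claimed bound is `0`; for none the tables agree vacuously.
  rcases Nat.lt_or_ge (Fintype.card V) 2 with hn | hn
  · rcases Nat.lt_or_ge 0 (Fintype.card V) with h1 | h1
    · rw [show Fintype.card V = 1 by omega]
      simp
    · have : IsEmpty V := Fintype.card_eq_zero_iff.1 (by omega)
      rw [failProb_eq_zero _ fun T _ s => isEmptyElim s, tsub_zero]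
      exact tsub_le_self
  refine tsub_le_tsub_left ?_ _
  have hn' : (2 : ℝ) ≤ Fintype.card V := by exact_mod_cast hn
  have hn0 : (0 : ℝ) < Fintype.card V := by linarith
  refine (allPairsMFC_prob _ rfl le_rfl ?_ le_rfl hB hg hn).trans ?_
  · simp only [constantsFor]; linarith
  rw [← ENNReal.ofReal_add (by positivity) (by positivity)]
  refine ENNReal.ofReal_le_ofReal ?_
  -- The constants make both failure exponents at most `-c - 1`; the spare factor `n ^ (-1) ≤ 1 / 2`
  -- absorbs the sum of the two terms.
  have h1 : (3 : ℝ) - (constantsFor c hc).cOuter / 900 = -c + -1 := by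
    simp only [constantsFor]; ring
  have h2 : (7 : ℝ) - (constantsFor c hc).cSample / 3 ≤ -c + -1 := by
    simp only [constantsFor]; linarith
  rw [h1]
  have h3 := Real.rpow_le_rpow_of_exponent_le (by linarith : (1 : ℝ) ≤ Fintype.card V) h2
  have h4 : (Fintype.card V : ℝ) ^ (-c + -1) ≤ (Fintype.card V : ℝ) ^ (-c) * (1 / 2) := by
    rw [Real.rpow_add hn0, Real.rpow_neg_one]
    refine mul_le_mul_of_nonneg_left ?_ (by positivity)
    rw [one_div]
    exact inv_anti₀ two_pos hn'
  linarith

end Main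

end ElectricCar

end

theorem mainTheorem7 (c : ℝ) (hc : 0 < c) :
    ∃ κ : ElectricCar.HiddenConstants,
      ∀ (V : Type*) [Fintype V] (G : Digraph V) (g : V → V → ℝ) (B : ℝ), 0 < B →
        (∀ x y : V, G.Adj x y → -B ≤ g x y ∧ g x y ≤ B) →
        ENNReal.ofReal (1 - (Fintype.card V : ℝ) ^ (-c)) ≤
          (ElectricCar.allPairsMFC κ G g B).toOuterMeasure
            {T | ∀ s t : V, T s t = ElectricCar.maxFinalCharge G g B B s t} :=
  ⟨ElectricCar.constantsFor c hc, fun _ _ _ _ _ hB hg =>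
    ElectricCar.allPairsMFC_constantsFor c hc hB.le hg⟩
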